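/- Let $n,T\ge 1$ be integers. Let $(\varepsilon_{i,t})_{1\le i\le n,\ t\in\mathbb Z}$ be independent real random variables with $\mathbb E[\varepsilon_{i,t}]=0$, $\mathbb E[\varepsilon_{i,t}^2]=1$ and $\mathbb E[|\varepsilon_{i,t}|^8]\le\kappa_8$, each having a Lebesgue density whose essential supremum is at most $M$. Let $\Psi_0,\Psi_1,\dots$ be real diagonal $n\times n$ matrices such that, for constants $b,B>0$ and every $j$, $$\Big|\sum_{k=0}^\infty(\Psi_k)_{jj}\Big|\ge b,\qquad \sum_{k=0}^\infty(1+k)\,|(\Psi_k)_{jj}|\le B .$$ Put $e_t=\sum_{k=0}^\infty\Psi_k\varepsilon_{t-k}$, where $\varepsilon_t=(\varepsilon_{1,t},\dots,\varepsilon_{n,t})'$, and let $\boldsymbol e_j=(e_{j,1},\dots,e_{j,T})$ be the $j$-th row of $[e_1,\dots,e_T]$. For $1\le k\le T-1$ let $$\sigma_k=\Big[2\sin\frac{\pi k}{2T}\Big]^{-1},\qquad v_{k,t}=\sqrt{\tfrac 2T}\,\sin\frac{\pi k(t-1)}{T}\quad(1\le t\le T),\qquad \boldsymbol e_j\boldsymbol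 v_k=\sum_{t=1}^T e_{j,t}v_{k,t},$$ $$M_{j,kk}=\frac{\sigma_k^2(\boldsymbol e_j\boldsymbol v_k)^2}{\sum_{t=1}^{T-1}\sigma_t^2(\boldsymbol e_j\boldsymbol v_t)^2},\qquad \mathcal M_{k,k}=\frac{k^{-2}Z_k^2}{\sum_{t=1}^\infty t^{-2}Z_t^2},$$ where $Z_1,Z_2,\dots$ are i.i.d. standard normal. Then there is a constant $C_{B,M,\kappa_8}>0$ depending only on $B,M,\kappa_8$ such that for all sufficiently large $T$ (that is, for all $T\ge T_0$ with $T_0$ depending only on $b,B,M,\kappa_8$), all $n\ge 1$, all $j\in\{1,\dots,n\}$ and all $k\in\{1,\dots,T-1\}$ (in particular, for all $k\le K$ when $K$ is fixed and $T>K$), the variables $M_{j,kk}$ and $\mathcal M_{k,k}$ are integrable and $$\big|\mathbb E[M_{j,kk}]-\mathbb E[\mathcal M_{k,k}]\big|\le C_{B,M,\kappa_8}\,T^{-1/2},$$ uniformly over all such noises and coefficient sequences. -/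

import Mathlib

open MeasureTheory ProbabilityTheory
open scoped Matrix

universe u v

namespace UnitRoot

noncomputable section

/-- The `n`-dimensional noise `ε = (ε_{i,t})`, with `i` a coordinate and `t ∈ ℤ` the time: the
`ε_{i,t}` are independent with mean `0` and variance `1`, have Lebesgue densities essentially
bounded by `M`, and eighth absolute moments bounded by `κ`. -/
structure IsNoise {Ω : Type*} [MeasurableSpace Ω] (μ : Measure Ω) (M κ : ℝ) {n : ℕ}
    (ε : Fin n → ℤ → Ω → ℝ) : Prop where
  indep : iIndepFun (fun p : Fin n × ℤ => ε p.1 p.2) μ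
  mean_zero : ∀ i t, ∫ ω, ε i t ω ∂μ = 0
  var_one : ∀ i t, ∫ ω, ε i t ω ^ 2 ∂μ = 1
  memLp : ∀ i t, MemLp (ε i t) 8 μ
  moment_le : ∀ i t, ∫ ω, |ε i t ω| ^ 8 ∂μ ≤ κ
  hasPDF : ∀ i t, HasPDF (ε i t) μ volume
  density_le : ∀ i t, essSup (pdf (ε i t) μ volume) volume ≤ ENNReal.ofReal M

/-- The coefficients `Ψ_0, Ψ_1, …` of a diagonal matrix lag polynomial with
`|∑_k (Ψ_k)_{jj}| ≥ b` and `∑_k (1 + k) |(Ψ_k)_{jj}| ≤ B` for every `j`. -/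
structure IsLagPolynomial (b B : ℝ) {n : ℕ} (Ψ : ℕ → Matrix (Fin n) (Fin n) ℝ) : Prop where
  diag : ∀ k, (Ψ k).IsDiag
  lower : ∀ j, b ≤ |∑' k : ℕ, Ψ k j j|
  summable : ∀ j, Summable fun k : ℕ => (1 + (k : ℝ)) * |Ψ k j j|
  upper : ∀ j, ∑' k : ℕ, (1 + (k : ℝ)) * |Ψ k j j| ≤ B

/-- The innovation `e_t = Ψ(L) ε_t = ∑_{k ≥ 0} Ψ_k ε_{t-k}`, a random vector in `ℝⁿ`
(the increment `X_t - X_{t-1}` of the observed series). -/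
def innovation {Ω : Type*} {n : ℕ} (Ψ : ℕ → Matrix (Fin n) (Fin n) ℝ)
    (ε : Fin n → ℤ → Ω → ℝ) (t : ℤ) (ω : Ω) : Fin n → ℝ :=
  fun j => ∑' k : ℕ, (Ψ k *ᵥ fun i => ε i (t - k) ω) j

/-- `σ_k = 1 / (2 sin (π k / (2T)))`, for `1 ≤ k ≤ T - 1`. -/
def sigma (T k : ℕ) : ℝ := (2 * Real.sin (Real.pi * k / (2 * T)))⁻¹

/-- The `t`-th coordinate of `v_k`, `v_{k,t} = √(2/T) sin (π k (t - 1) / T)`, for `1 ≤ t ≤ T`. -/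
def vCoord (T k t : ℕ) : ℝ :=
  Real.sqrt (2 / T) * Real.sin (Real.pi * k * ((t : ℝ) - 1) / T)

/-- `e_j v_k = ∑_{t=1}^T e_{j,t} v_{k,t}`, where `e_j` is the `j`-th row of `[e_1, …, e_T]`. -/
def fourierCoord {Ω : Type*} {n : ℕ} (Ψ : ℕ → Matrix (Fin n) (Fin n) ℝ)
    (ε : Fin n → ℤ → Ω → ℝ) (T : ℕ) (j : Fin n) (k : ℕ) (ω : Ω) : ℝ :=
  ∑ t ∈ Finset.Icc 1 T, innovation Ψ ε t ω j * vCoord T k t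

/-- `M_{j,kl} = σ_k σ_l (e_j v_k) (e_j v_l) / ∑_{t=1}^{T-1} σ_t² (e_j v_t)²`. -/
def ratio {Ω : Type*} {n : ℕ} (Ψ : ℕ → Matrix (Fin n) (Fin n) ℝ)
    (ε : Fin n → ℤ → Ω → ℝ) (T : ℕ) (j : Fin n) (k l : ℕ) (ω : Ω) : ℝ :=
  sigma T k * sigma T l * fourierCoord Ψ ε T j k ω * fourierCoord Ψ ε T j l ω /
    ∑ t ∈ Finset.Icc 1 (T - 1), sigma T t ^ 2 * fourierCoord Ψ ε T j t ω ^ 2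

/-- `𝓜_{k,l} = (k l)⁻¹ Z_k Z_l / ∑_{t ≥ 1} t⁻² Z_t²`. -/
def limitRatio {Ω : Type*} (Z : ℕ+ → Ω → ℝ) (k l : ℕ+) (ω : Ω) : ℝ :=
  ((k : ℝ) * (l : ℝ))⁻¹ * Z k ω * Z l ω / ∑' t : ℕ+, ((t : ℝ) ^ 2)⁻¹ * Z t ω ^ 2

end

end UnitRoot

/-! The expected ratio is compared with its limit through three replacements: the linear process by
its long-run multiple of the noise, the noise by Gaussian variables, and the finite weights by
`t⁻²`. All three ratios have the form `N / D` with `D = ∑ w_t y_t²` and `N = w_k y_k² ≤ D`, so they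
lie in `[0, 1]`; the only danger is a small `D`.

The middle replacement carries the rate. Regularise `D` to `D + δ` with `δ = T^(-1/2)` and write
`E[N / (D + δ)] = ∫ e^(-δl) E[N e^(-lD)] dl` over `l > 0` (`integral_div_add_eq`). The exponential
of a quadratic form is a Gaussian average of exponentials of linear forms: `e^(-lD)` is the mean of
`exp(i ∑ √(2 l w_t) y_t z_t)` over standard Gaussian `z`, and the extra factor `1 - z_k²` produces
`2 l N`. Each `y_t` is linear in independent noise, so for fixed `z` the mean over the noise is a
product of characteristic functions, close to its Gaussian counterpart by Taylor expansion with
third moments (`norm_prod_charFun_sub_le`). The frequencies are themselves Gaussian in `z` with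
variance `O(l / T)`, because each sine coordinate is `O(T^(-1/2))`. Summing over `T` factors gives
an error `O((1 + l²)⁻¹ T^(-1/2) + l² T⁻²)` for `E[N e^(-lD)]`, and integration in `l` gives
`O(T^(-1/2))` (`abs_integral_ratio_sub_le`). The same transforms bound the cost of `δ` and the
probability that `D` is small.

For the process, the Beveridge-Nelson decomposition writes `e_j v_k` as `p = ∑_l ψ_l`, where `ψ_l =
(Ψ_l)_{jj}`, times the noise coordinate, plus a remainder of second moment `O(σ_k⁻²)`, since `v_k`
varies slowly and vanishes at both ends. The factor `p` cancels in the ratio, and after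
normalisation the total error in `D` is `O(log T / T)`. For the limit, the weights `(π σ_t / T)²`
differ from `t⁻²` by `O(1 / T)` in total. Both comparisons use `abs_integral_ratio_compare` on the
event `D ≥ T^(-1/4)`, whose complement has probability `O(T^(-1/2))`. The constants `b` and `B`
multiply only terms of smaller order, `T^(-3/4) log T`, and are absorbed in `T₀`. -/

namespace UnitRoot

/-! ### Fourier integrals and moments of Gaussian measures -/

/-- The standard Gaussian measure on `ι → ℝ`. -/
noncomputable abbrev stdGauss (ι : Type*) [Fintype ι] : Measure (ι → ℝ) :=
  Measure.pi fun _ : ι => gaussianReal 0 1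

theorem integral_cexp_gaussianReal (a : ℝ) :
    ∫ z, Complex.exp (Complex.I * (a * z : ℝ)) ∂(gaussianReal 0 1) =
      (Real.exp (-(a ^ 2 / 2)) : ℂ) := by
  have h := charFun_gaussianReal (μ := 0) (v := 1) a
  rw [charFun_apply_real] at h
  push_cast at h ⊢
  convert h using 3
  · ring_nf
  · ring

/-- The second derivative of the complex moment generating function `exp (z² / 2)`, taken at `z = i
a`. -/
theorem integral_sq_mul_cexp_gaussianReal (a : ℝ) :
    ∫ z : ℝ, (z : ℂ) ^ 2 * Complex.exp (Complex.I * (a * z : ℝ)) ∂(gaussianReal 0 1) =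
      (1 - a ^ 2 : ℝ) * (Real.exp (-(a ^ 2 / 2)) : ℂ) := by
  have hz : (Complex.I * a).re ∈ interior (integrableExpSet id (gaussianReal 0 1)) := by
    simp [integrableExpSet_id_gaussianReal]
  have h := iteratedDeriv_complexMGF hz 2
  have hM : complexMGF id (gaussianReal 0 1) = fun z => Complex.exp (z ^ 2 / 2) := by
    ext z
    rw [complexMGF_id_gaussianReal]
    simp
  have h1 : deriv (fun z : ℂ => Complex.exp (z ^ 2 / 2)) =
      fun z => z * Complex.exp (z ^ 2 / 2) := by
    ext z
    have : HasDerivAt (fun z : ℂ => Complex.exp (z ^ 2 / 2))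
        (Complex.exp (z ^ 2 / 2) * ((2 : ℕ) * z ^ (2 - 1) / 2)) z :=
      ((hasDerivAt_pow 2 z).div_const 2).cexp
    rw [this.deriv]; push_cast; ring
  have h2 (z : ℂ) : deriv (fun z : ℂ => z * Complex.exp (z ^ 2 / 2)) z =
      (1 + z ^ 2) * Complex.exp (z ^ 2 / 2) := by
    have : HasDerivAt (fun z : ℂ => z * Complex.exp (z ^ 2 / 2)) (1 * Complex.exp (z ^ 2 / 2) +
        z * (Complex.exp (z ^ 2 / 2) * ((2 : ℕ) * z ^ (2 - 1) / 2))) z :=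
      (hasDerivAt_id z).mul ((hasDerivAt_pow 2 z).div_const 2).cexp
    rw [this.deriv]; push_cast; ring
  rw [hM, iteratedDeriv_succ, iteratedDeriv_one, h1, h2] at h
  push_cast
  have e : ∀ z : ℝ, (z : ℂ) ^ 2 * Complex.exp (Complex.I * (a * z)) =
      ((id z : ℝ) : ℂ) ^ 2 * Complex.exp (Complex.I * a * (id z : ℝ)) := by
    intro z; simp only [id]; ring_nf
  simp_rw [e]
  rw [← h, mul_pow, Complex.I_sq]
  ring_nf

theorem integrable_cexp_gaussianReal (a : ℝ) :
    Integrable (fun z : ℝ => Complex.exp (Complex.I * (a * z : ℝ))) (gaussianReal 0 1) := by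
  refine Integrable.of_bound (C := 1) (by fun_prop) (.of_forall fun z => ?_)
  rw [mul_comm, Complex.norm_exp_ofReal_mul_I]

theorem integrable_pow_gaussianReal (n : ℕ) :
    Integrable (fun z : ℝ => z ^ n) (gaussianReal 0 1) := by
  have h := memLp_id_gaussianReal (μ := 0) (v := 1) n
  have h' := h.integrable_norm_pow'
  refine h'.mono' (by fun_prop) (.of_forall fun z => ?_)
  simp

theorem integral_one_sub_sq_mul_cexp_gaussianReal (a : ℝ) :
    ∫ z : ℝ, ((1 - z ^ 2 : ℝ) : ℂ) * Complex.exp (Complex.I * (a * z : ℝ)) ∂(gaussianReal 0 1) =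
      (a ^ 2 * Real.exp (-(a ^ 2 / 2)) : ℝ) := by
  have e : ∀ z : ℝ, ((1 - z ^ 2 : ℝ) : ℂ) * Complex.exp (Complex.I * (a * z : ℝ)) =
      Complex.exp (Complex.I * (a * z : ℝ)) -
        (z : ℂ) ^ 2 * Complex.exp (Complex.I * (a * z : ℝ)) := by
    intro z; push_cast; ring
  simp_rw [e]
  rw [integral_sub (integrable_cexp_gaussianReal a), integral_cexp_gaussianReal,
    integral_sq_mul_cexp_gaussianReal]
  · push_cast; ring
  · refine (integrable_pow_gaussianReal 2).norm.mono' (by fun_prop) (.of_forall fun z => ?_)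
    rw [norm_mul, mul_comm Complex.I, Complex.norm_exp_ofReal_mul_I]
    simp

theorem integral_cexp_stdGauss {ι : Type*} [Fintype ι] (a : ι → ℝ) :
    ∫ z, Complex.exp (Complex.I * (∑ t, a t * z t : ℝ)) ∂(stdGauss ι) =
      (Real.exp (-((∑ t, a t ^ 2) / 2)) : ℂ) := by
  have e : ∀ z : ι → ℝ, Complex.exp (Complex.I * (∑ t, a t * z t : ℝ)) =
      ∏ t, Complex.exp (Complex.I * (a t * z t : ℝ)) := by
    intro z
    rw [← Complex.exp_sum, Complex.ofReal_sum, Finset.mul_sum]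
  simp_rw [e]
  rw [integral_fintype_prod_eq_prod (fun t (z : ℝ) => Complex.exp (Complex.I * (a t * z : ℝ)))]
  simp_rw [integral_cexp_gaussianReal]
  rw [← Complex.ofReal_prod, ← Real.exp_sum, Finset.sum_neg_distrib, Finset.sum_div]

/-- The multiplier `1 - z_k²` cancels the constant term and leaves the clean factor `a_k²`; this is
how the numerator of the ratio is generated. -/
theorem integral_one_sub_sq_mul_cexp_stdGauss {ι : Type*} [Fintype ι] [DecidableEq ι]
    (a : ι → ℝ) (k : ι) :
    ∫ z, ((1 - z k ^ 2 : ℝ) : ℂ) * Complex.exp (Complex.I * (∑ t, a t * z t : ℝ)) ∂(stdGauss ι) =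
      (a k ^ 2 * Real.exp (-((∑ t, a t ^ 2) / 2)) : ℝ) := by
  set f : ι → ℝ → ℂ := fun t z => (if t = k then ((1 - z ^ 2 : ℝ) : ℂ) else 1) *
    Complex.exp (Complex.I * (a t * z : ℝ)) with hf
  have e : ∀ z : ι → ℝ, ((1 - z k ^ 2 : ℝ) : ℂ) *
      Complex.exp (Complex.I * (∑ t, a t * z t : ℝ)) = ∏ t, f t (z t) := by
    intro z
    rw [hf, Finset.prod_mul_distrib, Finset.prod_ite_eq' Finset.univ k, ← Complex.exp_sum,
      Complex.ofReal_sum, Finset.mul_sum]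
    simp
  have g : ∀ t, ∫ z, f t z ∂(gaussianReal 0 1) =
      (if t = k then ((a k ^ 2 : ℝ) : ℂ) else 1) * (Real.exp (-(a t ^ 2 / 2)) : ℂ) := by
    intro t
    by_cases h : t = k
    · subst h
      simp only [hf, if_true]
      rw [integral_one_sub_sq_mul_cexp_gaussianReal]; push_cast; ring
    · simp only [hf, h, if_false, one_mul]
      rw [integral_cexp_gaussianReal]
  simp_rw [e]
  rw [integral_fintype_prod_eq_prod]
  simp_rw [g]
  rw [Finset.prod_mul_distrib, Finset.prod_ite_eq' Finset.univ k, ← Complex.ofReal_prod,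
    ← Real.exp_sum, Finset.sum_neg_distrib, Finset.sum_div]
  simp

theorem map_linear_stdGauss {ι : Type*} [Fintype ι] (a : ι → ℝ) :
    (stdGauss ι).map (fun z => ∑ t, a t * z t) = gaussianReal 0 (∑ t, a t ^ 2).toNNReal := by
  have : IsProbabilityMeasure ((stdGauss ι).map (fun z => ∑ t, a t * z t)) :=
    Measure.isProbabilityMeasure_map
      (by fun_prop : Measurable fun z : ι → ℝ => ∑ t, a t * z t).aemeasurable
  refine Measure.ext_of_charFun ?_
  ext u
  rw [charFun_gaussianReal, charFun_apply_real, integral_map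
    (by fun_prop : Measurable fun z : ι → ℝ => ∑ t, a t * z t).aemeasurable (by fun_prop)]
  have h := integral_cexp_stdGauss (fun t => u * a t)
  simp_rw [mul_assoc, ← Finset.mul_sum, mul_pow, ← Finset.mul_sum] at h
  convert h using 1
  · congr 1; ext z; congr 1; push_cast; ring
  · rw [Real.coe_toNNReal _ (Finset.sum_nonneg fun _ _ => sq_nonneg _)]
    push_cast
    congr 1; ring

/-- The twelfth moment of the standard normal law. -/
noncomputable def gaussTwelfth : ℝ := ∫ z : ℝ, z ^ 12 ∂(gaussianReal 0 1)

theorem gaussTwelfth_nonneg : 0 ≤ gaussTwelfth :=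
  integral_nonneg fun z => by positivity

theorem integral_pow_twelve_gaussianReal {v : ℝ} (hv : 0 ≤ v) :
    ∫ z : ℝ, z ^ 12 ∂(gaussianReal 0 v.toNNReal) = v ^ 6 * gaussTwelfth := by
  have h := gaussianReal_map_const_mul (μ := 0) (v := 1) (Real.sqrt v)
  have e : NNReal.mk (Real.sqrt v ^ 2) (sq_nonneg _) * 1 = v.toNNReal := by
    ext; simp [Real.sq_sqrt hv, hv]
  rw [mul_zero, e] at h
  rw [← h, integral_map (by fun_prop) (by fun_prop), gaussTwelfth, ← integral_const_mul]
  congr 1; ext z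
  rw [mul_pow, show (12 : ℕ) = 2 * 6 from rfl, pow_mul (Real.sqrt v), Real.sq_sqrt hv]

theorem integral_linear_pow_twelve {ι : Type*} [Fintype ι] (a : ι → ℝ) :
    ∫ z, (∑ t, a t * z t) ^ 12 ∂(stdGauss ι) = (∑ t, a t ^ 2) ^ 6 * gaussTwelfth := by
  rw [← integral_pow_twelve_gaussianReal (Finset.sum_nonneg fun _ _ => sq_nonneg _),
    ← map_linear_stdGauss, integral_map
    (by fun_prop : Measurable fun z : ι → ℝ => ∑ t, a t * z t).aemeasurable (by fun_prop)]

theorem integrable_linear_pow {ι : Type*} [Fintype ι] (a : ι → ℝ) (n : ℕ) :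
    Integrable (fun z => (∑ t, a t * z t) ^ n) (stdGauss ι) := by
  have h : Integrable (fun z : ℝ => z ^ n) ((stdGauss ι).map (fun z => ∑ t, a t * z t)) := by
    rw [map_linear_stdGauss]
    have h' := (memLp_id_gaussianReal (μ := 0) (v := (∑ t, a t ^ 2).toNNReal) n).integrable_norm_pow'
    refine h'.mono' (by fun_prop) (.of_forall fun z => ?_)
    simp
  exact h.comp_measurable (by fun_prop)

theorem integral_exp_neg_mul_sq_gaussianReal {a : ℝ} (ha : 0 ≤ a) :
    ∫ z : ℝ, Real.exp (-(a * z ^ 2)) ∂(gaussianReal 0 1) = (Real.sqrt (1 + 2 * a))⁻¹ := by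
  rw [integral_gaussianReal_eq_integral_smul (by simp)]
  have e : ∀ z : ℝ, gaussianPDFReal 0 1 z • Real.exp (-(a * z ^ 2)) =
      (Real.sqrt (2 * Real.pi))⁻¹ * Real.exp (-(1 / 2 + a) * z ^ 2) := by
    intro z
    rw [gaussianPDFReal, smul_eq_mul, mul_assoc, ← Real.exp_add]
    simp only [NNReal.coe_one, mul_one, sub_zero]
    congr 2; ring
  simp_rw [e]
  rw [integral_const_mul, integral_gaussian, ← Real.sqrt_inv, ← Real.sqrt_mul (by positivity),
    ← Real.sqrt_inv]
  congr 1
  have := Real.pi_pos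
  field_simp

/-! ### Products of characteristic functions against their Gaussian counterparts -/

/-- Factors are exchanged one at a time. Keeping the majorants `r s` rather than bounding factors by
`1` preserves the Gaussian decay of the whole product. -/
theorem norm_prod_sub_prod_le {σ : Type*} (S : Finset σ) {f g : σ → ℂ} {r : σ → ℝ}
    (hr : ∀ s, 0 < r s) (hf : ∀ s ∈ S, ‖f s‖ ≤ r s) (hg : ∀ s ∈ S, ‖g s‖ ≤ r s) :
    ‖∏ s ∈ S, f s - ∏ s ∈ S, g s‖ ≤ (∏ s ∈ S, r s) * ∑ s ∈ S, ‖f s - g s‖ / r s := by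
  classical
  induction S using Finset.induction_on with
  | empty => simp
  | insert a S ha ih =>
    rw [Finset.prod_insert ha, Finset.prod_insert ha, Finset.prod_insert ha, Finset.sum_insert ha]
    have ih' := ih (fun s hs => hf s (Finset.mem_insert_of_mem hs))
      (fun s hs => hg s (Finset.mem_insert_of_mem hs))
    have h1 : ‖∏ s ∈ S, f s‖ ≤ ∏ s ∈ S, r s := by
      rw [norm_prod]
      exact Finset.prod_le_prod (fun _ _ => norm_nonneg _)
        (fun s hs => hf s (Finset.mem_insert_of_mem hs))
    have h2 : f a * ∏ s ∈ S, f s - g a * ∏ s ∈ S, g s =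
        (f a - g a) * ∏ s ∈ S, f s + g a * (∏ s ∈ S, f s - ∏ s ∈ S, g s) := by ring
    rw [h2]
    refine (norm_add_le _ _).trans ?_
    rw [norm_mul, norm_mul, mul_add]
    have h3 : r a * (∏ s ∈ S, r s) * (‖f a - g a‖ / r a) = ‖f a - g a‖ * ∏ s ∈ S, r s := by
      have := hr a
      field_simp
    rw [h3, mul_assoc]
    refine add_le_add (mul_le_mul_of_nonneg_left h1 (norm_nonneg _)) ?_
    exact mul_le_mul (hg a (Finset.mem_insert_self _ _)) ih' (norm_nonneg _) (hr a).le

/-- A centred probability law with unit variance and third absolute moment at most `β`. -/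
structure IsStdLaw (β : ℝ) (ρ : Measure ℝ) : Prop where
  prob : IsProbabilityMeasure ρ
  integrable_cube : Integrable (fun x : ℝ => |x| ^ 3) ρ
  mean : ∫ x, x ∂ρ = 0
  var : ∫ x, x ^ 2 ∂ρ = 1
  cube_le : ∫ x, |x| ^ 3 ∂ρ ≤ β

theorem IsStdLaw.nonneg {β : ℝ} {ρ : Measure ℝ} (h : IsStdLaw β ρ) : 0 ≤ β :=
  (integral_nonneg fun x => by positivity).trans h.cube_le

theorem IsStdLaw.integrable_sq {β : ℝ} {ρ : Measure ℝ} (h : IsStdLaw β ρ) :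
    Integrable (fun x : ℝ => x ^ 2) ρ := by
  have := h.prob
  refine ((integrable_const (1 : ℝ)).add h.integrable_cube).mono' (by fun_prop)
    (.of_forall fun x => ?_)
  simp only [norm_pow, Real.norm_eq_abs, Pi.add_apply]
  have := abs_nonneg x
  nlinarith [sq_nonneg (|x| - 1), mul_nonneg this (sq_nonneg (|x| - 1))]

theorem IsStdLaw.integrable_id {β : ℝ} {ρ : Measure ℝ} (h : IsStdLaw β ρ) :
    Integrable (fun x : ℝ => x) ρ := by
  have := h.prob
  refine ((integrable_const (1 : ℝ)).add h.integrable_sq).mono' (by fun_prop)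
    (.of_forall fun x => ?_)
  simp only [Real.norm_eq_abs, Pi.add_apply]
  rw [← sq_abs]
  nlinarith [sq_nonneg (|x| - 1), abs_nonneg x]

theorem norm_cexp_sub_quadratic_le (y : ℝ) :
    ‖Complex.exp (Complex.I * (y : ℝ)) - (1 + Complex.I * y - (y : ℂ) ^ 2 / 2)‖ ≤ 4 * |y| ^ 3 := by
  -- Beyond `|y| = 1` no cancellation is needed: every term is at most a multiple of `|y| ^ 3`.
  rcases le_or_gt |y| 1 with h | h
  · have hb := Complex.exp_bound (x := Complex.I * y) (by simpa using h) (n := 3) (by norm_num)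
    have e : ∑ m ∈ Finset.range 3, (Complex.I * y) ^ m / (m.factorial : ℂ) =
        1 + Complex.I * y - (y : ℂ) ^ 2 / 2 := by
      simp [Finset.sum_range_succ, mul_pow, Nat.factorial]
      ring
    rw [e] at hb
    refine hb.trans ?_
    simp only [norm_mul, Complex.norm_I, one_mul, Complex.norm_real, Real.norm_eq_abs]
    norm_num [Nat.factorial]
    nlinarith [pow_nonneg (abs_nonneg y) 3]
  · have h1 : ‖Complex.exp (Complex.I * (y : ℝ))‖ = 1 := by
      rw [mul_comm, Complex.norm_exp_ofReal_mul_I]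
    have h2 : ‖(1 + Complex.I * y - (y : ℂ) ^ 2 / 2)‖ ≤ 1 + |y| + |y| ^ 2 / 2 := by
      refine (norm_sub_le _ _).trans (add_le_add ((norm_add_le _ _).trans ?_) ?_)
      · simp
      · simp
    refine (norm_sub_le _ _).trans ?_
    rw [h1]
    have h3 : |y| ^ 2 ≤ |y| ^ 3 := pow_le_pow_right₀ h.le (by norm_num)
    nlinarith

theorem IsStdLaw.norm_charFun_sub_le {β : ℝ} {ρ : Measure ℝ} (h : IsStdLaw β ρ) (u : ℝ) :
    ‖(∫ x : ℝ, Complex.exp (Complex.I * (u * x : ℝ)) ∂ρ) - (1 - u ^ 2 / 2 : ℝ)‖ ≤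
      4 * β * |u| ^ 3 := by
  have := h.prob
  have i1 : Integrable (fun x : ℝ => Complex.exp (Complex.I * (u * x : ℝ))) ρ := by
    refine Integrable.of_bound (C := 1) (by fun_prop) (.of_forall fun z => ?_)
    rw [mul_comm, Complex.norm_exp_ofReal_mul_I]
  have i2 : Integrable (fun x : ℝ => (1 + Complex.I * (u * x : ℝ) - ((u * x : ℝ) : ℂ) ^ 2 / 2)) ρ := by
    refine ((integrable_const _).add (((h.integrable_id.const_mul u).ofReal).const_mul _)).sub ?_
    have := ((h.integrable_sq.const_mul (u ^ 2)).ofReal (𝕜 := ℂ)).div_const 2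
    refine this.congr (.of_forall fun x => ?_)
    simp [mul_pow]
  have e : ∫ x : ℝ, (1 + Complex.I * (u * x : ℝ) - ((u * x : ℝ) : ℂ) ^ 2 / 2) ∂ρ =
      ((1 - u ^ 2 / 2 : ℝ) : ℂ) := by
    have e1 : ∀ x : ℝ, (1 + Complex.I * (u * x : ℝ) - ((u * x : ℝ) : ℂ) ^ 2 / 2) =
        1 + (Complex.I * u) * (x : ℝ) - ((u ^ 2 / 2 : ℝ) : ℂ) * ((x ^ 2 : ℝ) : ℂ) := by
      intro x; push_cast; ring
    simp_rw [e1]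
    rw [integral_sub ((integrable_const _).add (h.integrable_id.ofReal.const_mul _))
      (h.integrable_sq.ofReal.const_mul _), integral_add (integrable_const _)
      (h.integrable_id.ofReal.const_mul _), integral_const_mul, integral_const_mul,
      integral_complex_ofReal, integral_complex_ofReal, h.mean, h.var]
    simp
  rw [← e, ← integral_sub i1 i2]
  refine (norm_integral_le_integral_norm _).trans ?_
  calc _ ≤ ∫ x : ℝ, 4 * |u| ^ 3 * |x| ^ 3 ∂ρ := by
        refine integral_mono (i1.sub i2).norm (h.integrable_cube.const_mul _) fun x => ?_
        refine (norm_cexp_sub_quadratic_le (u * x)).trans_eq ?_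
        rw [abs_mul, mul_pow]; ring
    _ ≤ _ := by
        rw [integral_const_mul]
        nlinarith [mul_le_mul_of_nonneg_left h.cube_le (by positivity : 0 ≤ 4 * |u| ^ 3)]

theorem norm_integral_cexp_le_one {ρ : Measure ℝ} [IsProbabilityMeasure ρ] (u : ℝ) :
    ‖(∫ x : ℝ, Complex.exp (Complex.I * (u * x : ℝ)) ∂ρ)‖ ≤ 1 := by
  refine (norm_integral_le_integral_norm _).trans_eq ?_
  have : ∀ x : ℝ, ‖Complex.exp (Complex.I * (u * x : ℝ))‖ = 1 := fun x => by
    rw [mul_comm, Complex.norm_exp_ofReal_mul_I]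
  simp_rw [this]
  simp

theorem IsStdLaw.norm_charFun_sub_exp_le {β : ℝ} {ρ : Measure ℝ} (h : IsStdLaw β ρ) {u : ℝ}
    (hu : |u| ≤ 1) :
    ‖(∫ x : ℝ, Complex.exp (Complex.I * (u * x : ℝ)) ∂ρ) - (Real.exp (-(u ^ 2 / 2)) : ℝ)‖ ≤
      (4 * β + 1) * |u| ^ 3 := by
  have h1 := h.norm_charFun_sub_le u
  have hu2 : u ^ 2 ≤ 1 := by rw [← sq_abs]; exact pow_le_one₀ (abs_nonneg _) hu
  have h2 : |Real.exp (-(u ^ 2 / 2)) - 1 - (-(u ^ 2 / 2))| ≤ (-(u ^ 2 / 2)) ^ 2 :=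
    Real.abs_exp_sub_one_sub_id_le (by rw [abs_neg, abs_of_nonneg (by positivity)]; linarith)
  have h3 : (-(u ^ 2 / 2)) ^ 2 ≤ |u| ^ 3 := by
    rw [neg_sq, div_pow, ← pow_mul, ← Even.pow_abs (by decide)]
    have : |u| ^ (2 * 2) ≤ |u| ^ 3 := pow_le_pow_of_le_one (abs_nonneg _) hu (by norm_num)
    nlinarith [pow_nonneg (abs_nonneg u) (2 * 2)]
  have h4 : ‖((1 - u ^ 2 / 2 : ℝ) : ℂ) - (Real.exp (-(u ^ 2 / 2)) : ℝ)‖ ≤ |u| ^ 3 := by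
    rw [← Complex.ofReal_sub, Complex.norm_real, Real.norm_eq_abs, abs_sub_comm]
    refine (le_of_eq ?_).trans (h2.trans h3)
    congr 1; ring
  have := (norm_sub_le_norm_sub_add_norm_sub _ ((1 - u ^ 2 / 2 : ℝ) : ℂ) _).trans (add_le_add h1 h4)
  refine this.trans_eq (by ring)

/-- The threshold makes the Taylor error `4 β |u|³` at most `u² / 4`, so half of the quadratic
decrease `u² / 2` survives. -/
theorem IsStdLaw.norm_charFun_le_exp {β : ℝ} {ρ : Measure ℝ} (h : IsStdLaw β ρ) {u : ℝ}
    (hu : |u| ≤ (16 * β + 1)⁻¹) :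
    ‖(∫ x : ℝ, Complex.exp (Complex.I * (u * x : ℝ)) ∂ρ)‖ ≤ Real.exp (-(u ^ 2 / 4)) := by
  have h0 := h.nonneg
  have hb : |u| * (16 * β + 1) ≤ 1 := by
    rwa [inv_eq_one_div, le_div_iff₀ (by positivity)] at hu
  have hu1 : |u| ≤ 1 := by nlinarith [abs_nonneg u, mul_nonneg (abs_nonneg u) h0]
  have hu2 : u ^ 2 ≤ 1 := by rw [← sq_abs]; exact pow_le_one₀ (abs_nonneg _) hu1
  have h1 := h.norm_charFun_sub_le u
  have h2 : ‖((1 - u ^ 2 / 2 : ℝ) : ℂ)‖ = 1 - u ^ 2 / 2 := by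
    rw [Complex.norm_real, Real.norm_eq_abs, abs_of_nonneg (by linarith)]
  have h3 : 4 * β * |u| ^ 3 ≤ u ^ 2 / 4 := by
    rw [← sq_abs u]
    nlinarith [mul_le_mul_of_nonneg_left hb (sq_nonneg |u|), pow_nonneg (abs_nonneg u) 3]
  have h4 := norm_sub_norm_le (∫ x : ℝ, Complex.exp (Complex.I * (u * x : ℝ)) ∂ρ)
    ((1 - u ^ 2 / 2 : ℝ) : ℂ)
  have h5 := Real.add_one_le_exp (-(u ^ 2 / 4))
  linarith

/-- The constant of `norm_prod_charFun_sub_le`. -/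
noncomputable def prodConst (β : ℝ) : ℝ := 2 * (4 * β + 1) + 2 * (16 * β + 1) ^ 6

/-- If all frequencies are below the threshold, the exchange argument gives the cubic term with
Gaussian decay. Otherwise some `(16 β + 1) |θ s|` exceeds `1`, and its sixth power dominates the
trivial bound `2`. The sixth power is what later makes this rare case of order `T⁻²`. -/
theorem norm_prod_charFun_sub_le {σ : Type*} [Fintype σ] {β : ℝ} (hβ : 0 ≤ β) {ρ : σ → Measure ℝ}
    (h : ∀ s, IsStdLaw β (ρ s)) (θ : σ → ℝ) :
    ‖(∏ s, ∫ x : ℝ, Complex.exp (Complex.I * (θ s * x : ℝ)) ∂(ρ s)) -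
        (Real.exp (-((∑ s, θ s ^ 2) / 2)) : ℝ)‖ ≤
      prodConst β * (∑ s, |θ s| ^ 3 * Real.exp (-((∑ s, θ s ^ 2) / 4)) + ∑ s, θ s ^ 6) := by
  have e1 : (Real.exp (-((∑ s, θ s ^ 2) / 2)) : ℂ) = ∏ s, (Real.exp (-(θ s ^ 2 / 2)) : ℂ) := by
    rw [← Complex.ofReal_prod, ← Real.exp_sum, Finset.sum_neg_distrib, Finset.sum_div]
  have hA : 0 ≤ ∑ s, |θ s| ^ 3 * Real.exp (-((∑ s, θ s ^ 2) / 4)) :=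
    Finset.sum_nonneg fun s _ => by positivity
  have hB : 0 ≤ ∑ s, θ s ^ 6 := Finset.sum_nonneg fun s _ => by positivity
  by_cases hg : ∀ s, |θ s| ≤ (16 * β + 1)⁻¹
  · have hle : ∀ s, |θ s| ≤ 1 := fun s => (hg s).trans (inv_le_one_of_one_le₀ (by linarith))
    rw [e1]
    have := norm_prod_sub_prod_le Finset.univ
      (f := fun s => ∫ x : ℝ, Complex.exp (Complex.I * (θ s * x : ℝ)) ∂(ρ s))
      (g := fun s => (Real.exp (-(θ s ^ 2 / 2)) : ℂ)) (r := fun s => Real.exp (-(θ s ^ 2 / 4)))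
      (fun s => Real.exp_pos _) (fun s _ => (h s).norm_charFun_le_exp (hg s)) (fun s _ => by
        rw [Complex.norm_real, Real.norm_eq_abs, abs_of_pos (Real.exp_pos _)]
        exact Real.exp_le_exp.2 (by nlinarith [sq_nonneg (θ s)]))
    refine this.trans ?_
    have e2 : ∏ s, Real.exp (-(θ s ^ 2 / 4)) = Real.exp (-((∑ s, θ s ^ 2) / 4)) := by
      rw [← Real.exp_sum, Finset.sum_neg_distrib, Finset.sum_div]
    rw [e2]
    have h6 : ∀ s, ‖(∫ x : ℝ, Complex.exp (Complex.I * (θ s * x : ℝ)) ∂(ρ s)) -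
        (Real.exp (-(θ s ^ 2 / 2)) : ℝ)‖ / Real.exp (-(θ s ^ 2 / 4)) ≤
        2 * (4 * β + 1) * |θ s| ^ 3 := by
      intro s
      rw [div_le_iff₀ (Real.exp_pos _)]
      have h7 := (h s).norm_charFun_sub_exp_le (hle s)
      -- Dividing by the majorant costs at most a factor `2`, the one in the first term of
      -- `prodConst`.
      have h8 : (1 : ℝ) / 2 ≤ Real.exp (-(θ s ^ 2 / 4)) := by
        have := Real.add_one_le_exp (-(θ s ^ 2 / 4))
        have : θ s ^ 2 ≤ 1 := by rw [← sq_abs]; exact pow_le_one₀ (abs_nonneg _) (hle s)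
        linarith
      have h9 : 0 ≤ (4 * β + 1) * |θ s| ^ 3 := by positivity
      nlinarith
    calc _ ≤ Real.exp (-((∑ s, θ s ^ 2) / 4)) * ∑ s, 2 * (4 * β + 1) * |θ s| ^ 3 :=
          mul_le_mul_of_nonneg_left (Finset.sum_le_sum fun s _ => h6 s) (Real.exp_pos _).le
      _ = 2 * (4 * β + 1) * ∑ s, |θ s| ^ 3 * Real.exp (-((∑ s, θ s ^ 2) / 4)) := by
          rw [← Finset.mul_sum, ← Finset.sum_mul]; ring
      _ ≤ _ := by
          rw [prodConst]
          have : 0 ≤ 2 * (16 * β + 1) ^ 6 := by positivity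
          have : 0 ≤ 2 * (4 * β + 1) := by positivity
          nlinarith [mul_nonneg ‹0 ≤ 2 * (16 * β + 1) ^ 6› hA,
            mul_nonneg ‹0 ≤ 2 * (16 * β + 1) ^ 6› hB, mul_nonneg ‹0 ≤ 2 * (4 * β + 1)› hB]
  · push Not at hg
    obtain ⟨s, hs⟩ := hg
    have h1 : ‖(∏ s, ∫ x : ℝ, Complex.exp (Complex.I * (θ s * x : ℝ)) ∂(ρ s))‖ ≤ 1 := by
      rw [norm_prod]
      refine Finset.prod_le_one (fun _ _ => norm_nonneg _) fun s _ => ?_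
      have := (h s).prob
      exact norm_integral_cexp_le_one _
    have h2 : ‖((Real.exp (-((∑ s, θ s ^ 2) / 2)) : ℝ) : ℂ)‖ ≤ 1 := by
      rw [Complex.norm_real, Real.norm_eq_abs, abs_of_pos (Real.exp_pos _), Real.exp_le_one_iff]
      have := Finset.sum_nonneg fun s (_ : s ∈ Finset.univ) => sq_nonneg (θ s)
      linarith
    have h3 : 1 ≤ (16 * β + 1) ^ 6 * θ s ^ 6 := by
      rw [← Even.pow_abs (by decide : Even 6) (θ s), ← mul_pow]
      refine one_le_pow₀ ?_
      rw [inv_lt_iff_one_lt_mul₀ (by positivity)] at hs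
      linarith
    have h4 : θ s ^ 6 ≤ ∑ s, θ s ^ 6 :=
      Finset.single_le_sum (f := fun s => θ s ^ 6) (fun _ _ => by positivity) (Finset.mem_univ s)
    refine (norm_sub_le _ _).trans ?_
    have h5 : 0 ≤ (16 * β + 1) ^ 6 := by positivity
    have h6 := mul_le_mul_of_nonneg_left h4 h5
    rw [prodConst]
    nlinarith [mul_nonneg h5 hA, mul_nonneg (by positivity : 0 ≤ 4 * β + 1) hB,
      mul_nonneg (by positivity : 0 ≤ 4 * β + 1) hA]

/-! ### Linearisation by an auxiliary Gaussian vector -/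

theorem integrable_mul_of_sq {α : Type*} [MeasurableSpace α] {μ : Measure α} {f g : α → ℝ}
    (hf : AEStronglyMeasurable f μ) (hg : AEStronglyMeasurable g μ)
    (hf2 : Integrable (fun x => f x ^ 2) μ) (hg2 : Integrable (fun x => g x ^ 2) μ) :
    Integrable (fun x => f x * g x) μ :=
  ((memLp_two_iff_integrable_sq hf).2 hf2).integrable_mul ((memLp_two_iff_integrable_sq hg).2 hg2)

theorem integral_mul_le_sqrt_mul_sqrt {α : Type*} [MeasurableSpace α] {μ : Measure α} {f g : α → ℝ}
    (hf : AEStronglyMeasurable f μ) (hg : AEStronglyMeasurable g μ)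
    (hf0 : ∀ x, 0 ≤ f x) (hg0 : ∀ x, 0 ≤ g x)
    (hf2 : Integrable (fun x => f x ^ 2) μ) (hg2 : Integrable (fun x => g x ^ 2) μ) :
    ∫ x, f x * g x ∂μ ≤ √(∫ x, f x ^ 2 ∂μ) * √(∫ x, g x ^ 2 ∂μ) := by
  have h := integral_mul_le_Lp_mul_Lq_of_nonneg (μ := μ) Real.HolderConjugate.two_two
    (f := f) (g := g) (.of_forall hf0) (.of_forall hg0)
    (by simpa using (memLp_two_iff_integrable_sq hf).2 hf2)
    (by simpa using (memLp_two_iff_integrable_sq hg).2 hg2)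
  simpa [Real.sqrt_eq_rpow] using h

/-- The linearised functional: `z ↦ ∫ h(z) exp(i ∑ a_t y_t z_t)` under the Gaussian measure. -/
noncomputable def linearised {ι : Type*} [Fintype ι] (h : (ι → ℝ) → ℝ) (a y : ι → ℝ) : ℂ :=
  ∫ z, (h z : ℂ) * Complex.exp (Complex.I * (∑ t, (a t * y t) * z t : ℝ)) ∂(stdGauss ι)

/-- By Fubini the noise is integrated first; for fixed `z` the exponent is linear in `x`, so
independence factorises the integral. -/
theorem integral_linearised {ι σ : Type*} [Fintype ι] [Fintype σ] {h : (ι → ℝ) → ℝ}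
    (hh : Integrable h (stdGauss ι)) (a : ι → ℝ) (v : ι → σ → ℝ) (ρ : σ → Measure ℝ)
    [∀ s, IsProbabilityMeasure (ρ s)] :
    ∫ x, linearised h a (fun t => ∑ s, x s * v t s) ∂(Measure.pi ρ) =
      ∫ z, (h z : ℂ) * ∏ s, ∫ x : ℝ, Complex.exp (Complex.I * ((∑ t, a t * v t s * z t) * x : ℝ))
        ∂(ρ s) ∂(stdGauss ι) := by
  simp only [linearised]
  rw [integral_integral_swap]
  · refine integral_congr_ae (.of_forall fun z => ?_)
    simp only
    rw [integral_const_mul, ← integral_fintype_prod_eq_prod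
      (fun s (x : ℝ) => Complex.exp (Complex.I * ((∑ t, a t * v t s * z t) * x : ℝ)))]
    congr 1
    refine integral_congr_ae (.of_forall fun x => ?_)
    simp only
    rw [← Complex.exp_sum, ← Finset.mul_sum, ← Complex.ofReal_sum]
    congr 3
    simp_rw [Finset.mul_sum, Finset.sum_mul]
    rw [Finset.sum_comm]
    exact Finset.sum_congr rfl fun s _ => Finset.sum_congr rfl fun t _ => by ring
  · refine (hh.norm.comp_snd (Measure.pi ρ)).mono' ?_ (.of_forall fun p => ?_)
    · refine (Complex.continuous_ofReal.comp_aestronglyMeasurable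
        (hh.aestronglyMeasurable.comp_snd (ν := stdGauss ι))).mul ?_
      exact (by fun_prop : Continuous fun p : (σ → ℝ) × (ι → ℝ) =>
        Complex.exp (Complex.I * (∑ t, (a t * ∑ s, p.1 s * v t s) * p.2 t : ℝ))).aestronglyMeasurable
    · simp only [Function.uncurry]
      rw [norm_mul, mul_comm Complex.I, Complex.norm_exp_ofReal_mul_I, mul_one, Complex.norm_real]

/-- The case of Gaussian noise with the identity matrix as `v`. -/
theorem integral_linearised_gauss {ι : Type*} [Fintype ι] {h : (ι → ℝ) → ℝ}
    (hh : Integrable h (stdGauss ι)) (a : ι → ℝ) :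
    ∫ y, linearised h a y ∂(stdGauss ι) =
      ∫ z, (h z : ℂ) * (Real.exp (-((∑ t, (a t * z t) ^ 2) / 2)) : ℝ) ∂(stdGauss ι) := by
  classical
  have := integral_linearised hh a (fun t s => if t = s then (1 : ℝ) else 0)
    (fun _ => gaussianReal 0 1)
  simp only [mul_ite, mul_one, mul_zero, Finset.sum_ite_eq, Finset.mem_univ, if_true, ite_mul,
    zero_mul, Finset.sum_ite_eq'] at this
  rw [this]
  refine integral_congr_ae (.of_forall fun z => ?_)
  simp only
  simp_rw [integral_cexp_gaussianReal]
  rw [← Complex.ofReal_prod, ← Real.exp_sum, Finset.sum_neg_distrib, Finset.sum_div]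

theorem sum_sq_of_orthonormal {ι σ : Type*} [Fintype ι] [Fintype σ] [DecidableEq ι] {v : ι → σ → ℝ}
    (hv : ∀ t t', ∑ s, v t s * v t' s = if t = t' then 1 else 0) (c : ι → ℝ) :
    ∑ s, (∑ t, c t * v t s) ^ 2 = ∑ t, c t ^ 2 := by
  have e : ∀ s, (∑ t, c t * v t s) ^ 2 = ∑ t, ∑ t', c t * c t' * (v t s * v t' s) := by
    intro s
    rw [sq, Finset.sum_mul_sum]
    exact Finset.sum_congr rfl fun _ _ => Finset.sum_congr rfl fun _ _ => by ring
  simp_rw [e]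
  rw [Finset.sum_comm]
  refine Finset.sum_congr rfl fun t _ => ?_
  rw [Finset.sum_comm]
  simp_rw [← Finset.mul_sum, hv]
  simp [sq]

section moments

variable {ι σ : Type*} [Fintype ι] {h θ : (ι → ℝ) → ℝ} {H r q : ℝ}

theorem integral_abs_mul_pow_six_le
    (hm : AEStronglyMeasurable h (stdGauss ι)) (h2 : Integrable (fun z => h z ^ 2) (stdGauss ι))
    (hH : ∫ z, h z ^ 2 ∂(stdGauss ι) ≤ H) (c : ι → ℝ) (hc : ∑ t, c t ^ 2 ≤ r ^ 2) :
    Integrable (fun z => |h z| * (∑ t, c t * z t) ^ 6) (stdGauss ι) ∧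
    ∫ z, |h z| * (∑ t, c t * z t) ^ 6 ∂(stdGauss ι) ≤ √H * √gaussTwelfth * r ^ 6 := by
  have i12 := integrable_linear_pow c 12
  have e12 : ∀ z : ι → ℝ, ((∑ t, c t * z t) ^ 6) ^ 2 = (∑ t, c t * z t) ^ 12 := fun z => by
    rw [← pow_mul]
  have hcm : AEStronglyMeasurable (fun z : ι → ℝ => (∑ t, c t * z t) ^ 6) (stdGauss ι) :=
    (by fun_prop : Continuous fun z : ι → ℝ => (∑ t, c t * z t) ^ 6).aestronglyMeasurable
  refine ⟨integrable_mul_of_sq hm.norm hcm (by simpa using h2) (by simpa [e12] using i12), ?_⟩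
  refine (integral_mul_le_sqrt_mul_sqrt hm.norm hcm (fun _ => norm_nonneg _)
    (fun _ => by positivity) (by simpa using h2) (by simpa [e12] using i12)).trans ?_
  simp_rw [e12, integral_linear_pow_twelve]
  simp only [Real.norm_eq_abs, sq_abs]
  rw [mul_assoc]
  refine mul_le_mul (Real.sqrt_le_sqrt hH) ?_ (Real.sqrt_nonneg _) (Real.sqrt_nonneg _)
  rw [Real.sqrt_mul' _ gaussTwelfth_nonneg, mul_comm]
  refine mul_le_mul_of_nonneg_left ?_ (Real.sqrt_nonneg _)
  rw [Real.sqrt_le_left (by positivity), ← pow_mul, mul_comm 6 2, pow_mul]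
  exact pow_le_pow_left₀ (Finset.sum_nonneg fun _ _ => sq_nonneg _) hc 6

/-- Cauchy-Schwarz separates `g`, which carries the decay in `l`; the remaining square `h² θ⁶` is
the sixth-power bound applied to `h²`, hence the fourth moment of `h`. -/
theorem integral_abs_mul_pow_three_le
    (hm : AEStronglyMeasurable h (stdGauss ι)) (h4 : Integrable (fun z => h z ^ 4) (stdGauss ι))
    (hH : ∫ z, h z ^ 4 ∂(stdGauss ι) ≤ H) (hr : 0 ≤ r) (c : ι → ℝ) (hc : ∑ t, c t ^ 2 ≤ r ^ 2)
    {g : (ι → ℝ) → ℝ} (hg : AEStronglyMeasurable g (stdGauss ι)) (hg0 : ∀ z, 0 ≤ g z)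
    (hg2 : Integrable (fun z => g z ^ 2) (stdGauss ι)) :
    Integrable (fun z => |h z| * |∑ t, c t * z t| ^ 3 * g z) (stdGauss ι) ∧
    ∫ z, |h z| * |∑ t, c t * z t| ^ 3 * g z ∂(stdGauss ι) ≤
      √(√H * √gaussTwelfth) * r ^ 3 * √(∫ z, g z ^ 2 ∂(stdGauss ι)) := by
  have hm2 : AEStronglyMeasurable (fun z => h z ^ 2) (stdGauss ι) := hm.pow 2
  have h4' : Integrable (fun z => (h z ^ 2) ^ 2) (stdGauss ι) := by simpa [← pow_mul] using h4
  have hH' : ∫ z, (h z ^ 2) ^ 2 ∂(stdGauss ι) ≤ H := by simpa [← pow_mul] using hH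
  have hb := integral_abs_mul_pow_six_le hm2 h4' hH' c hc
  have e : ∀ z, (|h z| * |∑ t, c t * z t| ^ 3) ^ 2 = |h z ^ 2| * (∑ t, c t * z t) ^ 6 := by
    intro z
    rw [mul_pow, ← pow_mul, Even.pow_abs (by decide : Even (3 * 2)), abs_pow]
  have hcm : AEStronglyMeasurable (fun z => |h z| * |∑ t, c t * z t| ^ 3) (stdGauss ι) :=
    hm.norm.mul (by fun_prop :
      Continuous fun z : ι → ℝ => |∑ t, c t * z t| ^ 3).aestronglyMeasurable
  have hi : Integrable (fun z => (|h z| * |∑ t, c t * z t| ^ 3) ^ 2) (stdGauss ι) := by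
    simp_rw [e]; exact hb.1
  refine ⟨integrable_mul_of_sq hcm hg hi hg2, ?_⟩
  refine (integral_mul_le_sqrt_mul_sqrt hcm hg (fun _ => by positivity) hg0 hi hg2).trans ?_
  refine mul_le_mul_of_nonneg_right ?_ (Real.sqrt_nonneg _)
  simp_rw [e]
  refine (Real.sqrt_le_sqrt hb.2).trans_eq ?_
  rw [Real.sqrt_mul' _ (by positivity), show r ^ 6 = (r ^ 3) ^ 2 by ring,
    Real.sqrt_sq (by positivity)]

end moments

/-- The constant of `norm_integral_linearised_sub_le`. -/
noncomputable def kernelConst (β H : ℝ) : ℝ :=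
  prodConst β * (√(√H * √gaussTwelfth) + √H * √gaussTwelfth)

theorem prodConst_nonneg {β : ℝ} (hβ : 0 ≤ β) : 0 ≤ prodConst β := by
  rw [prodConst]; positivity

theorem kernelConst_nonneg {β : ℝ} (hβ : 0 ≤ β) (H : ℝ) : 0 ≤ kernelConst β H :=
  mul_nonneg (prodConst_nonneg hβ) (by positivity)

/-- Orthonormality gives `∑ θ_s² = ∑ (a_t z_t)²`, so the Gaussian approximation of the product is
exactly the integrand obtained from Gaussian `y`. Only the error of the product approximation
remains, averaged over `z`, where each `θ_s` is a Gaussian linear form of variance at most `r²`. -/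
theorem norm_integral_linearised_sub_le {ι σ : Type*} [Fintype ι] [Fintype σ] [DecidableEq ι]
    {β H r : ℝ} (hβ : 0 ≤ β) {h : (ι → ℝ) → ℝ} (hm : AEStronglyMeasurable h (stdGauss ι))
    (h2 : Integrable (fun z => h z ^ 2) (stdGauss ι)) (hH2 : ∫ z, h z ^ 2 ∂(stdGauss ι) ≤ H)
    (h4 : Integrable (fun z => h z ^ 4) (stdGauss ι)) (hH4 : ∫ z, h z ^ 4 ∂(stdGauss ι) ≤ H)
    {v : ι → σ → ℝ} (hv : ∀ t t', ∑ s, v t s * v t' s = if t = t' then 1 else 0)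
    {ρ : σ → Measure ℝ} (hρ : ∀ s, IsStdLaw β (ρ s)) (a : ι → ℝ) (hr : 0 ≤ r)
    (har : ∀ s, ∑ t, (a t * v t s) ^ 2 ≤ r ^ 2) :
    ‖(∫ x, linearised h a (fun t => ∑ s, x s * v t s) ∂(Measure.pi ρ)) -
        ∫ y, linearised h a y ∂(stdGauss ι)‖ ≤
      kernelConst β H * Fintype.card σ *
        (r ^ 3 * √(∫ z, Real.exp (-((∑ t, (a t * z t) ^ 2) / 2)) ∂(stdGauss ι)) + r ^ 6) := by
  have hp : ∀ s, IsProbabilityMeasure (ρ s) := fun s => (hρ s).prob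
  have h1 : Integrable h (stdGauss ι) :=
    ((memLp_two_iff_integrable_sq hm).2 h2).integrable (by norm_num)
  -- The frequency at which the characteristic function of `ρ s` is evaluated.
  set θ : (ι → ℝ) → σ → ℝ := fun z s => ∑ t, a t * v t s * z t with hθ
  have hsq : ∀ z, ∑ s, θ z s ^ 2 = ∑ t, (a t * z t) ^ 2 := by
    intro z
    rw [← sum_sq_of_orthonormal hv]
    refine Finset.sum_congr rfl fun s _ => ?_
    rw [hθ]; congr 1
    exact Finset.sum_congr rfl fun t _ => by ring
  set g : (ι → ℝ) → ℝ := fun z => Real.exp (-((∑ t, (a t * z t) ^ 2) / 4)) with hg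
  have hgc : Continuous g := by rw [hg]; fun_prop
  have hg1 : ∀ z, g z ≤ 1 := fun z => by
    rw [hg, Real.exp_le_one_iff]
    have := Finset.sum_nonneg fun t (_ : t ∈ Finset.univ) => sq_nonneg (a t * z t)
    linarith
  have hg2e : ∀ z, g z ^ 2 = Real.exp (-((∑ t, (a t * z t) ^ 2) / 2)) := fun z => by
    rw [hg, ← Real.exp_nat_mul]; congr 1; push_cast; ring
  have hg0 : ∀ z, 0 ≤ g z := fun z => (Real.exp_pos _).le
  have hg2 : Integrable (fun z => g z ^ 2) (stdGauss ι) :=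
    Integrable.of_bound (C := 1) (by fun_prop) (.of_forall fun z => by
      rw [Real.norm_eq_abs, abs_of_nonneg (sq_nonneg _)]; exact pow_le_one₀ (hg0 z) (hg1 z))
  rw [integral_linearised h1, integral_linearised_gauss h1]
  set Φ : (ι → ℝ) → ℂ := fun z => ∏ s, ∫ x : ℝ, Complex.exp (Complex.I * (θ z s * x : ℝ)) ∂(ρ s)
    with hΦ
  have hΦm : AEStronglyMeasurable Φ (stdGauss ι) := by
    refine (Measurable.aestronglyMeasurable ?_)
    rw [hΦ]
    refine Finset.measurable_prod _ fun s _ => ?_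
    have hc : Continuous (fun z => θ z s) := by rw [hθ]; fun_prop
    have : (fun u : ℝ => ∫ x : ℝ, Complex.exp (Complex.I * (u * x : ℝ)) ∂(ρ s)) =
        charFun (ρ s) := by
      ext u
      rw [charFun_apply_real]
      refine integral_congr_ae (.of_forall fun x => ?_)
      simp only; congr 1; push_cast; ring
    have hcm : Measurable (fun u : ℝ => ∫ x : ℝ, Complex.exp (Complex.I * (u * x : ℝ)) ∂(ρ s)) := by
      rw [this]; exact measurable_charFun
    exact hcm.comp hc.measurable
  have hΦ1 : ∀ z, ‖Φ z‖ ≤ 1 := fun z => by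
    rw [hΦ, norm_prod]
    exact Finset.prod_le_one (fun _ _ => norm_nonneg _) fun s _ => norm_integral_cexp_le_one _
  have i1 : Integrable (fun z => (h z : ℂ) * Φ z) (stdGauss ι) :=
    h1.ofReal.mul_bdd (c := 1) hΦm (.of_forall hΦ1)
  have i2 : Integrable (fun z => (h z : ℂ) * (Real.exp (-((∑ t, (a t * z t) ^ 2) / 2)) : ℝ))
      (stdGauss ι) := by
    refine h1.ofReal.mul_bdd (c := 1) (Continuous.aestronglyMeasurable (by fun_prop))
      (.of_forall fun z => ?_)
    rw [← hg2e, Complex.norm_real, Real.norm_eq_abs, abs_of_nonneg (sq_nonneg _)]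
    exact pow_le_one₀ (hg0 z) (hg1 z)
  rw [← integral_sub i1 i2]
  have hA := fun s => integral_abs_mul_pow_three_le hm h4 hH4 hr (fun t => a t * v t s) (har s)
    hgc.aestronglyMeasurable hg0 hg2
  have hB := fun s => integral_abs_mul_pow_six_le hm h2 hH2 (fun t => a t * v t s) (har s)
  have hK := prodConst_nonneg hβ
  calc _ ≤ ∫ z, prodConst β * (∑ s, (|h z| * |θ z s| ^ 3 * g z) + ∑ s, (|h z| * θ z s ^ 6))
        ∂(stdGauss ι) := by
        refine norm_integral_le_of_norm_le ?_ (.of_forall fun z => ?_)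
        · exact ((integrable_finsetSum _ fun s _ => (hA s).1).add
            (integrable_finsetSum _ fun s _ => (hB s).1)).const_mul _
        · rw [← mul_sub, norm_mul, Complex.norm_real, Real.norm_eq_abs]
          have := norm_prod_charFun_sub_le hβ hρ (θ z)
          rw [hsq] at this
          refine (mul_le_mul_of_nonneg_left this (abs_nonneg _)).trans_eq ?_
          simp only [hg, mul_add, Finset.mul_sum]
          congr 1
          · exact Finset.sum_congr rfl fun s _ => by ring
          · exact Finset.sum_congr rfl fun s _ => by ring
    _ = prodConst β * (∑ s, ∫ z, (|h z| * |θ z s| ^ 3 * g z) ∂(stdGauss ι) +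
          ∑ s, ∫ z, (|h z| * θ z s ^ 6) ∂(stdGauss ι)) := by
        rw [integral_const_mul, integral_add (integrable_finsetSum _ fun s _ => (hA s).1)
          (integrable_finsetSum _ fun s _ => (hB s).1),
          integral_finsetSum _ fun s _ => (hA s).1, integral_finsetSum _ fun s _ => (hB s).1]
    _ ≤ prodConst β * (∑ s : σ, √(√H * √gaussTwelfth) * r ^ 3 * √(∫ z, g z ^ 2 ∂(stdGauss ι)) +
          ∑ s : σ, √H * √gaussTwelfth * r ^ 6) := by
        refine mul_le_mul_of_nonneg_left (add_le_add ?_ ?_) hK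
        · exact Finset.sum_le_sum fun s _ => (hA s).2
        · exact Finset.sum_le_sum fun s _ => (hB s).2
    _ ≤ _ := by
        simp only [Finset.sum_const, Finset.card_univ, nsmul_eq_mul, kernelConst]
        simp_rw [hg2e]
        set J := √(∫ z, Real.exp (-((∑ t, (a t * z t) ^ 2) / 2)) ∂(stdGauss ι))
        set A := √(√H * √gaussTwelfth)
        set D := √H * √gaussTwelfth
        have hA0 : 0 ≤ A := Real.sqrt_nonneg _
        have hD0 : 0 ≤ D := by positivity
        have hJ0 : 0 ≤ J := Real.sqrt_nonneg _
        have p1 : 0 ≤ D * (r ^ 3 * J) := by positivity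
        have p2 : 0 ≤ A * r ^ 6 := by positivity
        have : (0 : ℝ) ≤ Fintype.card σ := by positivity
        rw [← mul_add, mul_assoc (prodConst β), mul_assoc (prodConst β)]
        refine mul_le_mul_of_nonneg_left ?_ hK
        rw [mul_comm (A + D), mul_assoc (Fintype.card σ : ℝ)]
        refine mul_le_mul_of_nonneg_left ?_ this
        nlinarith

/-! ### Expected ratios and small values through Laplace transforms -/

theorem integral_pow_mul_exp_neg_Ioi (n : ℕ) {δ : ℝ} (hδ : 0 < δ) :
    IntegrableOn (fun l : ℝ => l ^ n * Real.exp (-(δ * l))) (Set.Ioi 0) ∧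
    ∫ l in Set.Ioi (0 : ℝ), l ^ n * Real.exp (-(δ * l)) = (n.factorial : ℝ) * (1 / δ) ^ (n + 1) := by
  constructor
  · have := integrableOn_rpow_mul_exp_neg_mul_rpow (p := 1) (s := n) (b := δ)
      (by have : (0 : ℝ) ≤ n := by positivity
          linarith) one_pos hδ
    simpa [Real.rpow_natCast] using this
  · have := Real.integral_rpow_mul_exp_neg_mul_Ioi (a := (n : ℝ) + 1) (r := δ) (by positivity) hδ
    rw [Real.Gamma_nat_eq_factorial] at this
    simp only [add_sub_cancel_right, Real.rpow_natCast] at this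
    rw [this, mul_comm]
    congr 1
    exact_mod_cast Real.rpow_natCast (1 / δ) (n + 1)

theorem integral_inv_one_add_sq_Ioi_le :
    ∫ l in Set.Ioi (0 : ℝ), (1 + l ^ 2)⁻¹ ≤ Real.pi := by
  rw [← integral_univ_inv_one_add_sq]
  exact setIntegral_le_integral integrable_inv_one_add_sq (.of_forall fun x => by positivity)

section Laplace

variable {α : Type*} [MeasurableSpace α] {μ : Measure α} [IsProbabilityMeasure μ] {N D : α → ℝ}

/-- Fubini applied to `1 / (D + δ) = ∫ e^(-(D + δ) l) dl`; the shift `δ` makes the double integral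
absolutely convergent even where `D` vanishes. -/
theorem integral_div_add_eq (hN : Measurable N) (hD : Measurable D) (hN0 : ∀ x, 0 ≤ N x)
    (hD0 : ∀ x, 0 ≤ D x) (hNi : Integrable N μ) {δ : ℝ} (hδ : 0 < δ) :
    IntegrableOn (fun l : ℝ => Real.exp (-(δ * l)) * ∫ x, N x * Real.exp (-(l * D x)) ∂μ)
      (Set.Ioi 0) ∧
    ∫ l in Set.Ioi (0 : ℝ), Real.exp (-(δ * l)) * ∫ x, N x * Real.exp (-(l * D x)) ∂μ =
      ∫ x, N x / (D x + δ) ∂μ := by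
  have hexp : IntegrableOn (fun l : ℝ => Real.exp (-(δ * l))) (Set.Ioi 0) := by
    simpa using exp_neg_integrableOn_Ioi 0 hδ
  have hint : Integrable (fun p : ℝ × α => Real.exp (-(δ * p.1)) * (N p.2 *
      Real.exp (-(p.1 * D p.2)))) ((volume.restrict (Set.Ioi (0 : ℝ))).prod μ) := by
    refine (hexp.mul_prod hNi).mono ?_ ?_
    · exact (by fun_prop : Measurable fun p : ℝ × α => Real.exp (-(δ * p.1)) * (N p.2 *
        Real.exp (-(p.1 * D p.2)))).aestronglyMeasurable
    · have hpos : ∀ᵐ p : ℝ × α ∂((volume.restrict (Set.Ioi (0 : ℝ))).prod μ), 0 < p.1 := by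
        have : ∀ᵐ l : ℝ ∂(volume.restrict (Set.Ioi (0 : ℝ))), 0 < l :=
          ae_restrict_mem measurableSet_Ioi
        exact Measure.quasiMeasurePreserving_fst.ae this
      filter_upwards [hpos] with p hp
      rw [Real.norm_eq_abs, Real.norm_eq_abs, abs_of_nonneg (by have := hN0 p.2; positivity),
        abs_of_nonneg (by have := hN0 p.2; positivity)]
      refine mul_le_mul_of_nonneg_left ?_ (Real.exp_pos _).le
      refine mul_le_of_le_one_right (hN0 _) (Real.exp_le_one_iff.2 ?_)
      have := mul_nonneg hp.le (hD0 p.2)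
      linarith
  constructor
  · refine hint.integral_prod_left.congr (.of_forall fun l => ?_)
    simp only
    rw [integral_const_mul]
  · simp_rw [← integral_const_mul]
    rw [integral_integral_swap hint]
    refine integral_congr_ae (.of_forall fun x => ?_)
    simp only
    have e : ∀ l : ℝ, Real.exp (-(δ * l)) * (N x * Real.exp (-(l * D x))) =
        N x * Real.exp (-(D x + δ) * l) := by
      intro l
      rw [mul_left_comm, ← Real.exp_add]
      congr 2; ring
    simp_rw [e]
    have := hD0 x
    rw [integral_const_mul, integral_exp_mul_Ioi (by linarith)]
    have : D x + δ ≠ 0 := by linarith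
    rw [mul_zero, Real.exp_zero, neg_div_neg_eq, mul_one_div]

theorem abs_integral_div_add_sub_le {α' : Type*} [MeasurableSpace α'] {ν : Measure α'}
    [IsProbabilityMeasure ν] {N' D' : α' → ℝ}
    (hN : Measurable N) (hD : Measurable D) (hN0 : ∀ x, 0 ≤ N x)
    (hD0 : ∀ x, 0 ≤ D x) (hNi : Integrable N μ)
    (hN' : Measurable N') (hD' : Measurable D') (hN0' : ∀ x, 0 ≤ N' x)
    (hD0' : ∀ x, 0 ≤ D' x) (hNi' : Integrable N' ν) {δ c₁ c₂ : ℝ} (hδ : 0 < δ) (hc₁ : 0 ≤ c₁)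
    (h : ∀ l : ℝ, 0 < l → |(∫ x, N x * Real.exp (-(l * D x)) ∂μ) -
      ∫ x, N' x * Real.exp (-(l * D' x)) ∂ν| ≤ c₁ * (1 + l ^ 2)⁻¹ + c₂ * l ^ 2) :
    |(∫ x, N x / (D x + δ) ∂μ) - ∫ x, N' x / (D' x + δ) ∂ν| ≤
      c₁ * Real.pi + 2 * c₂ * (1 / δ) ^ 3 := by
  have hA := integral_div_add_eq hN hD hN0 hD0 hNi hδ
  have hB := integral_div_add_eq hN' hD' hN0' hD0' hNi' hδ
  have hG := integral_pow_mul_exp_neg_Ioi 2 hδ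
  rw [← hA.2, ← hB.2, ← integral_sub hA.1 hB.1, ← Real.norm_eq_abs]
  have hI : IntegrableOn (fun l : ℝ => c₁ * (1 + l ^ 2)⁻¹ + c₂ * (l ^ 2 * Real.exp (-(δ * l))))
      (Set.Ioi 0) :=
    (integrable_inv_one_add_sq.integrableOn.const_mul _).add (hG.1.const_mul _)
  calc _ ≤ ∫ l in Set.Ioi (0 : ℝ), (c₁ * (1 + l ^ 2)⁻¹ + c₂ * (l ^ 2 * Real.exp (-(δ * l)))) := by
        refine norm_integral_le_of_norm_le hI ?_
        filter_upwards [ae_restrict_mem measurableSet_Ioi] with l hl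
        rw [← mul_sub, norm_mul, Real.norm_eq_abs, Real.norm_eq_abs, abs_of_pos (Real.exp_pos _)]
        have hl' : 0 < l := hl
        have h1 : Real.exp (-(δ * l)) ≤ 1 := Real.exp_le_one_iff.2 (by nlinarith)
        have h2 : 0 ≤ c₁ * (1 + l ^ 2)⁻¹ := by positivity
        refine (mul_le_mul_of_nonneg_left (h l hl') (Real.exp_pos _).le).trans ?_
        nlinarith [mul_le_mul_of_nonneg_right h1 h2]
    _ = c₁ * (∫ l in Set.Ioi (0 : ℝ), (1 + l ^ 2)⁻¹) + c₂ * (((2 : ℕ).factorial : ℝ) *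
          (1 / δ) ^ (2 + 1)) := by
        rw [integral_add (integrable_inv_one_add_sq.integrableOn.const_mul _) (hG.1.const_mul _),
          integral_const_mul, integral_const_mul, hG.2]
    _ ≤ _ := by
        have := mul_le_mul_of_nonneg_left integral_inv_one_add_sq_Ioi_le hc₁
        simp only [Nat.factorial] at *
        push_cast
        linarith

/-- Controls the cost of the shift `δ`, which `abs_integral_div_sub_integral_div_add_le` bounds by
the mean of `δ / (D + δ)`. The three terms integrate against `e^(-δl)` to at most `c₀ / δ`, `c₁ π`
and `6 c₂ / δ⁴`. -/
theorem integral_const_div_add_le (hD : Measurable D) (hD0 : ∀ x, 0 ≤ D x) {δ c₀ c₁ c₂ : ℝ}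
    (hδ : 0 < δ) (hc₁ : 0 ≤ c₁)
    (h : ∀ l : ℝ, 0 < l → ∫ x, Real.exp (-(l * D x)) ∂μ ≤
      c₀ + c₁ * (1 + l ^ 2)⁻¹ + c₂ * l ^ 3) :
    ∫ x, δ / (D x + δ) ∂μ ≤ c₀ + δ * (c₁ * Real.pi) + 6 * c₂ * (1 / δ) ^ 3 := by
  have hA := integral_div_add_eq (μ := μ) (N := fun _ => 1) measurable_const hD
    (fun _ => zero_le_one) hD0 (integrable_const _) hδ
  have hG := integral_pow_mul_exp_neg_Ioi 3 hδ
  have hG0 := integral_pow_mul_exp_neg_Ioi 0 hδ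
  simp only [one_mul] at hA
  have e : ∀ x, δ / (D x + δ) = δ * (1 / (D x + δ)) := fun x => by ring
  simp_rw [e]
  rw [integral_const_mul, ← hA.2]
  have hI : IntegrableOn (fun l : ℝ => c₀ * (l ^ 0 * Real.exp (-(δ * l))) + (c₁ * (1 + l ^ 2)⁻¹ +
      c₂ * (l ^ 3 * Real.exp (-(δ * l))))) (Set.Ioi 0) :=
    (hG0.1.const_mul _).add
      ((integrable_inv_one_add_sq.integrableOn.const_mul _).add (hG.1.const_mul _))
  have hle : ∫ l in Set.Ioi (0 : ℝ), Real.exp (-(δ * l)) * ∫ x, Real.exp (-(l * D x)) ∂μ ≤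
      c₀ * (1 / δ) + (c₁ * Real.pi + c₂ * (6 * (1 / δ) ^ 4)) := by
    calc _ ≤ ∫ l in Set.Ioi (0 : ℝ), (c₀ * (l ^ 0 * Real.exp (-(δ * l))) + (c₁ * (1 + l ^ 2)⁻¹ +
          c₂ * (l ^ 3 * Real.exp (-(δ * l))))) := by
          refine setIntegral_mono_on hA.1 hI measurableSet_Ioi fun l hl => ?_
          have hl' : 0 < l := hl
          have h1 : Real.exp (-(δ * l)) ≤ 1 := Real.exp_le_one_iff.2 (by nlinarith)
          have h2 : 0 ≤ c₁ * (1 + l ^ 2)⁻¹ := by positivity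
          refine (mul_le_mul_of_nonneg_left (h l hl') (Real.exp_pos _).le).trans ?_
          nlinarith [mul_le_mul_of_nonneg_right h1 h2]
      _ = c₀ * (((0 : ℕ).factorial : ℝ) * (1 / δ) ^ (0 + 1)) +
          (c₁ * (∫ l in Set.Ioi (0 : ℝ), (1 + l ^ 2)⁻¹) + c₂ * (((3 : ℕ).factorial : ℝ) *
          (1 / δ) ^ (3 + 1))) := by
          have hI2 : IntegrableOn (fun l : ℝ => c₁ * (1 + l ^ 2)⁻¹ +
              c₂ * (l ^ 3 * Real.exp (-(δ * l)))) (Set.Ioi 0) :=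
            (integrable_inv_one_add_sq.integrableOn.const_mul _).add (hG.1.const_mul _)
          rw [integral_add (hG0.1.const_mul _) hI2,
            integral_add (integrable_inv_one_add_sq.integrableOn.const_mul _) (hG.1.const_mul _),
            integral_const_mul, integral_const_mul, integral_const_mul, hG.2, hG0.2]
      _ ≤ _ := by
          have := mul_le_mul_of_nonneg_left integral_inv_one_add_sq_Ioi_le hc₁
          simp only [Nat.factorial] at *
          push_cast
          simp only [pow_one]
          linarith
  refine (mul_le_mul_of_nonneg_left hle hδ.le).trans_eq ?_
  field_simp
  ring

/-- Markov's inequality for `e^(-qD)`, which exceeds `e⁻¹` on the event. -/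
theorem measureReal_lt_le_exp (hD : Measurable D) (hD0 : ∀ x, 0 ≤ D x) {q : ℝ} (hq : 0 < q) :
    μ.real {x | D x < 1 / q} ≤ Real.exp 1 * ∫ x, Real.exp (-(q * D x)) ∂μ := by
  have hi : Integrable (fun x => Real.exp (-(q * D x))) μ := by
    refine Integrable.of_bound (C := 1) (by fun_prop) (.of_forall fun x => ?_)
    rw [Real.norm_eq_abs, abs_of_pos (Real.exp_pos _), Real.exp_le_one_iff]
    have := mul_nonneg hq.le (hD0 x)
    linarith
  have h := mul_meas_ge_le_integral_of_nonneg (μ := μ) (.of_forall fun x => (Real.exp_pos _).le)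
    hi (Real.exp (-1))
  have hs : μ.real {x | D x < 1 / q} ≤ μ.real {x | Real.exp (-1) ≤ Real.exp (-(q * D x))} := by
    refine measureReal_mono fun x hx => ?_
    have hx' : D x < 1 / q := hx
    rw [lt_div_iff₀ hq] at hx'
    simp only [Set.mem_ofPred_eq, Real.exp_le_exp]
    linarith
  have h1 : Real.exp 1 * Real.exp (-1) = 1 := by rw [← Real.exp_add]; simp
  calc _ ≤ Real.exp 1 * (Real.exp (-1) *
        μ.real {x | Real.exp (-1) ≤ Real.exp (-(q * D x))}) := by rw [← mul_assoc, h1, one_mul]; exact hs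
    _ ≤ _ := mul_le_mul_of_nonneg_left h (Real.exp_pos _).le

end Laplace

/-! ### Gaussian approximation for ratios of quadratic forms -/

/-- The diagonal quadratic form `∑ w_t y_t²`. -/
def quadForm {ι : Type*} [Fintype ι] (w y : ι → ℝ) : ℝ := ∑ t, w t * y t ^ 2

section

variable {ι : Type*} [Fintype ι] {w : ι → ℝ}

theorem quadForm_nonneg (hw : ∀ t, 0 ≤ w t) (y : ι → ℝ) : 0 ≤ quadForm w y :=
  Finset.sum_nonneg fun t _ => mul_nonneg (hw t) (sq_nonneg _)

theorem measurable_quadForm : Measurable (quadForm w) := by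
  unfold quadForm; fun_prop

theorem sum_sqrt_sq (hw : ∀ t, 0 ≤ w t) {l : ℝ} (hl : 0 ≤ l) (y : ι → ℝ) :
    (∑ t, (√(2 * l * w t) * y t) ^ 2) / 2 = l * quadForm w y := by
  rw [quadForm, Finset.mul_sum, Finset.sum_div]
  refine Finset.sum_congr rfl fun t _ => ?_
  rw [mul_pow, Real.sq_sqrt (by have := hw t; positivity)]
  ring

theorem linearised_one (hw : ∀ t, 0 ≤ w t) {l : ℝ} (hl : 0 ≤ l) (y : ι → ℝ) :
    linearised (fun _ => 1) (fun t => √(2 * l * w t)) y =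
      (Real.exp (-(l * quadForm w y)) : ℝ) := by
  rw [linearised]
  simp only [Complex.ofReal_one, one_mul]
  rw [integral_cexp_stdGauss (fun t => √(2 * l * w t) * y t), sum_sqrt_sq hw hl]

theorem linearised_one_sub_sq [DecidableEq ι] (hw : ∀ t, 0 ≤ w t) {l : ℝ} (hl : 0 ≤ l)
    (y : ι → ℝ) (k : ι) :
    linearised (fun z => 1 - z k ^ 2) (fun t => √(2 * l * w t)) y =
      (2 * l * (w k * y k ^ 2 * Real.exp (-(l * quadForm w y))) : ℝ) := by
  rw [linearised]
  rw [integral_one_sub_sq_mul_cexp_stdGauss (fun t => √(2 * l * w t) * y t), sum_sqrt_sq hw hl,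
    mul_pow, Real.sq_sqrt (by have := hw k; positivity)]
  push_cast; ring

end

/-- A bound for the second and fourth moments of `1 - Z²` and of `1`. -/
noncomputable def gaussConst : ℝ :=
  1 + ∫ z : ℝ, (1 - z ^ 2) ^ 2 ∂(gaussianReal 0 1) + ∫ z : ℝ, (1 - z ^ 2) ^ 4 ∂(gaussianReal 0 1)

theorem integrable_one_sub_sq_pow (n : ℕ) :
    Integrable (fun z : ℝ => (1 - z ^ 2) ^ n) (gaussianReal 0 1) := by
  have e : ∀ z : ℝ, (1 - z ^ 2) ^ n =
      ∑ m ∈ Finset.range (n + 1), (n.choose m : ℝ) * ((-1) ^ m * z ^ (2 * m)) := by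
    intro z
    rw [sub_eq_neg_add, add_pow]
    refine Finset.sum_congr rfl fun m _ => ?_
    rw [neg_pow, pow_mul]; ring
  simp_rw [e]
  exact integrable_finsetSum _ fun m _ => ((integrable_pow_gaussianReal _).const_mul _).const_mul _

section

variable {ι σ : Type*} [Fintype ι] [Fintype σ] [DecidableEq ι] {w : ι → ℝ} {v : ι → σ → ℝ}
  {ρ : σ → Measure ℝ} {β A K H : ℝ}

/-- The constant of `norm_integral_linearised_sub_le_of_lt`. -/
noncomputable def decayConst (β A K : ℝ) : ℝ :=
  kernelConst β gaussConst * (A * √A * √K + A ^ 3)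

theorem decayConst_nonneg (hβ : 0 ≤ β) (hA : 0 ≤ A) : 0 ≤ decayConst β A K :=
  mul_nonneg (kernelConst_nonneg hβ _) (by positivity)

variable (hβ : 0 ≤ β) (hA : 0 ≤ A) (hK : 0 ≤ K) (hw : ∀ t, 0 ≤ w t)
  (hσ : 0 < Fintype.card σ)
  (hv : ∀ t t', ∑ s, v t s * v t' s = if t = t' then 1 else 0)
  (hρ : ∀ s, IsStdLaw β (ρ s))
  (hAv : ∀ s, 2 * ∑ t, w t * v t s ^ 2 ≤ A / Fintype.card σ)
  (hJ : ∀ l : ℝ, 0 ≤ l → ∫ z, Real.exp (-(l * quadForm w z)) ∂(stdGauss ι) ≤ K * ((1 + l) ^ 6)⁻¹)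

include hβ hA hK hw hσ hv hρ hAv hJ

/-- With `a_t = √(2 l w_t)` the frequencies have variance at most `A l / T`, where `T` is the number
of noise variables. Thus `T r³` is of order `l^(3/2) / √T` and `T r⁶` of order `l³ / T²`. -/
theorem norm_integral_linearised_sub_le_of_lt {h : (ι → ℝ) → ℝ}
    (hm : AEStronglyMeasurable h (stdGauss ι))
    (h2 : Integrable (fun z => h z ^ 2) (stdGauss ι))
    (hH2 : ∫ z, h z ^ 2 ∂(stdGauss ι) ≤ gaussConst)
    (h4 : Integrable (fun z => h z ^ 4) (stdGauss ι))
    (hH4 : ∫ z, h z ^ 4 ∂(stdGauss ι) ≤ gaussConst) {l : ℝ} (hl : 0 < l) :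
    ‖(∫ x, linearised h (fun t => √(2 * l * w t)) (fun t => ∑ s, x s * v t s) ∂(Measure.pi ρ)) -
        ∫ y, linearised h (fun t => √(2 * l * w t)) y ∂(stdGauss ι)‖ ≤
      decayConst β A K * (l * (1 + l ^ 2)⁻¹ / √(Fintype.card σ) + l ^ 3 / Fintype.card σ ^ 2) := by
  set T : ℝ := (Fintype.card σ : ℝ) with hT
  have hT0 : 0 < T := by rw [hT]; exact_mod_cast hσ
  have hr2 : √(A * l / T) ^ 2 = A * l / T := Real.sq_sqrt (by positivity)
  have har : ∀ s, ∑ t, (√(2 * l * w t) * v t s) ^ 2 ≤ √(A * l / T) ^ 2 := by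
    intro s
    have := sum_sqrt_sq hw hl.le (fun t => v t s)
    rw [div_eq_iff two_ne_zero] at this
    rw [this, hr2, quadForm]
    have h' := mul_le_mul_of_nonneg_left (hAv s) hl.le
    rw [show A * l / T = l * (A / T) by ring]
    linarith
  refine (norm_integral_linearised_sub_le hβ hm h2 hH2 h4 hH4 hv hρ _ (Real.sqrt_nonneg _)
    har).trans ?_
  simp_rw [sum_sqrt_sq hw hl.le]
  rw [decayConst, mul_assoc, mul_assoc]
  refine mul_le_mul_of_nonneg_left ?_ (kernelConst_nonneg hβ _)
  set r := √(A * l / T) with hr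
  have hr0 : 0 ≤ r := Real.sqrt_nonneg _
  have hJ1 : √(∫ z, Real.exp (-(l * quadForm w z)) ∂(stdGauss ι)) ≤ √K * ((1 + l) ^ 3)⁻¹ := by
    rw [Real.sqrt_le_left (by positivity), mul_pow, Real.sq_sqrt hK, inv_pow, ← pow_mul]
    exact hJ l hl.le
  have hr3 : T * (r ^ 3 * (√K * ((1 + l) ^ 3)⁻¹)) ≤
      A * √A * √K * (l * (1 + l ^ 2)⁻¹ / √T) := by
    have e1 : r = √A * √l / √T := by
      rw [hr, Real.sqrt_div (by positivity), Real.sqrt_mul hA]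
    have e2 : T * r ^ 3 = A * l * (√A * √l / √T) := by
      rw [pow_succ, hr2, e1]; field_simp
    -- The sixth power in `hJ` is chosen for this: after its square root has absorbed `√l`, the
    -- decay is still integrable.
    have e3 : √l * ((1 + l) ^ 3)⁻¹ ≤ (1 + l ^ 2)⁻¹ := by
      rw [← div_eq_mul_inv, div_le_iff₀ (by positivity), ← div_eq_inv_mul,
        le_div_iff₀ (by positivity)]
      have : √l ≤ 1 + l := by
        rw [Real.sqrt_le_left (by positivity)]; nlinarith
      have h5 : 1 + l ^ 2 ≤ (1 + l) ^ 2 := by nlinarith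
      calc √l * (1 + l ^ 2) ≤ (1 + l) * (1 + l) ^ 2 :=
            mul_le_mul this h5 (by positivity) (by positivity)
        _ = _ := by ring
    calc _ = (A * √A * √K) * (l * (√l * ((1 + l) ^ 3)⁻¹) / √T) := by
          rw [← mul_assoc, e2]; ring
      _ ≤ _ := by gcongr
  have hr6 : T * r ^ 6 = A ^ 3 * (l ^ 3 / T ^ 2) := by
    rw [show r ^ 6 = (r ^ 2) ^ 3 by ring, hr2]; field_simp
  have p1 : 0 ≤ A ^ 3 * (l * (1 + l ^ 2)⁻¹ / √T) := by positivity
  have p2 : 0 ≤ A * √A * √K * (l ^ 3 / T ^ 2) := by positivity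
  have h6 : T * (r ^ 3 * √(∫ z, Real.exp (-(l * quadForm w z)) ∂(stdGauss ι))) ≤
      T * (r ^ 3 * (√K * ((1 + l) ^ 3)⁻¹)) := by gcongr
  nlinarith

theorem abs_integral_exp_sub_le {l : ℝ} (hl : 0 < l) :
    |(∫ x, Real.exp (-(l * quadForm w (fun t => ∑ s, x s * v t s))) ∂(Measure.pi ρ)) -
        ∫ y, Real.exp (-(l * quadForm w y)) ∂(stdGauss ι)| ≤
      decayConst β A K * (l * (1 + l ^ 2)⁻¹ / √(Fintype.card σ) + l ^ 3 / Fintype.card σ ^ 2) := by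
  have hc : (1 : ℝ) ≤ gaussConst := by
    rw [gaussConst]
    have h1 : 0 ≤ ∫ z : ℝ, (1 - z ^ 2) ^ 2 ∂(gaussianReal 0 1) :=
      integral_nonneg fun z => by positivity
    have h2 : 0 ≤ ∫ z : ℝ, (1 - z ^ 2) ^ 4 ∂(gaussianReal 0 1) :=
      integral_nonneg fun z => by positivity
    linarith
  have := norm_integral_linearised_sub_le_of_lt hβ hA hK hw hσ hv hρ hAv hJ (h := fun _ => 1)
    aestronglyMeasurable_const (by simp) (by simpa using hc) (by simp) (by simpa using hc) hl
  simp_rw [linearised_one hw hl.le] at this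
  rwa [integral_complex_ofReal, integral_complex_ofReal, ← Complex.ofReal_sub, Complex.norm_real,
    Real.norm_eq_abs] at this

/-- The multiplier `1 - z_k²` yields the integrand with a factor `2 l`. Dividing by `l` improves the
error to one integrable near infinity in its first term; the `2` is dropped. -/
theorem abs_integral_sq_mul_exp_sub_le (k : ι) {l : ℝ} (hl : 0 < l) :
    |(∫ x, w k * (∑ s, x s * v k s) ^ 2 *
          Real.exp (-(l * quadForm w (fun t => ∑ s, x s * v t s))) ∂(Measure.pi ρ)) -
        ∫ y, w k * y k ^ 2 * Real.exp (-(l * quadForm w y)) ∂(stdGauss ι)| ≤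
      decayConst β A K * ((1 + l ^ 2)⁻¹ / √(Fintype.card σ) + l ^ 2 / Fintype.card σ ^ 2) := by
  have h1 : 0 ≤ ∫ z : ℝ, (1 - z ^ 2) ^ 2 ∂(gaussianReal 0 1) :=
    integral_nonneg fun z => by positivity
  have h2 : 0 ≤ ∫ z : ℝ, (1 - z ^ 2) ^ 4 ∂(gaussianReal 0 1) :=
    integral_nonneg fun z => by positivity
  have e : ∀ n : ℕ, ∫ z : ι → ℝ, (1 - z k ^ 2) ^ n ∂(stdGauss ι) =
      ∫ z : ℝ, (1 - z ^ 2) ^ n ∂(gaussianReal 0 1) := fun n =>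
    integral_comp_eval (μ := fun _ : ι => gaussianReal 0 1) (i := k)
      (f := fun z : ℝ => (1 - z ^ 2) ^ n)
      (integrable_one_sub_sq_pow n).aestronglyMeasurable
  have i : ∀ n : ℕ, Integrable (fun z : ι → ℝ => (1 - z k ^ 2) ^ n) (stdGauss ι) := fun n =>
    integrable_comp_eval (μ := fun _ : ι => gaussianReal 0 1) (i := k)
      (f := fun z : ℝ => (1 - z ^ 2) ^ n) (integrable_one_sub_sq_pow n)
  have := norm_integral_linearised_sub_le_of_lt hβ hA hK hw hσ hv hρ hAv hJ
    (h := fun z => 1 - z k ^ 2)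
    (Continuous.aestronglyMeasurable (by fun_prop)) (i 2) (by rw [e, gaussConst]; linarith) (i 4)
    (by rw [e, gaussConst]; linarith) hl
  simp_rw [linearised_one_sub_sq hw hl.le] at this
  rw [integral_complex_ofReal, integral_complex_ofReal, ← Complex.ofReal_sub, Complex.norm_real,
    Real.norm_eq_abs, integral_const_mul, integral_const_mul, ← mul_sub, abs_mul,
    abs_of_pos (by positivity)] at this
  have hC := decayConst_nonneg (K := K) hβ hA
  have e2 : decayConst β A K *
      (l * (1 + l ^ 2)⁻¹ / √(Fintype.card σ) + l ^ 3 / Fintype.card σ ^ 2) =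
      l * (decayConst β A K *
        ((1 + l ^ 2)⁻¹ / √(Fintype.card σ) + l ^ 2 / Fintype.card σ ^ 2)) := by ring
  rw [e2, mul_comm 2 l, mul_assoc] at this
  have h3 := le_of_mul_le_mul_left this hl
  refine le_trans ?_ h3
  exact le_mul_of_one_le_left (abs_nonneg _) (by norm_num)

end

theorem integrable_sq_linear_pi {σ : Type*} [Fintype σ] {β : ℝ} {ρ : σ → Measure ℝ}
    (hρ : ∀ s, IsStdLaw β (ρ s)) (c : σ → ℝ) :
    Integrable (fun x : σ → ℝ => (∑ s, x s * c s) ^ 2) (Measure.pi ρ) := by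
  have hp : ∀ s, IsProbabilityMeasure (ρ s) := fun s => (hρ s).prob
  have h : ∀ s, MemLp (fun x : σ → ℝ => x s * c s) 2 (Measure.pi ρ) := fun s => by
    have : MemLp (fun x : σ → ℝ => x s) 2 (Measure.pi ρ) := by
      rw [memLp_two_iff_integrable_sq (measurable_pi_apply s).aestronglyMeasurable]
      exact integrable_comp_eval (μ := ρ) (i := s) (f := fun x : ℝ => x ^ 2) (hρ s).integrable_sq
    exact this.mul_const _
  exact (memLp_finsetSum Finset.univ fun s _ => h s).integrable_sq

theorem abs_div_sub_div_add_le {N D δ : ℝ} (hN : 0 ≤ N) (hND : N ≤ D) (hδ : 0 < δ) :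
    |N / D - N / (D + δ)| ≤ δ / (D + δ) := by
  rcases (hN.trans hND).eq_or_lt with h | h
  · have : N = 0 := le_antisymm (by rw [h]; exact hND) hN
    subst this
    simp only [zero_div, sub_self, abs_zero]
    rw [← h]; positivity
  · have e : N / D - N / (D + δ) = (N / D) * (δ / (D + δ)) := by
      field_simp; ring
    have hq : 0 ≤ δ / (D + δ) := by positivity
    rw [e, abs_of_nonneg (by positivity)]
    exact mul_le_of_le_one_left hq ((div_le_one h).2 hND)

theorem div_mem_unit {N D : ℝ} (hN : 0 ≤ N) (hND : N ≤ D) : ‖N / D‖ ≤ 1 := by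
  rw [Real.norm_eq_abs, abs_of_nonneg (div_nonneg hN (hN.trans hND))]
  exact div_le_one_of_le₀ hND (hN.trans hND)

theorem abs_integral_div_sub_integral_div_add_le {α : Type*} [MeasurableSpace α] {μ : Measure α}
    [IsProbabilityMeasure μ] {N D : α → ℝ} (hN : Measurable N) (hD : Measurable D)
    (hN0 : ∀ x, 0 ≤ N x) (hND : ∀ x, N x ≤ D x) {δ : ℝ} (hδ : 0 < δ) :
    |(∫ x, N x / D x ∂μ) - ∫ x, N x / (D x + δ) ∂μ| ≤ ∫ x, δ / (D x + δ) ∂μ := by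
  have hD0 : ∀ x, 0 ≤ D x := fun x => (hN0 x).trans (hND x)
  have i1 : Integrable (fun x => N x / D x) μ :=
    Integrable.of_bound (C := 1) (hN.div hD).aestronglyMeasurable
      (.of_forall fun x => div_mem_unit (hN0 x) (hND x))
  have i2 : Integrable (fun x => N x / (D x + δ)) μ :=
    Integrable.of_bound (C := 1) (hN.div (hD.add_const δ)).aestronglyMeasurable
      (.of_forall fun x => div_mem_unit (hN0 x) (by linarith [hND x]))
  have i3 : Integrable (fun x => δ / (D x + δ)) μ :=
    Integrable.of_bound (C := 1) (measurable_const.div (hD.add_const δ)).aestronglyMeasurable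
      (.of_forall fun x => div_mem_unit hδ.le (by linarith [hD0 x]))
  rw [← integral_sub i1 i2, ← Real.norm_eq_abs]
  exact norm_integral_le_of_norm_le i3
    (.of_forall fun x => abs_div_sub_div_add_le (hN0 x) (hND x) hδ)

section

variable {ι σ : Type*} [Fintype ι] [Fintype σ] {w : ι → ℝ} {v : ι → σ → ℝ}
  {ρ : σ → Measure ℝ} {β A K : ℝ}

theorem single_le_quadForm (hw : ∀ t, 0 ≤ w t) (y : ι → ℝ) (k : ι) :
    w k * y k ^ 2 ≤ quadForm w y :=
  Finset.single_le_sum (f := fun t => w t * y t ^ 2) (fun t _ => mul_nonneg (hw t) (sq_nonneg _))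
    (Finset.mem_univ k)

theorem inv_one_add_pow_six_le {l : ℝ} (hl : 0 ≤ l) : ((1 + l) ^ 6)⁻¹ ≤ (1 + l ^ 2)⁻¹ := by
  refine inv_anti₀ (by positivity) ?_
  have h1 : 1 + l ^ 2 ≤ (1 + l) ^ 2 := by nlinarith
  exact h1.trans (pow_le_pow_right₀ (by linarith) (by norm_num))

theorem mul_inv_one_add_sq_le_one {l : ℝ} : l * (1 + l ^ 2)⁻¹ ≤ 1 := by
  rw [← div_eq_mul_inv, div_le_one (by positivity)]
  nlinarith [sq_nonneg (l - 1)]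

theorem measureReal_quadForm_gauss_le (hK : 0 ≤ K) (hw : ∀ t, 0 ≤ w t)
    (hJ : ∀ l : ℝ, 0 ≤ l → ∫ z, Real.exp (-(l * quadForm w z)) ∂(stdGauss ι) ≤
      K * ((1 + l) ^ 6)⁻¹) {q : ℝ} (hq : 0 < q) :
    (stdGauss ι).real {z | quadForm w z < 1 / q} ≤ 3 * K / q ^ 2 := by
  have h := measureReal_lt_le_exp (μ := stdGauss ι) measurable_quadForm (quadForm_nonneg hw) hq
  have h1 : ((1 + q) ^ 6)⁻¹ ≤ (q ^ 2)⁻¹ := (inv_one_add_pow_six_le hq.le).trans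
    (inv_anti₀ (by positivity) (by linarith))
  have h2 := (hJ q hq.le).trans (mul_le_mul_of_nonneg_left h1 hK)
  refine h.trans ((mul_le_mul_of_nonneg_left h2 (Real.exp_pos _).le).trans ?_)
  rw [mul_div_assoc, ← div_eq_mul_inv]
  exact mul_le_mul_of_nonneg_right Real.exp_one_lt_three.le (by positivity)

variable [DecidableEq ι] (hβ : 0 ≤ β) (hA : 0 ≤ A) (hK : 0 ≤ K) (hw : ∀ t, 0 ≤ w t)
  (hσ : 0 < Fintype.card σ)
  (hv : ∀ t t', ∑ s, v t s * v t' s = if t = t' then 1 else 0)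
  (hρ : ∀ s, IsStdLaw β (ρ s))
  (hAv : ∀ s, 2 * ∑ t, w t * v t s ^ 2 ≤ A / Fintype.card σ)
  (hJ : ∀ l : ℝ, 0 ≤ l → ∫ z, Real.exp (-(l * quadForm w z)) ∂(stdGauss ι) ≤ K * ((1 + l) ^ 6)⁻¹)

include hβ hA hK hw hσ hv hρ hAv hJ

theorem integral_exp_quadForm_le {l : ℝ} (hl : 0 < l) :
    ∫ x, Real.exp (-(l * quadForm w (fun t => ∑ s, x s * v t s))) ∂(Measure.pi ρ) ≤
      decayConst β A K / √(Fintype.card σ) + K * (1 + l ^ 2)⁻¹ +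
        decayConst β A K / Fintype.card σ ^ 2 * l ^ 3 := by
  have h := abs_integral_exp_sub_le hβ hA hK hw hσ hv hρ hAv hJ hl
  have h1 := (hJ l hl.le).trans (mul_le_mul_of_nonneg_left (inv_one_add_pow_six_le hl.le) hK)
  have hC := decayConst_nonneg (K := K) hβ hA
  have h2 : l * (1 + l ^ 2)⁻¹ / √(Fintype.card σ) ≤ 1 / √(Fintype.card σ) := by
    have := mul_inv_one_add_sq_le_one (l := l)
    gcongr
  have h3 := mul_le_mul_of_nonneg_left h2 hC
  have h4 := (abs_le.1 h).2
  have e : decayConst β A K * (l * (1 + l ^ 2)⁻¹ / √(Fintype.card σ) + l ^ 3 / Fintype.card σ ^ 2) =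
    decayConst β A K * (l * (1 + l ^ 2)⁻¹ / √(Fintype.card σ)) +
      decayConst β A K / Fintype.card σ ^ 2 * l ^ 3 := by ring
  have e' : decayConst β A K * (1 / √(Fintype.card σ)) = decayConst β A K / √(Fintype.card σ) := by
    ring
  linarith

/-- At `l = q = T^(1/4)` every term of the transform bound is at most of order `q⁻² = T^(-1/2)`. -/
theorem measureReal_quadForm_lt_le {q : ℝ} (hq : q ^ 4 = Fintype.card σ) (hq1 : 1 ≤ q) :
    (Measure.pi ρ).real {x | quadForm w (fun t => ∑ s, x s * v t s) < 1 / q} ≤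
      (3 * K + 6 * decayConst β A K) / q ^ 2 := by
  have hp : ∀ s, IsProbabilityMeasure (ρ s) := fun s => (hρ s).prob
  have hq0 : 0 < q := by linarith
  have hm : Measurable fun x : σ → ℝ => quadForm w (fun t => ∑ s, x s * v t s) :=
    measurable_quadForm.comp (by fun_prop)
  have h := measureReal_lt_le_exp (μ := Measure.pi ρ) hm (fun x => quadForm_nonneg hw _) hq0
  have h' := integral_exp_quadForm_le hβ hA hK hw hσ hv hρ hAv hJ hq0
  have hs : √(Fintype.card σ : ℝ) = q ^ 2 := by
    rw [← hq, show q ^ 4 = (q ^ 2) ^ 2 by ring, Real.sqrt_sq (by positivity)]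
  rw [hs, ← hq] at h'
  have hC := decayConst_nonneg (K := K) hβ hA
  have h1 : K * (1 + q ^ 2)⁻¹ ≤ K / q ^ 2 := by
    rw [div_eq_mul_inv]
    exact mul_le_mul_of_nonneg_left (inv_anti₀ (by positivity) (by linarith)) hK
  have h2 : decayConst β A K / (q ^ 4) ^ 2 * q ^ 3 ≤ decayConst β A K / q ^ 2 := by
    rw [div_mul_eq_mul_div, div_le_div_iff₀ (by positivity) (by positivity), mul_assoc, ← pow_add,
      ← pow_mul]
    exact mul_le_mul_of_nonneg_left (pow_le_pow_right₀ hq1 (by norm_num)) hC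
  have h3 : ∫ x, Real.exp (-(q * quadForm w (fun t => ∑ s, x s * v t s))) ∂(Measure.pi ρ) ≤
      (K + 2 * decayConst β A K) / q ^ 2 := by
    rw [add_div, mul_div_assoc]; linarith
  refine h.trans ((mul_le_mul_of_nonneg_left h3 (Real.exp_pos _).le).trans ?_)
  rw [show (3 * K + 6 * decayConst β A K) / q ^ 2 = 3 * ((K + 2 * decayConst β A K) / q ^ 2) by ring]
  exact mul_le_mul_of_nonneg_right Real.exp_one_lt_three.le (by positivity)

/-- Both ratios are regularised by `δ = T^(-1/2)`. This balances the cost of the shift, of order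
`δ`, against the error `T⁻² δ⁻³` coming from large `l`. -/
theorem abs_integral_ratio_sub_le (k : ι) :
    |(∫ x, w k * (∑ s, x s * v k s) ^ 2 / quadForm w (fun t => ∑ s, x s * v t s) ∂(Measure.pi ρ)) -
        ∫ y, w k * y k ^ 2 / quadForm w y ∂(stdGauss ι)| ≤
      (13 * decayConst β A K + 8 * K) / √(Fintype.card σ) := by
  have hp : ∀ s, IsProbabilityMeasure (ρ s) := fun s => (hρ s).prob
  set T : ℝ := (Fintype.card σ : ℝ) with hT
  have hT0 : 0 < T := by rw [hT]; exact_mod_cast hσ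
  set c := decayConst β A K with hc
  have hC : 0 ≤ c := decayConst_nonneg (K := K) hβ hA
  have hs0 : 0 < √T := Real.sqrt_pos.2 hT0
  have hsq : √T ^ 2 = T := Real.sq_sqrt hT0.le
  have hδ : 0 < 1 / √T := by positivity
  have mD : Measurable fun x : σ → ℝ => quadForm w (fun t => ∑ s, x s * v t s) :=
    measurable_quadForm.comp (by fun_prop)
  have mD' : Measurable fun y : ι → ℝ => quadForm w y := measurable_quadForm
  have mN : Measurable fun x : σ → ℝ => w k * (∑ s, x s * v k s) ^ 2 := by fun_prop
  have mN' : Measurable fun y : ι → ℝ => w k * y k ^ 2 := by fun_prop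
  have a1 := abs_integral_div_sub_integral_div_add_le (μ := Measure.pi ρ) mN mD
    (fun x => mul_nonneg (hw k) (sq_nonneg _))
    (fun x => single_le_quadForm hw (fun t => ∑ s, x s * v t s) k) hδ
  have a2 := abs_integral_div_sub_integral_div_add_le (μ := stdGauss ι) mN' mD'
    (fun x => mul_nonneg (hw k) (sq_nonneg _)) (fun x => single_le_quadForm hw x k) hδ
  have b1 := integral_const_div_add_le (μ := Measure.pi ρ) mD (fun x => quadForm_nonneg hw _) hδ hK
    (fun l hl => integral_exp_quadForm_le hβ hA hK hw hσ hv hρ hAv hJ hl)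
  have b2 := integral_const_div_add_le (μ := stdGauss ι) (c₀ := 0) (c₂ := 0) mD'
    (fun x => quadForm_nonneg hw _) hδ hK (fun l hl => by
      have := (hJ l hl.le).trans (mul_le_mul_of_nonneg_left (inv_one_add_pow_six_le hl.le) hK)
      simpa using this)
  have hNi : Integrable (fun x : σ → ℝ => w k * (∑ s, x s * v k s) ^ 2) (Measure.pi ρ) :=
    (integrable_sq_linear_pi hρ _).const_mul _
  have hNi' : Integrable (fun y : ι → ℝ => w k * y k ^ 2) (stdGauss ι) :=
    (integrable_comp_eval (μ := fun _ : ι => gaussianReal 0 1) (i := k) (f := fun x : ℝ => x ^ 2)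
      (integrable_pow_gaussianReal 2)).const_mul _
  have m := abs_integral_div_add_sub_le (μ := Measure.pi ρ) (ν := stdGauss ι) (c₁ := c / √T)
    (c₂ := c / T ^ 2) mN mD (fun x => mul_nonneg (hw k) (sq_nonneg _))
    (fun x => quadForm_nonneg hw _) hNi mN' mD' (fun x => mul_nonneg (hw k) (sq_nonneg _))
    (fun x => quadForm_nonneg hw _) hNi' hδ (by positivity) (fun l hl => by
      refine (abs_integral_sq_mul_exp_sub_le hβ hA hK hw hσ hv hρ hAv hJ k hl).trans_eq ?_
      rw [← hc, ← hT]; ring)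
  have e3 : (1 / (1 / √T)) ^ 3 / T ^ 2 = 1 / √T := by
    rw [one_div_one_div, show T ^ 2 = √T ^ 4 by rw [show √T ^ 4 = (√T ^ 2) ^ 2 by ring, hsq]]
    field_simp
  have e4 : 6 * (c / T ^ 2) * (1 / (1 / √T)) ^ 3 = 6 * c / √T := by
    rw [show 6 * (c / T ^ 2) * (1 / (1 / √T)) ^ 3 = 6 * c * ((1 / (1 / √T)) ^ 3 / T ^ 2) by ring, e3]
    ring
  have e5 : 2 * (c / T ^ 2) * (1 / (1 / √T)) ^ 3 = 2 * c / √T := by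
    rw [show 2 * (c / T ^ 2) * (1 / (1 / √T)) ^ 3 = 2 * c * ((1 / (1 / √T)) ^ 3 / T ^ 2) by ring, e3]
    ring
  rw [← hc, ← hT, e4] at b1
  rw [e5] at m
  have hpi := Real.pi_le_four
  have p1 : 1 / √T * (K * Real.pi) ≤ 4 * K / √T := by
    rw [show 4 * K / √T = 1 / √T * (K * 4) by ring]; gcongr
  have p2 : c / √T * Real.pi ≤ 4 * c / √T := by
    rw [show 4 * c / √T = c / √T * 4 by ring]; gcongr
  have e6 : (13 * c + 8 * K) / √T =
      2 * c / √T + 4 * c / √T + (c / √T + 4 * K / √T + 6 * c / √T) + 4 * K / √T := by ring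
  rw [e6]
  simp only [mul_zero, zero_mul, add_zero, zero_add] at b2
  rw [abs_le] at *
  constructor <;> linarith [m.1, m.2, a1.1, a1.2, a2.1, a2.2]

end

/-! ### The sine basis and the weights -/

theorem two_mul_sin_mul_sum_cos (x : ℝ) (n : ℕ) :
    2 * Real.sin (x / 2) * ∑ s ∈ Finset.range n, Real.cos (s * x) =
      Real.sin ((n - 1 / 2) * x) + Real.sin (x / 2) := by
  induction n with
  | zero =>
    rw [show ((0 : ℕ) - 1 / 2 : ℝ) * x = -(x / 2) by push_cast; ring, Real.sin_neg]
    simp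
  | succ n ih =>
    rw [Finset.sum_range_succ, mul_add, ih]
    rw [show (((n + 1 : ℕ) : ℝ) - 1 / 2) * x = n * x + x / 2 by push_cast; ring,
      show ((n : ℝ) - 1 / 2) * x = n * x - x / 2 by ring, Real.sin_add, Real.sin_sub]
    ring

theorem sum_cos_eq {T : ℕ} (hT : 0 < T) {m : ℤ} (hm : m ≠ 0) (h1 : -(2 * T : ℤ) < m)
    (h2 : m < 2 * T) :
    ∑ s ∈ Finset.range T, Real.cos (s * (Real.pi * m / T)) = (1 - Real.cos (Real.pi * m)) / 2 := by
  have hT' : (0 : ℝ) < T := by exact_mod_cast hT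
  have hpi := Real.pi_pos
  have h1' : -(2 * T : ℝ) < m := by exact_mod_cast h1
  have h2' : (m : ℝ) < 2 * T := by exact_mod_cast h2
  have hne : Real.sin (Real.pi * m / T / 2) ≠ 0 := by
    rw [Ne, Real.sin_eq_zero_iff_of_lt_of_lt]
    · have : (m : ℝ) ≠ 0 := by exact_mod_cast hm
      positivity
    · rw [div_div, lt_div_iff₀ (by positivity)]; nlinarith
    · rw [div_div, div_lt_iff₀ (by positivity)]; nlinarith
  have h := two_mul_sin_mul_sum_cos (Real.pi * m / T) T
  have e : ((T : ℝ) - 1 / 2) * (Real.pi * m / T) = m * Real.pi - Real.pi * m / T / 2 := by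
    field_simp
  rw [e, Real.sin_sub, Real.sin_int_mul_pi] at h
  have h3 : Real.sin (Real.pi * m / T / 2) *
      (2 * ∑ s ∈ Finset.range T, Real.cos (s * (Real.pi * m / T))) =
      Real.sin (Real.pi * m / T / 2) * (1 - Real.cos (Real.pi * m)) := by
    rw [mul_comm Real.pi (m : ℝ)] at *
    linarith
  have := mul_left_cancel₀ hne h3
  linarith

/-- The product becomes a difference of cosines with frequencies `k - l` and `k + l`. These have the
same parity, so for `k ≠ l` the two cosine sums are equal and cancel. -/
theorem sum_sin_mul_sin {T k l : ℕ} (hk : 0 < k) (hkT : k < T) (hl : 0 < l) (hlT : l < T) :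
    ∑ s ∈ Finset.range T, Real.sin (Real.pi * k * s / T) * Real.sin (Real.pi * l * s / T) =
      if k = l then (T : ℝ) / 2 else 0 := by
  have hT : 0 < T := by omega
  have e : ∀ s ∈ Finset.range T, Real.sin (Real.pi * k * s / T) * Real.sin (Real.pi * l * s / T) =
      (Real.cos (s * (Real.pi * ((k - l : ℤ) : ℝ) / T)) -
        Real.cos (s * (Real.pi * ((k + l : ℤ) : ℝ) / T))) / 2 := by
    intro s _
    rw [show (s : ℝ) * (Real.pi * ((k - l : ℤ) : ℝ) / T) =
        Real.pi * k * s / T - Real.pi * l * s / T by push_cast; ring,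
      show (s : ℝ) * (Real.pi * ((k + l : ℤ) : ℝ) / T) =
        Real.pi * k * s / T + Real.pi * l * s / T by push_cast; ring, Real.cos_sub, Real.cos_add]
    ring
  rw [Finset.sum_congr rfl e, ← Finset.sum_div, Finset.sum_sub_distrib,
    sum_cos_eq hT (m := k + l) (by omega) (by omega) (by omega)]
  split_ifs with h
  · subst h
    simp only [sub_self, Int.cast_zero, mul_zero, zero_div, Real.cos_zero, Finset.sum_const,
      Finset.card_range, nsmul_eq_mul, mul_one]
    rw [show Real.pi * ((k + k : ℤ) : ℝ) = k * (2 * Real.pi) by push_cast; ring,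
      Real.cos_nat_mul_two_pi]
    ring
  · rw [sum_cos_eq hT (m := k - l) (by omega) (by omega) (by omega)]
    rw [show Real.pi * ((k + l : ℤ) : ℝ) = Real.pi * ((k - l : ℤ) : ℝ) + l * (2 * Real.pi) by
      push_cast; ring, Real.cos_add_nat_mul_two_pi]
    ring

theorem sum_vCoord_mul {T k l : ℕ} (hk : 0 < k) (hkT : k < T) (hl : 0 < l) (hlT : l < T) :
    ∑ s : Fin T, vCoord T k (s + 1) * vCoord T l (s + 1) = if k = l then 1 else 0 := by
  have hT : (0 : ℝ) < T := by exact_mod_cast (by omega : 0 < T)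
  have h := sum_sin_mul_sin hk hkT hl hlT
  have e : ∀ s : Fin T, vCoord T k (s + 1) * vCoord T l (s + 1) =
      2 / T * (Real.sin (Real.pi * k * (s : ℕ) / T) * Real.sin (Real.pi * l * (s : ℕ) / T)) := by
    intro s
    rw [vCoord, vCoord]
    push_cast
    rw [add_sub_cancel_right, mul_mul_mul_comm, Real.mul_self_sqrt (by positivity)]
  simp_rw [e]
  rw [← Finset.mul_sum, Fin.sum_univ_eq_sum_range
    (fun s => Real.sin (Real.pi * k * (s : ℕ) / T) * Real.sin (Real.pi * l * (s : ℕ) / T)), h]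
  split_ifs
  · field_simp
  · simp

theorem vCoord_sq_le (T k t : ℕ) : vCoord T k t ^ 2 ≤ 2 / T := by
  rw [vCoord, mul_pow, Real.sq_sqrt (by positivity)]
  exact mul_le_of_le_one_right (by positivity) (Real.sin_sq_le_one _)

theorem vCoord_one (T k : ℕ) : vCoord T k 1 = 0 := by simp [vCoord]

theorem vCoord_succ_self {T : ℕ} (hT : 0 < T) (k : ℕ) : vCoord T k (T + 1) = 0 := by
  have : (T : ℝ) ≠ 0 := by exact_mod_cast hT.ne'
  rw [vCoord]
  push_cast
  rw [add_sub_cancel_right, mul_div_assoc, div_self this, mul_one, mul_comm Real.pi,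
    Real.sin_nat_mul_pi, mul_zero]

section sigma

variable {T k : ℕ} (hk : 0 < k) (hkT : k < T)

include hk hkT

theorem angle_bounds : 0 < Real.pi * k / (2 * T) ∧ Real.pi * k / (2 * T) < Real.pi / 2 := by
  have hT : (0 : ℝ) < T := by exact_mod_cast (by omega : 0 < T)
  have hk' : (0 : ℝ) < k := by exact_mod_cast hk
  have h : (k : ℝ) < T := by exact_mod_cast hkT
  have := Real.pi_pos
  refine ⟨by positivity, ?_⟩
  rw [div_lt_div_iff₀ (by positivity) (by positivity)]
  nlinarith [mul_pos this (sub_pos.2 h)]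

theorem sin_angle_pos : 0 < Real.sin (Real.pi * k / (2 * T)) := by
  have h := angle_bounds hk hkT
  exact Real.sin_pos_of_pos_of_lt_pi h.1 (by linarith [Real.pi_pos])

theorem sigma_pos : 0 < sigma T k := by
  have := sin_angle_pos hk hkT
  rw [sigma]; positivity

theorem sigma_le : sigma T k ≤ T / (2 * k) := by
  have h := angle_bounds hk hkT
  have hk' : (0 : ℝ) < k := by exact_mod_cast hk
  have hT : (0 : ℝ) < T := by exact_mod_cast (by omega : 0 < T)
  have hs := Real.mul_le_sin h.1.le h.2.le
  have e : 2 / Real.pi * (Real.pi * k / (2 * T)) = k / T := by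
    have := Real.pi_pos
    field_simp
  rw [e] at hs
  have : sigma T k ≤ (2 * (k / T : ℝ))⁻¹ := by
    rw [sigma]
    exact inv_anti₀ (by positivity) (by linarith)
  refine this.trans_eq ?_
  field_simp

/-- A difference of consecutive sines carries the factor `2 sin (π k / (2T))`, which is `σ_k⁻¹`. -/
theorem sum_vCoord_sub_sq_le :
    ∑ t ∈ Finset.Icc 1 T, (vCoord T k (t + 1) - vCoord T k t) ^ 2 ≤ 2 * (sigma T k)⁻¹ ^ 2 := by
  have hT : (0 : ℝ) < T := by exact_mod_cast (by omega : 0 < T)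
  have e : ∀ t ∈ Finset.Icc 1 T, (vCoord T k (t + 1) - vCoord T k t) ^ 2 ≤
      2 / T * (sigma T k)⁻¹ ^ 2 := by
    intro t _
    rw [vCoord, vCoord, ← mul_sub, mul_pow, Real.sq_sqrt (by positivity), sigma, inv_inv,
      Real.sin_sub_sin]
    refine mul_le_mul_of_nonneg_left ?_ (by positivity)
    rw [show (Real.pi * k * (((t + 1 : ℕ) : ℝ) - 1) / T - Real.pi * k * ((t : ℝ) - 1) / T) / 2 =
      Real.pi * k / (2 * T) by push_cast; field_simp; ring, mul_pow]
    exact mul_le_of_le_one_right (sq_nonneg _) (Real.cos_sq_le_one _)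
  refine (Finset.sum_le_sum e).trans_eq ?_
  simp only [Finset.sum_const, Nat.card_Icc, nsmul_eq_mul, add_tsub_cancel_right]
  field_simp

end sigma

/-- The normalised weight `(π σ_k / T)²`. -/
noncomputable def weight (T k : ℕ) : ℝ := (Real.pi * sigma T k / T) ^ 2

theorem weight_nonneg (T k : ℕ) : 0 ≤ weight T k := sq_nonneg _

section weight

variable {T k : ℕ} (hk : 0 < k) (hkT : k < T)

include hk hkT

theorem weight_eq : weight T k =
    (Real.pi * k / (2 * T)) ^ 2 / ((k : ℝ) ^ 2 * Real.sin (Real.pi * k / (2 * T)) ^ 2) := by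
  have hk' : (0 : ℝ) < k := by exact_mod_cast hk
  have hT : (0 : ℝ) < T := by exact_mod_cast (by omega : 0 < T)
  have := sin_angle_pos hk hkT
  rw [weight, sigma]
  field_simp

theorem inv_sq_le_weight : ((k : ℝ) ^ 2)⁻¹ ≤ weight T k := by
  have hk' : (0 : ℝ) < k := by exact_mod_cast hk
  have h0 := sin_angle_pos hk hkT
  have h := angle_bounds hk hkT
  have h1 := Real.sin_le h.1.le
  rw [weight_eq hk hkT, inv_eq_one_div, div_le_div_iff₀ (by positivity) (by positivity)]
  have := pow_le_pow_left₀ h0.le h1 2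
  nlinarith [mul_le_mul_of_nonneg_left this (sq_nonneg (k : ℝ))]

/-- From `x cos x ≤ sin x` follows `x² - sin² x ≤ x² sin² x`, so the excess is at most `x² / k² = π²
/ (4 T²)`. -/
theorem weight_sub_le : weight T k - ((k : ℝ) ^ 2)⁻¹ ≤ 7 / (T : ℝ) ^ 2 := by
  have hk' : (0 : ℝ) < k := by exact_mod_cast hk
  have hT : (0 : ℝ) < T := by exact_mod_cast (by omega : 0 < T)
  have h0 := sin_angle_pos hk hkT
  have h := angle_bounds hk hkT
  have hc : 0 < Real.cos (Real.pi * k / (2 * T)) :=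
    Real.cos_pos_of_mem_Ioo ⟨by linarith [h.1, Real.pi_pos], h.2⟩
  have h2 := Real.le_tan h.1.le h.2
  rw [Real.tan_eq_sin_div_cos, le_div_iff₀ hc] at h2
  have hxT : (Real.pi * k / (2 * T)) * (2 * T) = Real.pi * k := by field_simp
  have h6 := Real.sin_sq_add_cos_sq (Real.pi * k / (2 * T))
  have h1 := Real.sin_le h.1.le
  rw [weight_eq hk hkT]
  generalize Real.pi * k / (2 * T) = x at *
  have h4 : x ^ 2 * (1 - Real.sin x ^ 2) ≤ Real.sin x ^ 2 := by
    have := pow_le_pow_left₀ (by positivity [h.1.le]) h2 2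
    rw [mul_pow] at this
    nlinarith
  have h5 : x ^ 2 - Real.sin x ^ 2 ≤ x ^ 2 * Real.sin x ^ 2 := by nlinarith
  have e : x ^ 2 / ((k : ℝ) ^ 2 * Real.sin x ^ 2) - ((k : ℝ) ^ 2)⁻¹ =
      (x ^ 2 - Real.sin x ^ 2) / ((k : ℝ) ^ 2 * Real.sin x ^ 2) := by
    field_simp
  rw [e]
  have h7 : (x ^ 2 - Real.sin x ^ 2) / ((k : ℝ) ^ 2 * Real.sin x ^ 2) ≤ x ^ 2 / (k : ℝ) ^ 2 := by
    rw [div_le_div_iff₀ (by positivity) (by positivity)]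
    nlinarith [mul_le_mul_of_nonneg_left h5 (sq_nonneg (k : ℝ))]
  refine h7.trans ?_
  rw [div_le_div_iff₀ (by positivity) (by positivity)]
  have h8 : x ^ 2 * (T : ℝ) ^ 2 * 4 = Real.pi ^ 2 * (k : ℝ) ^ 2 := by
    rw [← mul_pow, ← mul_pow, ← hxT]; ring
  have h9 : Real.pi ^ 2 ≤ 16 := by
    have := Real.pi_le_four
    nlinarith [Real.pi_pos]
  nlinarith [sq_nonneg (k : ℝ)]

theorem weight_le : weight T k ≤ 8 * ((k : ℝ) ^ 2)⁻¹ := by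
  have hk' : (0 : ℝ) < k := by exact_mod_cast hk
  have hT : (0 : ℝ) < T := by exact_mod_cast (by omega : 0 < T)
  have h := weight_sub_le hk hkT
  have h1 : 7 / (T : ℝ) ^ 2 ≤ 7 * ((k : ℝ) ^ 2)⁻¹ := by
    rw [← div_eq_mul_inv]
    have : (k : ℝ) ≤ T := by exact_mod_cast hkT.le
    gcongr
  linarith

end weight

theorem sum_inv_sq_le (m : ℕ) : ∑ i ∈ Finset.range m, (((i + 1 : ℕ) : ℝ) ^ 2)⁻¹ ≤ 2 - (m : ℝ)⁻¹ := by
  induction m with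
  | zero => simp
  | succ m ih =>
    rw [Finset.sum_range_succ]
    rcases m.eq_zero_or_pos with h | h
    · subst h; norm_num
    · have hm : (0 : ℝ) < m := by exact_mod_cast h
      have : ((((m + 1 : ℕ) : ℝ)) ^ 2)⁻¹ ≤ (m : ℝ)⁻¹ - ((m + 1 : ℕ) : ℝ)⁻¹ := by
        push_cast
        rw [← sub_nonneg]
        have : (m : ℝ)⁻¹ - ((m : ℝ) + 1)⁻¹ - (((m : ℝ) + 1) ^ 2)⁻¹ =
            1 / (m * ((m : ℝ) + 1) ^ 2) := by field_simp; ring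
        rw [this]; positivity
      linarith

theorem sum_weight_le (T : ℕ) : ∑ i : Fin (T - 1), weight T (i + 1) ≤ 16 := by
  have h : ∀ i : Fin (T - 1), weight T (i + 1) ≤ 8 * (((i + 1 : ℕ) : ℝ) ^ 2)⁻¹ := fun i =>
    weight_le (by omega) (by omega)
  refine (Finset.sum_le_sum fun i _ => h i).trans ?_
  rw [← Finset.mul_sum, Fin.sum_univ_eq_sum_range (fun i => (((i + 1 : ℕ) : ℝ) ^ 2)⁻¹)]
  have := sum_inv_sq_le (T - 1)
  have : (0 : ℝ) ≤ ((T - 1 : ℕ) : ℝ)⁻¹ := by positivity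
  linarith

theorem two_mul_sum_weight_mul_vCoord_sq_le (T : ℕ) (s : Fin T) :
    2 * ∑ i : Fin (T - 1), weight T (i + 1) * vCoord T (i + 1) (s + 1) ^ 2 ≤
      64 / Fintype.card (Fin T) := by
  have h : ∀ i : Fin (T - 1), weight T (i + 1) * vCoord T (i + 1) (s + 1) ^ 2 ≤
      weight T (i + 1) * (2 / T) := fun i =>
    mul_le_mul_of_nonneg_left (vCoord_sq_le _ _ _) (weight_nonneg _ _)
  have h1 := Finset.sum_le_sum fun i (_ : i ∈ Finset.univ) => h i
  rw [← Finset.sum_mul] at h1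
  have h2 := mul_le_mul_of_nonneg_right (sum_weight_le T) (by positivity : (0 : ℝ) ≤ 2 / T)
  rw [Fintype.card_fin, show (64 : ℝ) / T = 2 * (16 * (2 / T)) by ring]
  linarith

theorem sum_sigma_le {T : ℕ} (hT : 0 < T) :
    ∑ i : Fin (T - 1), sigma T (i + 1) ≤ T / 2 * (1 + Real.log T) := by
  have h : ∀ i : Fin (T - 1), sigma T (i + 1) ≤ T / 2 * ((i + 1 : ℕ) : ℝ)⁻¹ := fun i => by
    refine (sigma_le (by omega) (by omega)).trans_eq ?_
    field_simp
  refine (Finset.sum_le_sum fun i _ => h i).trans ?_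
  rw [← Finset.mul_sum, Fin.sum_univ_eq_sum_range (fun i => ((i + 1 : ℕ) : ℝ)⁻¹)]
  refine mul_le_mul_of_nonneg_left ?_ (by positivity)
  have h1 : ∑ i ∈ Finset.range (T - 1), ((i + 1 : ℕ) : ℝ)⁻¹ ≤
      ∑ i ∈ Finset.range T, ((i + 1 : ℕ) : ℝ)⁻¹ :=
    Finset.sum_le_sum_of_subset_of_nonneg (Finset.range_mono (by omega))
      fun _ _ _ => by positivity
  have h2 := harmonic_le_one_add_log T
  rw [harmonic] at h2
  push_cast at h1 h2 ⊢
  exact h1.trans h2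

/-- The integral is the product of `(1 + 2 l w_i)^(-1/2)`. Twelve weights bounded below give the
sixth power; the other factors are at most `1`. -/
theorem integral_exp_quadForm_gauss_le {m : ℕ} (hm : 12 ≤ m) {w : Fin m → ℝ} (hw : ∀ i, 0 ≤ w i)
    (hw1 : ∀ i : Fin m, (((i + 1 : ℕ) : ℝ) ^ 2)⁻¹ ≤ w i) {l : ℝ} (hl : 0 ≤ l) :
    ∫ z, Real.exp (-(l * quadForm w z)) ∂(stdGauss (Fin m)) ≤ 72 ^ 6 * ((1 + l) ^ 6)⁻¹ := by
  have e : ∀ z : Fin m → ℝ, Real.exp (-(l * quadForm w z)) =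
      ∏ i, Real.exp (-((l * w i) * z i ^ 2)) := by
    intro z
    rw [← Real.exp_sum, Finset.sum_neg_distrib, quadForm, Finset.mul_sum]
    simp_rw [mul_assoc]
  simp_rw [e]
  rw [integral_fintype_prod_eq_prod (fun i (z : ℝ) => Real.exp (-((l * w i) * z ^ 2)))]
  set a : ℝ := (√(1 + l / 72))⁻¹ with ha
  have ha0 : 0 ≤ a := by positivity
  have h1 : ∀ i : Fin m, ∫ z : ℝ, Real.exp (-((l * w i) * z ^ 2)) ∂(gaussianReal 0 1) ≤
      if (i : ℕ) < 12 then a else 1 := by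
    intro i
    have hlw : 0 ≤ l * w i := mul_nonneg hl (hw i)
    rw [integral_exp_neg_mul_sq_gaussianReal hlw]
    split_ifs with h
    · refine inv_anti₀ (by positivity) (Real.sqrt_le_sqrt ?_)
      -- The twelfth weight is at least `12⁻²`, so `1 + 2 l w_i ≥ 1 + l / 72`.
      have h2 : ((144 : ℝ))⁻¹ ≤ w i := by
        refine le_trans ?_ (hw1 i)
        refine inv_anti₀ (by positivity) ?_
        have : ((i + 1 : ℕ) : ℝ) ≤ 12 := by exact_mod_cast h
        have h0 : (0 : ℝ) ≤ ((i + 1 : ℕ) : ℝ) := by positivity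
        nlinarith
      nlinarith [mul_le_mul_of_nonneg_left h2 hl]
    · exact inv_le_one_of_one_le₀ (Real.one_le_sqrt.2 (by linarith))
  have h2 : ∏ i : Fin m, (if (i : ℕ) < 12 then a else 1) = a ^ 12 := by
    rw [Fin.prod_univ_eq_prod_range (fun i => if i < 12 then a else 1)]
    rw [← Finset.prod_range_mul_prod_Ico _ hm, Finset.prod_congr rfl (g := fun _ => a)
      (fun i hi => if_pos (Finset.mem_range.1 hi)), Finset.prod_congr rfl (g := fun _ => 1)
      (fun i hi => if_neg (not_lt.2 (Finset.mem_Ico.1 hi).1))]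
    simp
  refine (Finset.prod_le_prod (fun i _ => integral_nonneg fun z => (Real.exp_pos _).le)
    (fun i _ => h1 i)).trans ?_
  rw [h2, ha, inv_pow, show (12 : ℕ) = 2 * 6 from rfl, pow_mul, Real.sq_sqrt (by positivity),
    ← div_eq_mul_inv, le_div_iff₀ (by positivity), ← div_eq_inv_mul, div_le_iff₀ (by positivity),
    ← mul_pow]
  exact pow_le_pow_left₀ (by positivity) (by linarith) 6

/-! ### White noise and the Beveridge-Nelson remainder -/

/-- A measurable white noise: uncorrelated variables with unit second moment. -/
structure IsWhite {Ω : Type*} [MeasurableSpace Ω] (μ : Measure Ω) (ξ : ℤ → Ω → ℝ) : Prop where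
  meas : ∀ t, Measurable (ξ t)
  memLp : ∀ t, MemLp (ξ t) 2 μ
  cov : ∀ s t, ∫ ω, ξ s ω * ξ t ω ∂μ = if s = t then 1 else 0

section

variable {Ω : Type*} [MeasurableSpace Ω] {μ : Measure Ω} {ξ : ℤ → Ω → ℝ}

theorem IsWhite.integral_sum_sq (h : IsWhite μ ξ) {α : Type*} (S : Finset α) (c : α → ℝ)
    {p : α → ℤ} (hp : Function.Injective p) :
    Integrable (fun ω => (∑ t ∈ S, c t * ξ (p t) ω) ^ 2) μ ∧
    ∫ ω, (∑ t ∈ S, c t * ξ (p t) ω) ^ 2 ∂μ = ∑ t ∈ S, c t ^ 2 := by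
  classical
  have hi : ∀ s t, Integrable (fun ω => ξ s ω * ξ t ω) μ := fun s t =>
    (h.memLp s).integrable_mul (h.memLp t)
  have e : ∀ ω, (∑ t ∈ S, c t * ξ (p t) ω) ^ 2 =
      ∑ t ∈ S, ∑ s ∈ S, c t * c s * (ξ (p t) ω * ξ (p s) ω) := by
    intro ω
    rw [sq, Finset.sum_mul_sum]
    exact Finset.sum_congr rfl fun _ _ => Finset.sum_congr rfl fun _ _ => by ring
  simp_rw [e]
  have hj : ∀ t s, Integrable (fun ω => c t * c s * (ξ (p t) ω * ξ (p s) ω)) μ := fun t s =>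
    (hi _ _).const_mul _
  refine ⟨integrable_finsetSum _ fun t _ => integrable_finsetSum _ fun s _ => hj t s, ?_⟩
  rw [integral_finsetSum _ fun t _ => integrable_finsetSum _ fun s _ => hj t s]
  refine Finset.sum_congr rfl fun t ht => ?_
  rw [integral_finsetSum _ fun s _ => hj t s]
  simp_rw [integral_const_mul, h.cov, hp.eq_iff]
  simp [ht, sq]

theorem sum_Icc_mul_shift (v : ℕ → ℝ) (x : ℤ → ℝ) (n : ℕ) (r : ℤ) :
    ∑ t ∈ Finset.Icc 1 n, v t * x (t - r - 1) =
      ∑ t ∈ Finset.Icc 1 n, v (t + 1) * x (t - r) + v 1 * x (-r) - v (n + 1) * x (n - r) := by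
  induction n with
  | zero => simp
  | succ n ih =>
    rw [Finset.sum_Icc_succ_top (by omega), Finset.sum_Icc_succ_top (by omega), ih]
    push_cast
    rw [show (n : ℤ) + 1 - r - 1 = n - r by ring]
    ring

/-- A shift by `l` is a telescoping sum of `l` unit shifts. Summation by parts, without boundary
terms because `v` vanishes at `1` and `T + 1`, moves each unit shift onto `v`. -/
theorem IsWhite.integral_shift_sq (h : IsWhite μ ξ) {v : ℕ → ℝ} {T : ℕ} (hv1 : v 1 = 0)
    (hvT : v (T + 1) = 0) (l : ℕ) :
    Integrable (fun ω => (∑ t ∈ Finset.Icc 1 T, v t * (ξ (t - l) ω - ξ t ω)) ^ 2) μ ∧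
    ∫ ω, (∑ t ∈ Finset.Icc 1 T, v t * (ξ (t - l) ω - ξ t ω)) ^ 2 ∂μ ≤
      (l : ℝ) ^ 2 * ∑ t ∈ Finset.Icc 1 T, (v (t + 1) - v t) ^ 2 := by
  set V := ∑ t ∈ Finset.Icc 1 T, (v (t + 1) - v t) ^ 2
  have hQ := fun m : ℕ => h.integral_sum_sq (Finset.Icc 1 T) (fun t => v (t + 1) - v t)
    (p := fun t : ℕ => (t : ℤ) - m) (fun a b hab => by simpa using hab)
  have e : ∀ ω, ∑ t ∈ Finset.Icc 1 T, v t * (ξ (t - l) ω - ξ t ω) =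
      ∑ m ∈ Finset.range l, ∑ t ∈ Finset.Icc 1 T, (v (t + 1) - v t) * ξ (t - m) ω := by
    intro ω
    induction l with
    | zero => simp
    | succ l ih =>
      rw [Finset.sum_range_succ, ← ih]
      have := sum_Icc_mul_shift v (fun s => ξ s ω) T l
      rw [hv1, hvT, zero_mul, zero_mul, add_zero, sub_zero] at this
      simp_rw [mul_sub, sub_mul, Finset.sum_sub_distrib]
      rw [← this]
      push_cast
      simp_rw [show ∀ t : ℕ, (t : ℤ) - (l + 1) = t - l - 1 from fun t => by ring]
      ring
  have hb : ∀ ω, (∑ t ∈ Finset.Icc 1 T, v t * (ξ (t - l) ω - ξ t ω)) ^ 2 ≤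
      l * ∑ m ∈ Finset.range l, (∑ t ∈ Finset.Icc 1 T, (v (t + 1) - v t) * ξ (t - m) ω) ^ 2 := by
    intro ω
    rw [e]
    simpa using sq_sum_le_card_mul_sum_sq (s := Finset.range l)
      (f := fun m : ℕ => ∑ t ∈ Finset.Icc 1 T, (v (t + 1) - v t) * ξ (t - m) ω)
  have hi : Integrable (fun ω => (l : ℝ) * ∑ m ∈ Finset.range l,
      (∑ t ∈ Finset.Icc 1 T, (v (t + 1) - v t) * ξ (t - m) ω) ^ 2) μ :=
    (integrable_finsetSum _ fun m _ => (hQ m).1).const_mul _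
  have hi' : Integrable (fun ω => (∑ t ∈ Finset.Icc 1 T, v t * (ξ (t - l) ω - ξ t ω)) ^ 2) μ := by
    refine hi.mono' ?_ (.of_forall fun ω => ?_)
    · have := h.meas
      exact (by fun_prop : Measurable _).aestronglyMeasurable
    · rw [Real.norm_eq_abs, abs_of_nonneg (sq_nonneg _)]; exact hb ω
  refine ⟨hi', (integral_mono hi' hi hb).trans_eq ?_⟩
  rw [integral_const_mul, integral_finsetSum _ fun m _ => (hQ m).1]
  simp_rw [(hQ _).2]
  simp only [Finset.sum_const, Finset.card_range, nsmul_eq_mul]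
  ring

/-- The linear process `∑_k ψ_k ξ_{t-k}`. -/
noncomputable def linProc (ψ : ℕ → ℝ) (ξ : ℤ → Ω → ℝ) (t : ℤ) (ω : Ω) : ℝ :=
  ∑' k : ℕ, ψ k * ξ (t - k) ω

variable {ψ : ℕ → ℝ} {B : ℝ}

theorem summable_abs_of_weighted (hs : Summable fun k : ℕ => (1 + (k : ℝ)) * |ψ k|) :
    Summable fun k => |ψ k| :=
  hs.of_nonneg_of_le (fun _ => abs_nonneg _) fun k =>
    le_mul_of_one_le_left (abs_nonneg _) (by linarith [(Nat.cast_nonneg k : (0 : ℝ) ≤ k)])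

/-- The expected sum of absolute values is at most `∑ |ψ_k|`, since each noise variable has first
absolute moment at most `1`. -/
theorem IsWhite.ae_summable [IsProbabilityMeasure μ] (h : IsWhite μ ξ)
    (hs : Summable fun k : ℕ => (1 + (k : ℝ)) * |ψ k|) :
    ∀ᵐ ω ∂μ, ∀ t : ℤ, Summable fun k : ℕ => ψ k * ξ (t - k) ω := by
  rw [ae_all_iff]
  intro t
  have hs' := summable_abs_of_weighted hs
  have hb : ∀ s, ∫⁻ ω, ‖ξ s ω‖ₑ ∂μ ≤ 1 := by
    intro s
    have h1 : eLpNorm (ξ s) 1 μ ≤ eLpNorm (ξ s) 2 μ :=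
      eLpNorm_le_eLpNorm_of_exponent_le (by norm_num) (h.memLp s).1
    rw [eLpNorm_one_eq_lintegral_enorm] at h1
    refine h1.trans ?_
    have h2 : ∫ ω, ‖ξ s ω‖ ^ (2 : ENNReal).toReal ∂μ = 1 := by
      have := h.cov s s
      simp only [if_true] at this
      rw [← this]
      congr 1; ext ω; simp [sq]
    rw [(h.memLp s).eLpNorm_eq_integral_rpow_norm (by norm_num) (by norm_num), h2]
    simp
  have hfin : ∫⁻ ω, ∑' k : ℕ, ‖ψ k * ξ (t - k) ω‖ₑ ∂μ < ⊤ := by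
    rw [lintegral_tsum (fun k => by have := h.meas; fun_prop)]
    have : ∀ k : ℕ, ∫⁻ ω, ‖ψ k * ξ (t - k) ω‖ₑ ∂μ ≤ ENNReal.ofReal |ψ k| := by
      intro k
      simp_rw [enorm_mul]
      rw [lintegral_const_mul _ (by have := h.meas; fun_prop), ← Real.enorm_eq_ofReal_abs]
      exact mul_le_of_le_one_right' (hb _)
    exact (ENNReal.tsum_le_tsum this).trans_lt hs'.tsum_ofReal_lt_top
  have hae := ae_lt_top' (by have := h.meas; fun_prop) hfin.ne
  filter_upwards [hae] with ω hω
  exact Summable.of_enorm hω.ne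

/-- The remainder of the Beveridge-Nelson approximation of `∑_t v_t e_t`. -/
noncomputable def remainder (ψ : ℕ → ℝ) (ξ : ℤ → Ω → ℝ) (v : ℕ → ℝ) (T : ℕ) (ω : Ω) : ℝ :=
  ∑ t ∈ Finset.Icc 1 T, linProc ψ ξ t ω * v t -
    (∑' k, ψ k) * ∑ t ∈ Finset.Icc 1 T, ξ t ω * v t

theorem measurable_linProc (hm : ∀ t, Measurable (ξ t)) (t : ℤ) : Measurable (linProc ψ ξ t) :=
  Measurable.tsum fun _ => (hm _).const_mul _

/-- The remainder is `∑_l ψ_l S_l`, with `S_l` the effect of a shift by `l`, whose second moment is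
at most `l² V`. -/
theorem IsWhite.integral_remainder_sq [IsProbabilityMeasure μ] (h : IsWhite μ ξ)
    (hs : Summable fun k : ℕ => (1 + (k : ℝ)) * |ψ k|)
    (hB : ∑' k : ℕ, (1 + (k : ℝ)) * |ψ k| ≤ B) {v : ℕ → ℝ} {T : ℕ} (hv1 : v 1 = 0)
    (hvT : v (T + 1) = 0) :
    Integrable (fun ω => remainder ψ ξ v T ω ^ 2) μ ∧
    ∫ ω, remainder ψ ξ v T ω ^ 2 ∂μ ≤
      B ^ 2 * ∑ t ∈ Finset.Icc 1 T, (v (t + 1) - v t) ^ 2 := by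
  have hm := h.meas
  set V := ∑ t ∈ Finset.Icc 1 T, (v (t + 1) - v t) ^ 2 with hV
  have hV0 : 0 ≤ V := Finset.sum_nonneg fun _ _ => sq_nonneg _
  set S : ℕ → Ω → ℝ := fun l ω => ∑ t ∈ Finset.Icc 1 T, v t * (ξ (t - l) ω - ξ t ω) with hS
  have hSm : ∀ l, Measurable (S l) := fun l => by rw [hS]; fun_prop
  have hSi : ∀ l, Integrable (fun ω => S l ω ^ 2) μ := fun l => (h.integral_shift_sq hv1 hvT l).1
  have hSb : ∀ l : ℕ, ∫ ω, S l ω ^ 2 ∂μ ≤ (l : ℝ) ^ 2 * V := fun l =>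
    (h.integral_shift_sq hv1 hvT l).2
  have hB0 : 0 ≤ B := (tsum_nonneg fun _ => by positivity).trans hB
  have hpart : ∀ n, ∑ k ∈ Finset.range n, (1 + (k : ℝ)) * |ψ k| ≤ B := fun n =>
    (hs.sum_le_tsum _ fun k _ => by positivity).trans hB
  have hRm : Measurable (remainder ψ ξ v T) := by
    have := measurable_linProc (ψ := ψ) hm
    unfold remainder
    fun_prop
  have hlim : ∀ᵐ ω ∂μ, Filter.Tendsto (fun n => ∑ l ∈ Finset.range n, ψ l * S l ω) Filter.atTop
      (nhds (remainder ψ ξ v T ω)) := by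
    filter_upwards [h.ae_summable hs] with ω hω
    have h1 : HasSum (fun l : ℕ => ∑ t ∈ Finset.Icc 1 T, (ψ l * ξ (t - l) ω * v t -
        ψ l * (ξ t ω * v t))) (∑ t ∈ Finset.Icc 1 T, (linProc ψ ξ t ω * v t -
        (∑' k, ψ k) * (ξ t ω * v t))) := by
      refine hasSum_sum fun t _ => ?_
      exact ((hω t).hasSum.mul_right _).sub ((summable_abs_of_weighted hs).of_abs.hasSum.mul_right _)
    have e : ∀ l : ℕ, ∑ t ∈ Finset.Icc 1 T, (ψ l * ξ (t - l) ω * v t - ψ l * (ξ t ω * v t)) =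
        ψ l * S l ω := by
      intro l
      rw [hS, Finset.mul_sum]
      exact Finset.sum_congr rfl fun t _ => by ring
    simp_rw [e] at h1
    rw [Finset.sum_sub_distrib, ← Finset.mul_sum] at h1
    exact h1.tendsto_sum_nat
  have hn : ∀ n, ∫⁻ ω, ENNReal.ofReal ((∑ l ∈ Finset.range n, ψ l * S l ω) ^ 2) ∂μ ≤
      ENNReal.ofReal (B ^ 2 * V) := by
    intro n
    have hpt : ∀ ω, (∑ l ∈ Finset.range n, ψ l * S l ω) ^ 2 ≤
        B * ∑ l ∈ Finset.range n, |ψ l| / (1 + (l : ℝ)) * S l ω ^ 2 := by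
      intro ω
      -- Cauchy-Schwarz with weights `1 + l`: the growth `l²` of the second moment of `S l` turns
      -- `|ψ_l| / (1 + l)` back into at most `(1 + l) |ψ_l|`, so both factors are bounded by `B`.
      have hcs := Finset.sum_sq_le_sum_mul_sum_of_sq_le_mul (Finset.range n)
        (r := fun l => ψ l * S l ω) (f := fun l : ℕ => (1 + (l : ℝ)) * |ψ l|)
        (g := fun l : ℕ => |ψ l| / (1 + (l : ℝ)) * S l ω ^ 2)
        (fun l _ => by positivity) (fun l _ => by positivity) (fun l _ => by
          have : (1 + (l : ℝ)) ≠ 0 := by positivity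
          refine le_of_eq ?_
          rw [mul_pow, ← sq_abs (ψ l)]; field_simp)
      refine hcs.trans (mul_le_mul_of_nonneg_right (hpart n) ?_)
      exact Finset.sum_nonneg fun l _ => by positivity
    have hi : Integrable (fun ω => B * ∑ l ∈ Finset.range n, |ψ l| / (1 + (l : ℝ)) * S l ω ^ 2) μ :=
      (integrable_finsetSum _ fun l _ => (hSi l).const_mul _).const_mul _
    calc _ ≤ ∫⁻ ω, ENNReal.ofReal (B * ∑ l ∈ Finset.range n, |ψ l| / (1 + (l : ℝ)) * S l ω ^ 2) ∂μ :=
          lintegral_mono fun ω => ENNReal.ofReal_le_ofReal (hpt ω)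
      _ = ENNReal.ofReal (∫ ω, B * ∑ l ∈ Finset.range n, |ψ l| / (1 + (l : ℝ)) * S l ω ^ 2 ∂μ) :=
          (ofReal_integral_eq_lintegral_ofReal hi (.of_forall fun ω =>
            (sq_nonneg _).trans (hpt ω))).symm
      _ ≤ _ := by
          refine ENNReal.ofReal_le_ofReal ?_
          rw [integral_const_mul, integral_finsetSum _ fun l _ => (hSi l).const_mul _, sq, mul_assoc]
          refine mul_le_mul_of_nonneg_left ?_ hB0
          refine le_trans (Finset.sum_le_sum fun l _ => ?_)
            ((Finset.sum_mul _ _ V).symm.le.trans (mul_le_mul_of_nonneg_right (hpart n) hV0))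
          rw [integral_const_mul]
          refine (mul_le_mul_of_nonneg_left (hSb l) (by positivity)).trans ?_
          rw [← mul_assoc]
          refine mul_le_mul_of_nonneg_right ?_ hV0
          rw [div_mul_eq_mul_div, div_le_iff₀ (by positivity), mul_comm (|ψ l|)]
          have h0 := abs_nonneg (ψ l)
          have h1 : (l : ℝ) ^ 2 ≤ (1 + l) * (1 + l) := by
            have : (0 : ℝ) ≤ l := by positivity
            nlinarith
          nlinarith [mul_le_mul_of_nonneg_right h1 h0]
  -- Fatou's lemma passes the bound from partial sums to their almost sure limit.
  have hfat : ∫⁻ ω, ENNReal.ofReal (remainder ψ ξ v T ω ^ 2) ∂μ ≤ ENNReal.ofReal (B ^ 2 * V) := by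
    have e : ∫⁻ ω, ENNReal.ofReal (remainder ψ ξ v T ω ^ 2) ∂μ =
        ∫⁻ ω, Filter.liminf (fun n => ENNReal.ofReal ((∑ l ∈ Finset.range n, ψ l * S l ω) ^ 2))
          Filter.atTop ∂μ := by
      refine lintegral_congr_ae ?_
      filter_upwards [hlim] with ω hω
      exact ((ENNReal.tendsto_ofReal (hω.pow 2)).liminf_eq).symm
    rw [e]
    refine (lintegral_liminf_le fun n => by fun_prop).trans ?_
    exact Filter.liminf_le_of_le (by isBoundedDefault) fun b hb => by
      obtain ⟨n, hn'⟩ := hb.exists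
      exact hn'.trans (hn n)
  have hint : Integrable (fun ω => remainder ψ ξ v T ω ^ 2) μ := by
    refine ⟨by fun_prop, ?_⟩
    rw [hasFiniteIntegral_iff_ofReal (.of_forall fun ω => sq_nonneg _)]
    exact hfat.trans_lt ENNReal.ofReal_lt_top
  refine ⟨hint, ?_⟩
  rw [← ofReal_integral_eq_lintegral_ofReal hint (.of_forall fun ω => sq_nonneg _)] at hfat
  exact (ENNReal.ofReal_le_ofReal_iff (by positivity)).1 hfat

end

/-! ### Stability of expected ratios -/

/-- Since `a / A ≤ 1`, only `B` appears in the denominator of the difference; no lower bound on `A`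
is needed. -/
theorem abs_div_sub_div_le {a A b B s : ℝ} (ha : 0 ≤ a) (haA : a ≤ A) (hB : 0 < B)
    (h1 : |a - b| ≤ s) (h2 : |A - B| ≤ s) : |a / A - b / B| ≤ 2 * s / B := by
  have hA : 0 ≤ A := ha.trans haA
  have hq : |a / A| ≤ 1 := by
    rw [abs_of_nonneg (div_nonneg ha hA)]; exact div_le_one_of_le₀ haA hA
  have e : a / A - b / B = ((a - b) - a / A * (A - B)) / B := by
    rcases hA.eq_or_lt with h | h
    · have : a = 0 := le_antisymm (h ▸ haA) ha
      subst this; simp [neg_div]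
    · field_simp; ring
  rw [e, abs_div, abs_of_pos hB]
  refine div_le_div_of_nonneg_right ?_ hB.le
  refine (abs_sub _ _).trans ?_
  rw [abs_mul]
  have := mul_le_mul hq h2 (abs_nonneg _) zero_le_one
  linarith

/-- Where `B < η` both ratios lie in `[0, 1]` and differ by at most `1`; elsewhere the pointwise
bound applies with `B ≥ η`. -/
theorem abs_integral_ratio_compare {α : Type*} [MeasurableSpace α] {μ : Measure α}
    [IsProbabilityMeasure μ] {a A b B S : α → ℝ} (ma : Measurable a) (mA : Measurable A)
    (mb : Measurable b) (mB : Measurable B) (ha : ∀ᵐ x ∂μ, 0 ≤ a x ∧ a x ≤ A x)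
    (hb : ∀ᵐ x ∂μ, 0 ≤ b x ∧ b x ≤ B x) (h1 : ∀ᵐ x ∂μ, |a x - b x| ≤ S x)
    (h2 : ∀ᵐ x ∂μ, |A x - B x| ≤ S x) (hS : Integrable S μ) {η : ℝ} (hη : 0 < η) :
    Integrable (fun x => a x / A x) μ ∧
    |(∫ x, a x / A x ∂μ) - ∫ x, b x / B x ∂μ| ≤ μ.real {x | B x < η} + 2 / η * ∫ x, S x ∂μ := by
  have i1 : Integrable (fun x => a x / A x) μ :=
    Integrable.of_bound (C := 1) (ma.div mA).aestronglyMeasurable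
      (ha.mono fun x hx => div_mem_unit hx.1 hx.2)
  have i2 : Integrable (fun x => b x / B x) μ :=
    Integrable.of_bound (C := 1) (mb.div mB).aestronglyMeasurable
      (hb.mono fun x hx => div_mem_unit hx.1 hx.2)
  have ms : MeasurableSet {x | B x < η} := measurableSet_lt mB measurable_const
  have i3 : Integrable ({x | B x < η}.indicator fun _ => (1 : ℝ)) μ :=
    (integrable_const _).indicator ms
  refine ⟨i1, ?_⟩
  rw [← integral_sub i1 i2, ← Real.norm_eq_abs]
  calc _ ≤ ∫ x, ({x | B x < η}.indicator (fun _ => (1 : ℝ)) x + 2 / η * S x) ∂μ := by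
        refine norm_integral_le_of_norm_le (i3.add (hS.const_mul _)) ?_
        filter_upwards [ha, hb, h1, h2] with x hax hbx h1x h2x
        have hS0 : 0 ≤ S x := (abs_nonneg _).trans h1x
        by_cases hx : B x < η
        · rw [Set.indicator_of_mem (by exact hx)]
          have p1 := div_nonneg hax.1 (hax.1.trans hax.2)
          have p2 := div_nonneg hbx.1 (hbx.1.trans hbx.2)
          have p3 := div_le_one_of_le₀ hax.2 (hax.1.trans hax.2)
          have p4 := div_le_one_of_le₀ hbx.2 (hbx.1.trans hbx.2)
          have p5 : 0 ≤ 2 / η * S x := by positivity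
          rw [Real.norm_eq_abs, abs_le]
          constructor <;> linarith
        · rw [Set.indicator_of_notMem (by exact hx), zero_add]
          push Not at hx
          refine (abs_div_sub_div_le hax.1 hax.2 (hη.trans_le hx) h1x h2x).trans ?_
          rw [div_mul_eq_mul_div]
          gcongr
    _ = _ := by
        rw [integral_add i3 (hS.const_mul _), integral_const_mul, integral_indicator ms]
        simp [Measure.real]

theorem integral_tsum_of_nonneg {α : Type*} [MeasurableSpace α] {μ : Measure α} {F : ℕ → α → ℝ}
    (hm : ∀ i, Measurable (F i)) (hF0 : ∀ i x, 0 ≤ F i x) (hi : ∀ i, Integrable (F i) μ)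
    (hs : Summable fun i => ∫ x, F i x ∂μ) :
    (∀ᵐ x ∂μ, Summable fun i => F i x) ∧ Integrable (fun x => ∑' i, F i x) μ ∧
    ∫ x, ∑' i, F i x ∂μ = ∑' i, ∫ x, F i x ∂μ := by
  have h1 : ∀ i, eLpNorm (F i) 1 μ = ENNReal.ofReal (∫ x, F i x ∂μ) := fun i => by
    rw [eLpNorm_one_eq_lintegral_enorm,
      ofReal_integral_eq_lintegral_ofReal (hi i) (.of_forall (hF0 i))]
    exact lintegral_congr fun x => Real.enorm_of_nonneg (hF0 i x)
  have hfin : ∑' i, eLpNorm (F i) 1 μ ≠ ⊤ := by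
    simp_rw [h1]
    exact hs.tsum_ofReal_lt_top.ne
  have hae := summable_norm_of_tsum_eLpNorm_ne_top le_rfl
    (fun i => (hm i).aestronglyMeasurable) hfin
  have hae' : ∀ᵐ x ∂μ, Summable fun i => F i x := hae.mono fun x hx => hx.of_norm
  refine ⟨hae', ⟨(Measurable.tsum hm).aestronglyMeasurable, ?_⟩, ?_⟩
  · rw [hasFiniteIntegral_iff_ofReal (.of_forall fun x => tsum_nonneg fun i => hF0 i x)]
    have : ∫⁻ x, ENNReal.ofReal (∑' i, F i x) ∂μ = ∑' i, ENNReal.ofReal (∫ x, F i x ∂μ) := by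
      rw [lintegral_congr_ae (hae'.mono fun x hx => ENNReal.ofReal_tsum_of_nonneg
        (fun i => hF0 i x) hx), lintegral_tsum fun i => by have := hm i; fun_prop]
      exact tsum_congr fun i =>
        (ofReal_integral_eq_lintegral_ofReal (hi i) (.of_forall (hF0 i))).symm
    rw [this]
    exact hs.tsum_ofReal_lt_top
  · refine (integral_tsum_of_summable_integral_norm hi ?_).symm
    refine hs.congr fun i => integral_congr_ae (.of_forall fun x => ?_)
    simp [abs_of_nonneg (hF0 i x)]

/-! ### From the finite Gaussian ratio to the infinite one -/

section Gaussian

/-- The weights `weight T (i + 1)` for `i + 1 < T`, extended by zero. -/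
noncomputable def extWeight (T i : ℕ) : ℝ := if i + 1 < T then weight T (i + 1) else 0

/-- Fewer than `T` genuine weights contribute `7 / T²` each; the tail of `∑ i⁻²` telescopes to at
most `1 / (T - 1) ≤ 2 / T`. -/
theorem sum_abs_extWeight_sub_le {T : ℕ} (hT : 2 ≤ T) (n : ℕ) :
    ∑ i ∈ Finset.range n, |(((i + 1 : ℕ) : ℝ) ^ 2)⁻¹ - extWeight T i| ≤ 9 / T := by
  have hT0 : (0 : ℝ) < T := by exact_mod_cast (by omega : 0 < T)
  have hT1 : (1 : ℝ) ≤ ((T - 1 : ℕ) : ℝ) := by exact_mod_cast (by omega : 1 ≤ T - 1)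
  have hT2 : ((T - 1 : ℕ) : ℝ) = T - 1 := by push_cast [Nat.cast_sub (by omega : 1 ≤ T)]; ring
  have hlow : ∀ i, i + 1 < T → |(((i + 1 : ℕ) : ℝ) ^ 2)⁻¹ - extWeight T i| ≤ 7 / (T : ℝ) ^ 2 := by
    intro i hi
    rw [extWeight, if_pos hi, abs_sub_comm,
      abs_of_nonneg (sub_nonneg.2 (inv_sq_le_weight (Nat.succ_pos i) hi))]
    exact weight_sub_le (Nat.succ_pos i) hi
  have h1 : ∑ i ∈ Finset.range (T - 1), |(((i + 1 : ℕ) : ℝ) ^ 2)⁻¹ - extWeight T i| ≤ 7 / T := by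
    refine (Finset.sum_le_sum fun i hi => hlow i (by rw [Finset.mem_range] at hi; omega)).trans ?_
    rw [Finset.sum_const, Finset.card_range, nsmul_eq_mul, hT2, mul_div_assoc',
      div_le_div_iff₀ (by positivity) (by positivity)]
    nlinarith
  have h2 : ∀ m : ℕ, ∑ i ∈ Finset.range (T - 1 + m),
      |(((i + 1 : ℕ) : ℝ) ^ 2)⁻¹ - extWeight T i| ≤
      7 / T + ((T - 1 : ℕ) : ℝ)⁻¹ - ((T - 1 + m : ℕ) : ℝ)⁻¹ := by
    intro m
    induction m with
    | zero => simpa using h1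
    | succ m ih =>
      rw [← add_assoc, Finset.sum_range_succ]
      have hx : (1 : ℝ) ≤ ((T - 1 + m : ℕ) : ℝ) := by exact_mod_cast (by omega : 1 ≤ T - 1 + m)
      have : |(((T - 1 + m + 1 : ℕ) : ℝ) ^ 2)⁻¹ - extWeight T (T - 1 + m)| ≤
          ((T - 1 + m : ℕ) : ℝ)⁻¹ - ((T - 1 + m + 1 : ℕ) : ℝ)⁻¹ := by
        rw [extWeight, if_neg (by omega), sub_zero, abs_of_nonneg (by positivity)]
        rw [Nat.cast_add_one]
        generalize ((T - 1 + m : ℕ) : ℝ) = x at hx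
        rw [← sub_nonneg]
        have e : x⁻¹ - (x + 1)⁻¹ - ((x + 1) ^ 2)⁻¹ = 1 / (x * (x + 1) ^ 2) := by
          field_simp; ring
        rw [e]; positivity
      linarith
  have h3 := h2 n
  have h4 : ∑ i ∈ Finset.range n, |(((i + 1 : ℕ) : ℝ) ^ 2)⁻¹ - extWeight T i| ≤
      ∑ i ∈ Finset.range (T - 1 + n), |(((i + 1 : ℕ) : ℝ) ^ 2)⁻¹ - extWeight T i| :=
    Finset.sum_le_sum_of_subset_of_nonneg (Finset.range_mono (by omega))
      fun _ _ _ => abs_nonneg _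
  have h5 : ((T - 1 : ℕ) : ℝ)⁻¹ ≤ 2 / T := by
    rw [inv_eq_one_div, div_le_div_iff₀ (by linarith) hT0, hT2]
    have : (2 : ℝ) ≤ T := by exact_mod_cast hT
    linarith
  have h6 : (0 : ℝ) ≤ ((T - 1 + n : ℕ) : ℝ)⁻¹ := by positivity
  have h7 : (9 : ℝ) / T = 7 / T + 2 / T := by ring
  linarith

theorem tsum_extWeight_mul {T : ℕ} (x : ℕ → ℝ) :
    (Summable fun i => extWeight T i * x i) ∧
    ∑' i, extWeight T i * x i = ∑ i : Fin (T - 1), weight T (i + 1) * x i := by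
  have h0 : ∀ i ∉ Finset.range (T - 1), extWeight T i * x i = 0 := fun i hi => by
    rw [Finset.mem_range] at hi
    rw [extWeight, if_neg (by omega), zero_mul]
  refine ⟨summable_of_ne_finset_zero h0, ?_⟩
  rw [tsum_eq_sum h0, Fin.sum_univ_eq_sum_range (fun i => weight T (i + 1) * x i)]
  refine Finset.sum_congr rfl fun i hi => ?_
  rw [Finset.mem_range] at hi
  rw [extWeight, if_pos (by omega)]

theorem abs_integral_limit_sub_le {Ω : Type*} [MeasurableSpace Ω] {ν : Measure Ω}
    [IsProbabilityMeasure ν] {ζ : ℕ → Ω → ℝ} (hm : ∀ i, Measurable (ζ i))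
    (hi : ∀ i, Integrable (fun ω => ζ i ω ^ 2) ν) (h1 : ∀ i, ∫ ω, ζ i ω ^ 2 ∂ν = 1) {T : ℕ}
    (hT : 2 ≤ T) (hlaw : HasLaw (fun ω (i : Fin (T - 1)) => ζ i ω) (stdGauss (Fin (T - 1))) ν)
    (k : Fin (T - 1)) {q : ℝ} (hq : 0 < q) :
    Integrable (fun ω => (((k + 1 : ℕ) : ℝ) ^ 2)⁻¹ * ζ k ω ^ 2 /
      ∑' i : ℕ, (((i + 1 : ℕ) : ℝ) ^ 2)⁻¹ * ζ i ω ^ 2) ν ∧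
    |(∫ ω, (((k + 1 : ℕ) : ℝ) ^ 2)⁻¹ * ζ k ω ^ 2 /
        ∑' i : ℕ, (((i + 1 : ℕ) : ℝ) ^ 2)⁻¹ * ζ i ω ^ 2 ∂ν) -
      ∫ y, weight T (k + 1) * y k ^ 2 / quadForm (fun i : Fin (T - 1) => weight T (i + 1)) y
        ∂(stdGauss (Fin (T - 1)))| ≤
      (stdGauss (Fin (T - 1))).real
        {y | quadForm (fun i : Fin (T - 1) => weight T (i + 1)) y < 1 / q} + 18 * q / T := by
  set w : Fin (T - 1) → ℝ := fun i => weight T (i + 1) with hw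
  have hw0 : ∀ i, 0 ≤ w i := fun i => weight_nonneg _ _
  set c : ℕ → ℝ := fun i => |(((i + 1 : ℕ) : ℝ) ^ 2)⁻¹ - extWeight T i| with hc
  have hc0 : ∀ i, 0 ≤ c i := fun i => abs_nonneg _
  have hcs : Summable c := summable_of_sum_range_le hc0 (sum_abs_extWeight_sub_le hT)
  have hcle : ∑' i, c i ≤ 9 / T :=
    hcs.tsum_le_of_sum_range_le (sum_abs_extWeight_sub_le hT)
  have hS := integral_tsum_of_nonneg (μ := ν) (F := fun i ω => c i * ζ i ω ^ 2)
    (fun i => by have := hm i; fun_prop) (fun i x => mul_nonneg (hc0 i) (sq_nonneg _))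
    (fun i => (hi i).const_mul _) (by simp_rw [integral_const_mul, h1, mul_one]; exact hcs)
  have hinv : Summable fun i : ℕ => (((i + 1 : ℕ) : ℝ) ^ 2)⁻¹ :=
    (summable_nat_add_iff 1).2 (Real.summable_nat_pow_inv.2 one_lt_two)
  have hL := integral_tsum_of_nonneg (μ := ν)
    (F := fun i ω => (((i + 1 : ℕ) : ℝ) ^ 2)⁻¹ * ζ i ω ^ 2)
    (fun i => by have := hm i; fun_prop) (fun i x => by positivity)
    (fun i => (hi i).const_mul _) (by simp_rw [integral_const_mul, h1, mul_one]; exact hinv)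
  simp_rw [integral_const_mul, h1, mul_one] at hS
  have hmv : Measurable fun ω (i : Fin (T - 1)) => ζ i ω := measurable_pi_lambda _ fun i => hm i
  have mB : Measurable fun ω => quadForm w (fun i : Fin (T - 1) => ζ i ω) :=
    measurable_quadForm.comp hmv
  have key := abs_integral_ratio_compare (μ := ν)
    (a := fun ω => (((k + 1 : ℕ) : ℝ) ^ 2)⁻¹ * ζ k ω ^ 2)
    (A := fun ω => ∑' i : ℕ, (((i + 1 : ℕ) : ℝ) ^ 2)⁻¹ * ζ i ω ^ 2)
    (b := fun ω => w k * ζ k ω ^ 2) (B := fun ω => quadForm w (fun i : Fin (T - 1) => ζ i ω))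
    (S := fun ω => ∑' i, c i * ζ i ω ^ 2) (η := 1 / q)
    (by have := hm k; fun_prop) (Measurable.tsum fun i => by have := hm i; fun_prop)
    (by have := hm k; fun_prop) mB
    (by
      filter_upwards [hL.1] with ω hω
      exact ⟨by positivity, hω.le_tsum (k : ℕ) fun _ _ => by positivity⟩)
    (.of_forall fun ω => ⟨mul_nonneg (hw0 k) (sq_nonneg _),
      single_le_quadForm hw0 (fun i : Fin (T - 1) => ζ i ω) k⟩)
    (by
      filter_upwards [hS.1] with ω hω
      refine le_trans (le_of_eq ?_) (hω.le_tsum (k : ℕ) fun i _ =>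
        mul_nonneg (hc0 i) (sq_nonneg _))
      have : (k : ℕ) + 1 < T := by omega
      simp only [hc, hw, extWeight, if_pos this]
      rw [← sub_mul, abs_mul, abs_of_nonneg (sq_nonneg (ζ k ω))])
    (by
      filter_upwards [hS.1, hL.1] with ω hω hω'
      have ht := tsum_extWeight_mul (T := T) (fun i => ζ i ω ^ 2)
      rw [show quadForm w (fun i : Fin (T - 1) => ζ i ω) = ∑' i, extWeight T i * ζ i ω ^ 2 from
        ht.2.symm, ← hω'.tsum_sub ht.1]
      have e : ∀ i, c i * ζ i ω ^ 2 =
          ‖(((i + 1 : ℕ) : ℝ) ^ 2)⁻¹ * ζ i ω ^ 2 - extWeight T i * ζ i ω ^ 2‖ := fun i => by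
        rw [← sub_mul, norm_mul, Real.norm_eq_abs, Real.norm_eq_abs,
          abs_of_nonneg (sq_nonneg (ζ i ω))]
      simp_rw [e] at hω ⊢
      exact norm_tsum_le_tsum_norm hω)
    hS.2.1 (by positivity)
  refine ⟨key.1, ?_⟩
  have hm1 : Measurable fun y : Fin (T - 1) → ℝ => w k * y k ^ 2 / quadForm w y :=
    Measurable.div (by fun_prop) measurable_quadForm
  have e1 : ∫ ω, w k * ζ k ω ^ 2 / quadForm w (fun i : Fin (T - 1) => ζ i ω) ∂ν =
      ∫ y, w k * y k ^ 2 / quadForm w y ∂(stdGauss (Fin (T - 1))) :=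
    hlaw.integral_comp hm1.aestronglyMeasurable
  have e2 : ν.real {ω | quadForm w (fun i : Fin (T - 1) => ζ i ω) < 1 / q} =
      (stdGauss (Fin (T - 1))).real {y | quadForm w y < 1 / q} :=
    hlaw.measureReal_eq (p := fun y => quadForm w y < 1 / q)
      (measurableSet_lt measurable_quadForm measurable_const)
  rw [e1, e2] at key
  refine key.2.trans (add_le_add_right ?_ _)
  rw [hS.2.2]
  calc 2 / (1 / q) * ∑' i, c i ≤ 2 / (1 / q) * (9 / T) :=
        mul_le_mul_of_nonneg_left hcle (by positivity)
    _ = _ := by field_simp; ring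

end Gaussian

/-! ### From the linear process to its noise -/

theorem sum_Icc_one_eq_sum_fin (T : ℕ) (f : ℕ → ℝ) :
    ∑ t ∈ Finset.Icc 1 T, f t = ∑ s : Fin T, f (s + 1) := by
  rw [Fin.sum_univ_eq_sum_range (fun s => f (s + 1))]
  induction T with
  | zero => simp
  | succ n ih => rw [Finset.sum_Icc_succ_top (by omega), Finset.sum_range_succ, ih]

theorem isWhite_of_iIndepFun {Ω : Type*} [MeasurableSpace Ω] {μ : Measure Ω}
    [IsProbabilityMeasure μ] {ξ : ℤ → Ω → ℝ} (hm : ∀ t, Measurable (ξ t)) (hind : iIndepFun ξ μ)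
    (h2 : ∀ t, MemLp (ξ t) 2 μ) (h0 : ∀ t, ∫ ω, ξ t ω ∂μ = 0) (h1 : ∀ t, ∫ ω, ξ t ω ^ 2 ∂μ = 1) :
    IsWhite μ ξ where
  meas := hm
  memLp := h2
  cov s t := by
    split_ifs with h
    · subst h; simp_rw [← sq]; exact h1 s
    · have := (hind.indepFun h).integral_mul_eq_mul_integral (hm s).aestronglyMeasurable
        (hm t).aestronglyMeasurable
      simp only [Pi.mul_apply] at this
      rw [this, h0, zero_mul]

theorem isStdLaw_map {Ω : Type*} [MeasurableSpace Ω] {μ : Measure Ω}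
    [IsProbabilityMeasure μ] {X : Ω → ℝ} {β : ℝ} (hm : Measurable X) (h0 : ∫ ω, X ω ∂μ = 0)
    (h1 : ∫ ω, X ω ^ 2 ∂μ = 1) (h3 : Integrable (fun ω => |X ω| ^ 3) μ)
    (hβ : ∫ ω, |X ω| ^ 3 ∂μ ≤ β) : IsStdLaw β (μ.map X) where
  prob := Measure.isProbabilityMeasure_map hm.aemeasurable
  integrable_cube := (integrable_map_measure (by fun_prop) hm.aemeasurable).2 h3
  mean := by rw [integral_map hm.aemeasurable (by fun_prop)]; exact h0
  var := by rw [integral_map hm.aemeasurable (by fun_prop)]; exact h1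
  cube_le := by rw [integral_map hm.aemeasurable (by fun_prop)]; exact hβ

section

variable {Ω : Type*} [MeasurableSpace Ω] {μ : Measure Ω} [IsProbabilityMeasure μ] {ξ : ℤ → Ω → ℝ}
  {ψ : ℕ → ℝ} {B b : ℝ}

/-- The sine coordinate `∑_t e_t v_{k,t}` of the linear process. -/
noncomputable def procCoord (ψ : ℕ → ℝ) (ξ : ℤ → Ω → ℝ) (T k : ℕ) (ω : Ω) : ℝ :=
  ∑ t ∈ Finset.Icc 1 T, linProc ψ ξ t ω * vCoord T k t

/-- The sine coordinate `∑_t ξ_t v_{k,t}` of the noise. -/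
noncomputable def noiseCoord (ξ : ℤ → Ω → ℝ) (T k : ℕ) (ω : Ω) : ℝ :=
  ∑ t ∈ Finset.Icc 1 T, ξ t ω * vCoord T k t

/-- With `F = p y + R`, the difference of squares is `2 p y R + R²`. The noise coordinate has second
moment `1` and `R` has `L²` norm of order `B / σ_k`, so after scaling by `σ_k²` one power of `σ_k`
remains. -/
theorem IsWhite.integral_sq_sub_sq_le (h : IsWhite μ ξ)
    (hs : Summable fun k : ℕ => (1 + (k : ℝ)) * |ψ k|)
    (hB : ∑' k : ℕ, (1 + (k : ℝ)) * |ψ k| ≤ B) {T k : ℕ} (hk : 0 < k) (hkT : k < T) :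
    Integrable (fun ω => |procCoord ψ ξ T k ω ^ 2 -
      (∑' k, ψ k) ^ 2 * noiseCoord ξ T k ω ^ 2|) μ ∧
    sigma T k ^ 2 * ∫ ω, |procCoord ψ ξ T k ω ^ 2 - (∑' k, ψ k) ^ 2 * noiseCoord ξ T k ω ^ 2| ∂μ ≤
      3 * B ^ 2 * sigma T k + 2 * B ^ 2 := by
  have hm := h.meas
  set p := ∑' k, ψ k with hp
  have hσ := sigma_pos hk hkT
  have hpB : |p| ≤ B := by
    refine le_trans ?_ hB
    have := norm_tsum_le_tsum_norm (f := ψ) (by simpa using summable_abs_of_weighted hs)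
    refine this.trans ((summable_abs_of_weighted hs).tsum_le_tsum (fun k => ?_) hs)
    exact le_mul_of_one_le_left (abs_nonneg _) (by linarith [(Nat.cast_nonneg k : (0 : ℝ) ≤ k)])
  have hB0 : 0 ≤ B := (abs_nonneg _).trans hpB
  have hR := h.integral_remainder_sq hs hB (vCoord_one T k) (vCoord_succ_self (by omega) k)
  have hRle := hR.2.trans
    (mul_le_mul_of_nonneg_left (sum_vCoord_sub_sq_le hk hkT) (sq_nonneg B))
  set R := remainder ψ ξ (vCoord T k) T with hRdef
  have hy := h.integral_sum_sq (Finset.Icc 1 T) (fun t => vCoord T k t)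
    (p := fun t : ℕ => (t : ℤ)) (fun a b hab => by simpa using hab)
  have hy1 : ∑ t ∈ Finset.Icc 1 T, vCoord T k t ^ 2 = 1 := by
    rw [sum_Icc_one_eq_sum_fin]
    simpa [sq] using sum_vCoord_mul hk hkT hk hkT
  have ey : ∀ ω, ∑ t ∈ Finset.Icc 1 T, vCoord T k t * ξ t ω = noiseCoord ξ T k ω := fun ω =>
    Finset.sum_congr rfl fun _ _ => mul_comm _ _
  simp_rw [ey, hy1] at hy
  have mR : Measurable R := by
    have := measurable_linProc (ψ := ψ) hm
    rw [hRdef]; unfold remainder; fun_prop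
  have mF : Measurable (procCoord ψ ξ T k) := by
    have := measurable_linProc (ψ := ψ) hm
    unfold procCoord; fun_prop
  have my : Measurable (noiseCoord ξ T k) := by unfold noiseCoord; fun_prop
  have eF : ∀ ω, procCoord ψ ξ T k ω = p * noiseCoord ξ T k ω + R ω := fun ω => by
    rw [hRdef, remainder, procCoord, noiseCoord]; ring
  have hbound : ∀ ω, |procCoord ψ ξ T k ω ^ 2 - p ^ 2 * noiseCoord ξ T k ω ^ 2| ≤
      2 * |p| * (|noiseCoord ξ T k ω| * |R ω|) + R ω ^ 2 := by
    intro ω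
    rw [eF, show (p * noiseCoord ξ T k ω + R ω) ^ 2 - p ^ 2 * noiseCoord ξ T k ω ^ 2 =
      2 * p * (noiseCoord ξ T k ω * R ω) + R ω ^ 2 by ring]
    refine (abs_add_le _ _).trans_eq ?_
    rw [abs_mul, abs_mul, abs_mul, abs_two, abs_of_nonneg (sq_nonneg (R ω))]
  have iyR : Integrable (fun ω => |noiseCoord ξ T k ω| * |R ω|) μ :=
    integrable_mul_of_sq my.abs.aestronglyMeasurable mR.abs.aestronglyMeasurable
      (by simpa using hy.1) (by simpa using hR.1)
  have cs := integral_mul_le_sqrt_mul_sqrt (μ := μ) my.abs.aestronglyMeasurable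
    mR.abs.aestronglyMeasurable (fun _ => abs_nonneg _) (fun _ => abs_nonneg _)
      (by simpa using hy.1) (by simpa using hR.1)
  simp only [sq_abs] at cs
  rw [hy.2, Real.sqrt_one, one_mul] at cs
  -- The factor `3 / 2` stands for `√2`.
  have hsq : √(∫ ω, R ω ^ 2 ∂μ) ≤ 3 / 2 * (B * (sigma T k)⁻¹) := by
    rw [Real.sqrt_le_left (by positivity)]
    refine hRle.trans ?_
    have : 0 ≤ (B * (sigma T k)⁻¹) ^ 2 := sq_nonneg _
    rw [mul_pow] at this
    nlinarith
  have i2 : Integrable (fun ω => 2 * |p| * (|noiseCoord ξ T k ω| * |R ω|) + R ω ^ 2) μ :=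
    (iyR.const_mul _).add hR.1
  have i1 : Integrable (fun ω => |procCoord ψ ξ T k ω ^ 2 - p ^ 2 * noiseCoord ξ T k ω ^ 2|) μ :=
    i2.mono' (by fun_prop) (.of_forall fun ω => by
      rw [Real.norm_eq_abs, abs_abs]; exact hbound ω)
  refine ⟨i1, ?_⟩
  have hI := integral_mono i1 i2 hbound
  rw [integral_add (iyR.const_mul _) hR.1, integral_const_mul] at hI
  have h3 : 2 * |p| * ∫ ω, |noiseCoord ξ T k ω| * |R ω| ∂μ ≤
      2 * B * (3 / 2 * (B * (sigma T k)⁻¹)) :=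
    mul_le_mul (by linarith) (cs.trans hsq)
      (integral_nonneg fun ω => by positivity) (by positivity)
  have h4 := mul_le_mul_of_nonneg_left (hI.trans (add_le_add h3 hRle)) (sq_nonneg (sigma T k))
  refine h4.trans_eq ?_
  field_simp

/-- The errors of the coordinates add up to `O(∑ σ_i) = O(T log T)`, and the normalisation is of
order `T⁻²`. The cutoff at `1 / q` contributes the factor `q`. -/
theorem IsWhite.abs_integral_process_sub_le (h : IsWhite μ ξ)
    (hs : Summable fun k : ℕ => (1 + (k : ℝ)) * |ψ k|)
    (hB : ∑' k : ℕ, (1 + (k : ℝ)) * |ψ k| ≤ B) (hb : 0 < b) (hbψ : b ≤ |∑' k, ψ k|) {T : ℕ}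
    (k : Fin (T - 1)) {P : Measure (Fin T → ℝ)}
    (hlaw : HasLaw (fun ω (s : Fin T) => ξ ((s : ℕ) + 1 : ℕ) ω) P μ) {q : ℝ} (hq : 0 < q) :
    Integrable (fun ω => (sigma T (k + 1) * procCoord ψ ξ T (k + 1) ω) ^ 2 /
      ∑ i : Fin (T - 1), (sigma T (i + 1) * procCoord ψ ξ T (i + 1) ω) ^ 2) μ ∧
    |(∫ ω, (sigma T (k + 1) * procCoord ψ ξ T (k + 1) ω) ^ 2 /
        ∑ i : Fin (T - 1), (sigma T (i + 1) * procCoord ψ ξ T (i + 1) ω) ^ 2 ∂μ) -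
      ∫ x, weight T (k + 1) * (∑ s : Fin T, x s * vCoord T (k + 1) (s + 1)) ^ 2 /
        quadForm (fun i : Fin (T - 1) => weight T (i + 1))
          (fun i => ∑ s : Fin T, x s * vCoord T (i + 1) (s + 1)) ∂P| ≤
      P.real {x | quadForm (fun i : Fin (T - 1) => weight T (i + 1))
          (fun i => ∑ s : Fin T, x s * vCoord T (i + 1) (s + 1)) < 1 / q} +
        128 * (B ^ 2 / b ^ 2) * (1 + Real.log T) / T * q := by
  have hm := h.meas
  have hkT := k.2
  have hT : 0 < T := by omega
  have hT0 : (0 : ℝ) < T := by exact_mod_cast hT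
  have hT1 : (1 : ℝ) ≤ T := by exact_mod_cast hT
  set p := ∑' k, ψ k with hp
  have hp0 : p ≠ 0 := by
    intro h0; rw [h0, abs_zero] at hbψ; linarith
  have hpi := Real.pi_pos
  -- Rescaling numerator and denominator by `c` leaves the ratio unchanged and turns `σ_i² p²` into
  -- the normalised weight.
  set c : ℝ := (Real.pi / (T * p)) ^ 2 with hc
  have hc0 : 0 < c := by positivity
  set w : Fin (T - 1) → ℝ := fun i => weight T (i + 1) with hw
  have hw0 : ∀ i, 0 ≤ w i := fun i => weight_nonneg _ _
  have hcw : ∀ i : Fin (T - 1), w i = c * sigma T (i + 1) ^ 2 * p ^ 2 := fun i => by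
    simp only [hw, hc, weight]; field_simp
  have hL := fun i : Fin (T - 1) =>
    h.integral_sq_sub_sq_le hs hB (k := i + 1) (T := T) (by omega) (by omega)
  set d : Fin (T - 1) → Ω → ℝ := fun i ω => |procCoord ψ ξ T (i + 1) ω ^ 2 -
    p ^ 2 * noiseCoord ξ T (i + 1) ω ^ 2| with hd
  have mF : ∀ k, Measurable (procCoord ψ ξ T k) := fun k => by
    have := measurable_linProc (ψ := ψ) hm
    unfold procCoord; fun_prop
  have my : ∀ k, Measurable (noiseCoord ξ T k) := fun k => by unfold noiseCoord; fun_prop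
  have hdi : ∀ (i : Fin (T - 1)) ω, |c * (sigma T (i + 1) * procCoord ψ ξ T (i + 1) ω) ^ 2 -
      w i * noiseCoord ξ T (i + 1) ω ^ 2| = c * sigma T (i + 1) ^ 2 * d i ω := fun i ω => by
    rw [hcw, hd, mul_pow]
    simp only
    rw [show c * (sigma T (i + 1) ^ 2 * procCoord ψ ξ T (i + 1) ω ^ 2) -
      c * sigma T (i + 1) ^ 2 * p ^ 2 * noiseCoord ξ T (i + 1) ω ^ 2 =
      c * sigma T (i + 1) ^ 2 * (procCoord ψ ξ T (i + 1) ω ^ 2 -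
        p ^ 2 * noiseCoord ξ T (i + 1) ω ^ 2) by ring, abs_mul, abs_of_nonneg (by positivity)]
  have hS : Integrable (fun ω => ∑ i : Fin (T - 1), c * sigma T (i + 1) ^ 2 * d i ω) μ :=
    integrable_finsetSum _ fun i _ => (hL i).1.const_mul _
  have my' : Measurable fun ω (i : Fin (T - 1)) => noiseCoord ξ T (i + 1) ω :=
    measurable_pi_lambda _ fun i => my _
  have key := abs_integral_ratio_compare (μ := μ)
    (a := fun ω => c * (sigma T (k + 1) * procCoord ψ ξ T (k + 1) ω) ^ 2)
    (A := fun ω => ∑ i : Fin (T - 1), c * (sigma T (i + 1) * procCoord ψ ξ T (i + 1) ω) ^ 2)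
    (b := fun ω => w k * noiseCoord ξ T (k + 1) ω ^ 2)
    (B := fun ω => quadForm w (fun i : Fin (T - 1) => noiseCoord ξ T (i + 1) ω))
    (S := fun ω => ∑ i : Fin (T - 1), c * sigma T (i + 1) ^ 2 * d i ω) (η := 1 / q)
    (by have := mF (k + 1); fun_prop) (by fun_prop) (by have := my (k + 1); fun_prop)
    (measurable_quadForm.comp my')
    (.of_forall fun ω => ⟨by positivity, Finset.single_le_sum
      (f := fun i : Fin (T - 1) => c * (sigma T (i + 1) * procCoord ψ ξ T (i + 1) ω) ^ 2)
      (fun i _ => by positivity) (Finset.mem_univ k)⟩)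
    (.of_forall fun ω => ⟨mul_nonneg (hw0 k) (sq_nonneg _),
      single_le_quadForm hw0 (fun i : Fin (T - 1) => noiseCoord ξ T (i + 1) ω) k⟩)
    (.of_forall fun ω => by
      rw [hdi]
      exact Finset.single_le_sum (f := fun i : Fin (T - 1) => c * sigma T (i + 1) ^ 2 * d i ω)
        (fun i _ => mul_nonneg (by positivity) (abs_nonneg _)) (Finset.mem_univ k))
    (.of_forall fun ω => by
      rw [quadForm, ← Finset.sum_sub_distrib]
      refine (Finset.abs_sum_le_sum_abs _ _).trans_eq ?_
      exact Finset.sum_congr rfl fun i _ => hdi i ω)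
    hS (by positivity)
  have er : ∀ ω, c * (sigma T (k + 1) * procCoord ψ ξ T (k + 1) ω) ^ 2 /
      ∑ i : Fin (T - 1), c * (sigma T (i + 1) * procCoord ψ ξ T (i + 1) ω) ^ 2 =
      (sigma T (k + 1) * procCoord ψ ξ T (k + 1) ω) ^ 2 /
      ∑ i : Fin (T - 1), (sigma T (i + 1) * procCoord ψ ξ T (i + 1) ω) ^ 2 := fun ω => by
    rw [← Finset.mul_sum, mul_div_mul_left _ _ hc0.ne']
  simp_rw [er] at key
  refine ⟨key.1, ?_⟩
  have en : ∀ i ω, noiseCoord ξ T i ω =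
      ∑ s : Fin T, ξ ((s : ℕ) + 1 : ℕ) ω * vCoord T i (s + 1) := fun i ω =>
    sum_Icc_one_eq_sum_fin T fun t => ξ t ω * vCoord T i t
  simp_rw [en] at key
  have mq : Measurable fun x : Fin T → ℝ => quadForm w
      (fun i => ∑ s : Fin T, x s * vCoord T (i + 1) (s + 1)) :=
    measurable_quadForm.comp (by fun_prop)
  have hm1 : Measurable fun x : Fin T → ℝ =>
      w k * (∑ s : Fin T, x s * vCoord T (k + 1) (s + 1)) ^ 2 /
        quadForm w (fun i => ∑ s : Fin T, x s * vCoord T (i + 1) (s + 1)) :=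
    Measurable.div (by fun_prop) mq
  have e1 := hlaw.integral_comp hm1.aestronglyMeasurable
  have e2 := hlaw.measureReal_eq (p := fun x => quadForm w
      (fun i => ∑ s : Fin T, x s * vCoord T (i + 1) (s + 1)) < 1 / q)
    (measurableSet_lt mq measurable_const)
  simp only [Function.comp_def] at e1
  rw [e1, e2] at key
  refine key.2.trans (add_le_add_right ?_ _)
  rw [integral_finsetSum _ fun i _ => (hL i).1.const_mul _]
  simp_rw [integral_const_mul, mul_assoc c]
  rw [← Finset.mul_sum]
  have hsum : ∑ i : Fin (T - 1), sigma T (i + 1) ^ 2 * ∫ ω, d i ω ∂μ ≤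
      4 * B ^ 2 * T * (1 + Real.log T) := by
    refine (Finset.sum_le_sum fun i _ => (hL i).2).trans ?_
    rw [Finset.sum_add_distrib, ← Finset.mul_sum]
    have h1 := mul_le_mul_of_nonneg_left (sum_sigma_le hT) (by positivity : 0 ≤ 3 * B ^ 2)
    simp only [Finset.sum_const, Finset.card_univ, Fintype.card_fin, nsmul_eq_mul]
    have h2 : ((T - 1 : ℕ) : ℝ) ≤ T := by exact_mod_cast Nat.sub_le T 1
    have h3 := mul_le_mul_of_nonneg_right h2 (by positivity : 0 ≤ 2 * B ^ 2)
    have h4 : 0 ≤ Real.log T := Real.log_nonneg hT1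
    have h5 : 0 ≤ B ^ 2 * T * Real.log T := by positivity
    nlinarith
  have hcle : c ≤ 16 / (T ^ 2 * b ^ 2) := by
    rw [hc, div_pow, mul_pow, ← sq_abs p]
    have h16 : Real.pi ^ 2 ≤ 16 := by
      have := Real.pi_le_four
      nlinarith
    gcongr
  have h4 : 0 ≤ Real.log T := Real.log_nonneg hT1
  calc 2 / (1 / q) * (c * ∑ i : Fin (T - 1), sigma T (i + 1) ^ 2 * ∫ ω, d i ω ∂μ)
      ≤ 2 / (1 / q) * (16 / (T ^ 2 * b ^ 2) * (4 * B ^ 2 * T * (1 + Real.log T))) := by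
        refine mul_le_mul_of_nonneg_left (mul_le_mul hcle hsum ?_ (by positivity)) (by positivity)
        exact Finset.sum_nonneg fun i _ => mul_nonneg (sq_nonneg _)
          (integral_nonneg fun ω => abs_nonneg _)
    _ = _ := by field_simp; ring

end

/-! ### Assembly of the three comparisons -/

/-- Determines `T₀`: here `D` will contain `B² / b²`, and `13 ≤ T` provides the twelve weights
needed for Gaussian decay. -/
theorem eventually_log_le_rpow (D : ℝ) :
    ∃ T₀ : ℕ, ∀ T : ℕ, T₀ ≤ T → 13 ≤ T ∧ D * (1 + Real.log T) ≤ (T : ℝ) ^ (1 / 4 : ℝ) := by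
  have h1 : (fun x : ℝ => D * (1 + Real.log x)) =o[Filter.atTop] fun x : ℝ => x ^ (1 / 4 : ℝ) := by
    refine Asymptotics.IsLittleO.const_mul_left (Asymptotics.IsLittleO.add ?_ ?_) D
    · exact (Asymptotics.isLittleO_const_left.2 (Or.inr
        (tendsto_norm_atTop_atTop.comp (tendsto_rpow_atTop (by norm_num)))))
    · exact isLittleO_log_rpow_atTop (by norm_num)
  have h2 := h1.comp_tendsto tendsto_natCast_atTop_atTop
  have h3 := (h2.def one_pos).and (Filter.eventually_ge_atTop 13)
  obtain ⟨T₀, hT₀⟩ := Filter.eventually_atTop.1 h3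
  refine ⟨T₀, fun T hT => ⟨(hT₀ T hT).2, ?_⟩⟩
  have h := (hT₀ T hT).1
  simp only [Function.comp, one_mul, Real.norm_eq_abs] at h
  rw [abs_of_nonneg (by positivity : (0 : ℝ) ≤ (T : ℝ) ^ (1 / 4 : ℝ))] at h
  exact (le_abs_self _).trans h

/-- The constant of the final bound, in terms of the bound on the third absolute moment. -/
noncomputable def finalConst (β : ℝ) : ℝ := 14 * 72 ^ 6 + 19 * decayConst β 64 (72 ^ 6) + 19

theorem finalConst_pos {β : ℝ} (hβ : 0 ≤ β) : 0 < finalConst β := by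
  have := decayConst_nonneg (K := 72 ^ 6) hβ (by norm_num : (0 : ℝ) ≤ 64)
  rw [finalConst]; positivity

theorem abs_integral_process_sub_limit_le {Ω Ω' : Type*} [MeasurableSpace Ω] [MeasurableSpace Ω']
    {μ : Measure Ω} [IsProbabilityMeasure μ] {ν : Measure Ω'} [IsProbabilityMeasure ν]
    {ξ : ℤ → Ω → ℝ} {ψ : ℕ → ℝ} {ζ : ℕ → Ω' → ℝ} {B b β : ℝ} (hβ : 0 ≤ β)
    (hm : ∀ t, Measurable (ξ t)) (hind : iIndepFun ξ μ)
    (h2 : ∀ t, MemLp (ξ t) 2 μ) (h0 : ∀ t, ∫ ω, ξ t ω ∂μ = 0) (h1 : ∀ t, ∫ ω, ξ t ω ^ 2 ∂μ = 1)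
    (h3 : ∀ t, Integrable (fun ω => |ξ t ω| ^ 3) μ) (h3β : ∀ t, ∫ ω, |ξ t ω| ^ 3 ∂μ ≤ β)
    (hs : Summable fun k : ℕ => (1 + (k : ℝ)) * |ψ k|)
    (hB : ∑' k : ℕ, (1 + (k : ℝ)) * |ψ k| ≤ B) (hb : 0 < b) (hbψ : b ≤ |∑' k, ψ k|)
    (hζm : ∀ i, Measurable (ζ i)) (hζind : iIndepFun ζ ν)
    (hζ : ∀ i, HasLaw (ζ i) (gaussianReal 0 1) ν) {T : ℕ} (hT : 13 ≤ T)
    (hTb : 128 * (B ^ 2 / b ^ 2) * (1 + Real.log T) ≤ (T : ℝ) ^ (1 / 4 : ℝ)) (k : Fin (T - 1)) :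
    Integrable (fun ω => (sigma T (k + 1) * procCoord ψ ξ T (k + 1) ω) ^ 2 /
      ∑ i : Fin (T - 1), (sigma T (i + 1) * procCoord ψ ξ T (i + 1) ω) ^ 2) μ ∧
    Integrable (fun ω => (((k + 1 : ℕ) : ℝ) ^ 2)⁻¹ * ζ k ω ^ 2 /
      ∑' i : ℕ, (((i + 1 : ℕ) : ℝ) ^ 2)⁻¹ * ζ i ω ^ 2) ν ∧
    |(∫ ω, (sigma T (k + 1) * procCoord ψ ξ T (k + 1) ω) ^ 2 /
        ∑ i : Fin (T - 1), (sigma T (i + 1) * procCoord ψ ξ T (i + 1) ω) ^ 2 ∂μ) -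
      ∫ ω, (((k + 1 : ℕ) : ℝ) ^ 2)⁻¹ * ζ k ω ^ 2 /
        ∑' i : ℕ, (((i + 1 : ℕ) : ℝ) ^ 2)⁻¹ * ζ i ω ^ 2 ∂ν| ≤
      finalConst β * (T : ℝ) ^ (-(1 / 2) : ℝ) := by
  have hT0 : (0 : ℝ) < T := by exact_mod_cast (by omega : 0 < T)
  have hT1 : (1 : ℝ) ≤ T := by exact_mod_cast (by omega : 1 ≤ T)
  -- The cutoff `1 / q` gives bad events of probability `O(q⁻²) = O(T^(-1/2))` and multiplies the
  -- `O(log T / T)` and `O(1 / T)` errors only by `q`.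
  set q : ℝ := (T : ℝ) ^ (1 / 4 : ℝ) with hq
  have hq0 : 0 < q := by positivity
  have hq1 : 1 ≤ q := Real.one_le_rpow hT1 (by norm_num)
  have hq4 : q ^ 4 = T := by
    rw [hq, ← Real.rpow_natCast, ← Real.rpow_mul hT0.le]; norm_num
  have hqT : (T : ℝ) ^ (-(1 / 2) : ℝ) = 1 / q ^ 2 := by
    rw [hq, ← Real.rpow_natCast, ← Real.rpow_mul hT0.le, Real.rpow_neg hT0.le, one_div]
    norm_num
  have hsq : √(T : ℝ) = q ^ 2 := by
    rw [← hq4, show q ^ 4 = (q ^ 2) ^ 2 by ring, Real.sqrt_sq (by positivity)]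
  have hw := isWhite_of_iIndepFun hm hind h2 h0 h1
  set ρ : Fin T → Measure ℝ := fun s => μ.map (ξ ((s : ℕ) + 1 : ℕ)) with hρd
  have hρ : ∀ s, IsStdLaw β (ρ s) := fun s => isStdLaw_map (hm _) (h0 _) (h1 _) (h3 _) (h3β _)
  have hlaw : HasLaw (fun ω (s : Fin T) => ξ ((s : ℕ) + 1 : ℕ) ω) (Measure.pi ρ) μ :=
    iIndepFun.hasLaw_pi (fun s => ⟨(hm _).aemeasurable, rfl⟩)
      (hind.precomp (g := fun s : Fin T => (((s : ℕ) + 1 : ℕ) : ℤ)) fun a b hab => by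
        simpa [Fin.ext_iff] using hab)
  have hζlaw : HasLaw (fun ω (i : Fin (T - 1)) => ζ i ω) (stdGauss (Fin (T - 1))) ν :=
    iIndepFun.hasLaw_pi (fun i => hζ i) (hζind.precomp Fin.val_injective)
  have hζi : ∀ i, Integrable (fun ω => ζ i ω ^ 2) ν := fun i =>
    Integrable.comp_aemeasurable (f := ζ i) (g := fun x : ℝ => x ^ 2)
      (by rw [(hζ i).map_eq]; exact integrable_pow_gaussianReal 2) (hζm i).aemeasurable
  have hζ1 : ∀ i, ∫ ω, ζ i ω ^ 2 ∂ν = 1 := fun i => by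
    have h := (hζ i).integral_comp (f := fun x : ℝ => x ^ 2) (by fun_prop)
    simp only [Function.comp_def] at h
    rw [h]
    have := variance_id_gaussianReal (μ := 0) (v := 1)
    rw [variance_eq_integral (by fun_prop)] at this
    simpa using this
  have hv : ∀ i i' : Fin (T - 1), ∑ s : Fin T, vCoord T (i + 1) (s + 1) * vCoord T (i' + 1) (s + 1) =
      if i = i' then 1 else 0 := fun i i' => by
    rw [sum_vCoord_mul (by omega) (by omega) (by omega) (by omega)]
    simp [Fin.ext_iff]
  have hw0 : ∀ i : Fin (T - 1), 0 ≤ weight T (i + 1) := fun i => weight_nonneg _ _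
  have hJ : ∀ l : ℝ, 0 ≤ l → ∫ z, Real.exp (-(l * quadForm (fun i : Fin (T - 1) =>
      weight T (i + 1)) z)) ∂(stdGauss (Fin (T - 1))) ≤ 72 ^ 6 * ((1 + l) ^ 6)⁻¹ := fun l hl =>
    integral_exp_quadForm_gauss_le (by omega) hw0
      (fun i => inv_sq_le_weight (Nat.succ_pos _) (by omega)) hl
  have hcard : 0 < Fintype.card (Fin T) := by rw [Fintype.card_fin]; omega
  have r1 := hw.abs_integral_process_sub_le hs hB hb hbψ k hlaw hq0
  have r2 := abs_integral_limit_sub_le hζm hζi hζ1 (by omega) hζlaw k hq0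
  have r3 := abs_integral_ratio_sub_le hβ (by norm_num) (by norm_num) hw0 hcard hv hρ
    (two_mul_sum_weight_mul_vCoord_sq_le T) hJ k
  have r4 := measureReal_quadForm_lt_le hβ (by norm_num) (by norm_num) hw0 hcard hv hρ
    (two_mul_sum_weight_mul_vCoord_sq_le T) hJ (q := q) (by rw [Fintype.card_fin, hq4]) hq1
  have r5 := measureReal_quadForm_gauss_le (by norm_num) hw0 hJ hq0
  rw [Fintype.card_fin, hsq] at r3
  refine ⟨r1.1, r2.1, ?_⟩
  rw [hqT, finalConst]
  set c := decayConst β 64 (72 ^ 6)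
  -- By `hTb` the left side is at most `q * q / q ^ 4`, which frees the final constant from `b` and
  -- `B`.
  have p1 : 128 * (B ^ 2 / b ^ 2) * (1 + Real.log T) / T * q ≤ 1 / q ^ 2 := by
    rw [← hq4, div_mul_eq_mul_div, div_le_div_iff₀ (by positivity) (by positivity), hq4]
    calc _ ≤ q * q * q ^ 2 := by gcongr
      _ = q ^ 4 := by ring
      _ = _ := by rw [hq4, one_mul]
  have p2 : 18 * q / T ≤ 18 / q ^ 2 := by
    rw [← hq4, div_le_div_iff₀ (by positivity) (by positivity)]
    have : q ^ 3 ≤ q ^ 4 := pow_le_pow_right₀ hq1 (by norm_num)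
    nlinarith
  have e : (14 * 72 ^ 6 + 19 * c + 19) * (1 / q ^ 2) =
      (3 * 72 ^ 6 + 6 * c) / q ^ 2 + 1 / q ^ 2 + (13 * c + 8 * 72 ^ 6) / q ^ 2 +
        3 * 72 ^ 6 / q ^ 2 + 18 / q ^ 2 := by ring
  rw [e]
  have q1 := r1.2
  have q2 := r2.2
  rw [abs_le] at *
  constructor <;> linarith [q1.1, q1.2, q2.1, q2.2, r3.1, r3.2]

theorem ratio_eq {Ω : Type*} {n : ℕ} {Ψ : ℕ → Matrix (Fin n) (Fin n) ℝ} (hΨ : ∀ k, (Ψ k).IsDiag)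
    {ε : Fin n → ℤ → Ω → ℝ} {ξ : ℤ → Ω → ℝ} {j : Fin n} {ω : Ω} (hω : ∀ t, ε j t ω = ξ t ω)
    (T k : ℕ) : ratio Ψ ε T j k k ω = (sigma T k * procCoord (fun l => Ψ l j j) ξ T k ω) ^ 2 /
      ∑ i : Fin (T - 1), (sigma T (i + 1) * procCoord (fun l => Ψ l j j) ξ T (i + 1) ω) ^ 2 := by
  have h1 : ∀ t : ℤ, innovation Ψ ε t ω j = linProc (fun l => Ψ l j j) ξ t ω := fun t => by
    refine tsum_congr fun l => ?_
    rw [Matrix.mulVec, dotProduct, Finset.sum_eq_single j]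
    · rw [hω]
    · intro i _ hij
      rw [hΨ l hij.symm, zero_mul]
    · simp
  have h2 : ∀ k, fourierCoord Ψ ε T j k ω = procCoord (fun l => Ψ l j j) ξ T k ω := fun k =>
    Finset.sum_congr rfl fun t _ => by rw [h1]
  simp only [ratio, h2]
  rw [sum_Icc_one_eq_sum_fin]
  simp_rw [mul_pow]
  congr 1
  ring

/-- Reindexing from positive integers to naturals, with index `i` standing for `i + 1`. -/
theorem limitRatio_eq {Ω : Type*} {Z : ℕ+ → Ω → ℝ} {ζ : ℕ → Ω → ℝ} {ω : Ω}
    (hω : ∀ i, Z i.succPNat ω = ζ i ω) (k : ℕ) :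
    limitRatio Z k.succPNat k.succPNat ω = (((k + 1 : ℕ) : ℝ) ^ 2)⁻¹ * ζ k ω ^ 2 /
      ∑' i : ℕ, (((i + 1 : ℕ) : ℝ) ^ 2)⁻¹ * ζ i ω ^ 2 := by
  have h := Equiv.pnatEquivNat.symm.tsum_eq (fun t : ℕ+ => ((t : ℝ) ^ 2)⁻¹ * Z t ω ^ 2)
  rw [limitRatio, ← h]
  congr 1
  · rw [hω]
    simp only [Nat.succPNat_coe, Nat.succ_eq_add_one]
    ring
  · refine tsum_congr fun i => ?_
    simp only [Equiv.pnatEquivNat_symm_apply, Nat.succPNat_coe, Nat.succ_eq_add_one, hω]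

theorem integrable_abs_cube_of_memLp {Ω : Type*} [MeasurableSpace Ω] {μ : Measure Ω}
    [IsProbabilityMeasure μ] {X : Ω → ℝ} {κ : ℝ} (h : MemLp X 8 μ) (hκ : ∫ ω, |X ω| ^ 8 ∂μ ≤ κ) :
    Integrable (fun ω => |X ω| ^ 3) μ ∧ ∫ ω, |X ω| ^ 3 ∂μ ≤ 1 + |κ| := by
  have h8 : Integrable (fun ω => |X ω| ^ 8) μ := by
    have h' : MemLp X ((8 : ℕ) : ENNReal) μ := by rwa [Nat.cast_ofNat]
    have := h'.integrable_norm_pow (by norm_num)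
    simpa only [Real.norm_eq_abs] using this
  have hle : ∀ ω, |X ω| ^ 3 ≤ 1 + |X ω| ^ 8 := fun ω => by
    rcases le_total |X ω| 1 with hx | hx
    · have := pow_le_one₀ (n := 3) (abs_nonneg (X ω)) hx
      have : 0 ≤ |X ω| ^ 8 := by positivity
      linarith
    · have := pow_le_pow_right₀ hx (by norm_num : 3 ≤ 8)
      linarith
  have i1 : Integrable (fun ω => 1 + |X ω| ^ 8) μ := (integrable_const _).add h8
  have i3 : Integrable (fun ω => |X ω| ^ 3) μ := by
    refine i1.mono' (h.1.norm.pow 3) (.of_forall fun ω => ?_)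
    rw [Real.norm_eq_abs, abs_of_nonneg (by positivity)]
    exact hle ω
  refine ⟨i3, (integral_mono i3 i1 hle).trans ?_⟩
  rw [integral_add (integrable_const _) h8]
  simp only [integral_const, probReal_univ, smul_eq_mul, mul_one]
  linarith [le_abs_self κ]

end UnitRoot

theorem mainTheorem3 (B M κ : ℝ) (hB : 0 < B) (hM : 0 < M) :
    ∃ C : ℝ, 0 < C ∧ ∀ b : ℝ, 0 < b → ∃ T₀ : ℕ, ∀ T : ℕ, T₀ ≤ T →
      ∀ (n : ℕ) (Ω : Type u) [MeasurableSpace Ω] (μ : Measure Ω) [IsProbabilityMeasure μ]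
        (ε : Fin n → ℤ → Ω → ℝ) (Ψ : ℕ → Matrix (Fin n) (Fin n) ℝ)
        (Ω' : Type v) [MeasurableSpace Ω'] (ν : Measure Ω') [IsProbabilityMeasure ν]
        (Z : ℕ+ → Ω' → ℝ),
        UnitRoot.IsNoise μ M κ ε →
        UnitRoot.IsLagPolynomial b B Ψ →
        iIndepFun Z ν →
        (∀ t, HasLaw (Z t) (gaussianReal 0 1) ν) →
        ∀ (j : Fin n) (k : ℕ+), (k : ℕ) ≤ T - 1 →
          Integrable (UnitRoot.ratio Ψ ε T j k k) μ ∧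
          Integrable (UnitRoot.limitRatio Z k k) ν ∧
          |∫ ω, UnitRoot.ratio Ψ ε T j k k ω ∂μ - ∫ ω, UnitRoot.limitRatio Z k k ω ∂ν| ≤
            C * (T : ℝ) ^ (-(1 / 2) : ℝ) := by
  have hβ : 0 ≤ 1 + |κ| := by positivity
  refine ⟨UnitRoot.finalConst (1 + |κ|), UnitRoot.finalConst_pos hβ, fun b hb => ?_⟩
  obtain ⟨T₀, hT₀⟩ := UnitRoot.eventually_log_le_rpow (128 * (B ^ 2 / b ^ 2))
  refine ⟨T₀, fun T hT n Ω _ μ _ ε Ψ Ω' _ ν _ Z hε hΨ hZ hZlaw j k hk => ?_⟩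
  obtain ⟨hT13, hTb⟩ := hT₀ T hT
  obtain ⟨k, rfl⟩ : ∃ k' : ℕ, k = k'.succPNat := ⟨k.natPred, by simp⟩
  have hk' : k < T - 1 := by simpa [Nat.succPNat_coe] using hk
  have hae : ∀ t, AEMeasurable (ε j t) μ := fun t => (hε.memLp j t).1.aemeasurable
  -- The noise is only almost everywhere measurable. Countably many times allow a simultaneous
  -- measurable version outside one null set; the same is done for `Z`.
  set ξ : ℤ → Ω → ℝ := fun t => (hae t).mk
  have hξ : ∀ t, ε j t =ᵐ[μ] ξ t := fun t => (hae t).ae_eq_mk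
  have hξall : ∀ᵐ ω ∂μ, ∀ t, ε j t ω = ξ t ω := ae_all_iff.2 hξ
  set ζ : ℕ → Ω' → ℝ := fun i => (hZlaw i.succPNat).aemeasurable.mk
  have hζ : ∀ i, Z i.succPNat =ᵐ[ν] ζ i := fun i => (hZlaw i.succPNat).aemeasurable.ae_eq_mk
  have hζall : ∀ᵐ ω ∂ν, ∀ i, Z i.succPNat ω = ζ i ω := ae_all_iff.2 hζ
  have hind : iIndepFun ξ μ :=
    (hε.indep.precomp (g := fun t : ℤ => (j, t)) fun a b hab => by simpa using hab).congr hξ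
  have hζind : iIndepFun ζ ν := (hZ.precomp Nat.succPNat_injective).congr hζ
  have hcube := fun t => UnitRoot.integrable_abs_cube_of_memLp (hε.memLp j t) (hε.moment_le j t)
  have hcongr : ∀ (f : ℝ → ℝ) t, ∫ ω, f (ξ t ω) ∂μ = ∫ ω, f (ε j t ω) ∂μ := fun f t =>
    integral_congr_ae ((hξ t).mono fun ω hω => by simp only [hω])
  have main := UnitRoot.abs_integral_process_sub_limit_le (ψ := fun l => Ψ l j j) hβ
    (fun t => (hae t).measurable_mk) hind
    (fun t => (((hε.memLp j t).mono_exponent (by norm_num)).ae_eq (hξ t)))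
    (fun t => (hcongr (fun x => x) t).trans (hε.mean_zero j t))
    (fun t => (hcongr (fun x => x ^ 2) t).trans (hε.var_one j t))
    (fun t => (hcube t).1.congr ((hξ t).mono fun ω hω => congrArg (fun x => |x| ^ 3) hω))
    (fun t => (hcongr (fun x => |x| ^ 3) t).trans_le (hcube t).2)
    (hΨ.summable j) (hΨ.upper j) hb (hΨ.lower j)
    (fun i => (hZlaw i.succPNat).aemeasurable.measurable_mk) hζind
    (fun i => (hZlaw _).congr (hζ i).symm) hT13 hTb ⟨k, hk'⟩
  have e1 : UnitRoot.ratio Ψ ε T j (k.succPNat : ℕ) (k.succPNat : ℕ) =ᵐ[μ] _ :=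
    hξall.mono fun ω hω => UnitRoot.ratio_eq hΨ.diag hω T (k + 1)
  have e2 : UnitRoot.limitRatio Z k.succPNat k.succPNat =ᵐ[ν] _ :=
    hζall.mono fun ω hω => UnitRoot.limitRatio_eq hω k
  rw [integral_congr_ae e1, integral_congr_ae e2]
  exact ⟨main.1.congr e1.symm, main.2.1.congr e2.symm, main.2.2⟩
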